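/- Let $G$ be a locally compact (Hausdorff) group, let $\mathrm{VN}(G)\subset\mathcal B(L^2(G))$ be its group von Neumann algebra, generated by the left regular representation $\lambda$, and let $A(G)=\mathrm{VN}(G)_*$ be its Fourier algebra, with its operator space structure as the predual of $\mathrm{VN}(G)$; an element $u\in A(G)$ is identified with the function $s\mapsto u(\lambda(s))$ on $G$. Let $\mathcal{M}_{\mathrm{cb}}(A(G))$ be the algebra of all completely bounded operators on $A(G)$ of the form $M_f\colon u\mapsto fu$ for some function $f\colon G\to\mathbb C$, with the completely bounded norm and the operator space structure inherited from $\mathcal{CB}(A(G))$; $M_f$ is identified with $f$. Let $A_{\mathrm{cb}}(G)$ be the norm closure of $A(G)$ in $\mathcal{M}_{\mathrm{cb}}(A(G))$. Then $A(G)\subset A_{\mathrm{cb}}(G)$, and $A_{\mathrm{cb}}(G)$ is a quantized Banach algebra, i.e. a complete operator space whose multiplication is (jointly) completely bounded. It is commutative, semisimple, regular (for every closed subset $F$ of the character space and every character $\varphi\notin F$ there is $a\in A_{\mathrm{cb}}(G)$ whose Gelfand transform vanishes on $F$ and equals $1$ at $\varphi$) and Tauberian (the elements whose Gelfand transform has compact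 support are dense in $A_{\mathrm{cb}}(G)$). Its character space is canonically identified with $G$: the map sending $x\in G$ to the point evaluation $f\mapsto f(x)$ is a homeomorphism of $G$ onto the character space of $A_{\mathrm{cb}}(G)$. -/

import Mathlib

noncomputable section

/-- The matrix product `α x β` of scalar matrices `α`, `β` with a matrix `x` over a vector space. -/
def matSandwich {ι κ E : Type*} [Fintype κ] [AddCommGroup E] [Module ℂ E]
    (α : Matrix ι κ ℂ) (x : Matrix κ κ E) (β : Matrix κ ι ℂ) : Matrix ι ι E :=
  fun i j => ∑ k, ∑ l, (α i k * β l j) • x k l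

section L2norm

open scoped Matrix.Norms.L2Operator

/-- The norm of a rectangular scalar matrix as an operator between Euclidean spaces. -/
def scalarOpNorm {ι κ : Type*} [Fintype ι] [Fintype κ] (α : Matrix ι κ ℂ) : ℝ :=
  letI := Classical.decEq κ
  ‖α‖

theorem scalarOpNorm_nonneg {ι κ : Type*} [Fintype ι] [Fintype κ] (α : Matrix ι κ ℂ) :
    0 ≤ scalarOpNorm α := by
  let := Classical.decEq κ
  exact norm_nonneg α

theorem scalarOpNorm_bound {ι κ : Type*} [Fintype ι] [Fintype κ] (α : Matrix ι κ ℂ) (v : κ → ℂ) :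
    ∑ i, ‖∑ k, α i k * v k‖ ^ 2 ≤ scalarOpNorm α ^ 2 * ∑ k, ‖v k‖ ^ 2 := by
  let := Classical.decEq κ
  have h := Matrix.l2_opNorm_mulVec α (WithLp.toLp 2 v)
  have h2 := pow_le_pow_left₀ (norm_nonneg _) h 2
  rw [mul_pow, EuclideanSpace.norm_sq_eq, EuclideanSpace.norm_sq_eq] at h2
  simpa [Matrix.mulVec, dotProduct, scalarOpNorm] using h2

theorem scalarOpNorm_le {ι κ : Type*} [Fintype ι] [Fintype κ] (α : Matrix ι κ ℂ) {C : ℝ}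
    (hC : 0 ≤ C) (h : ∀ v : κ → ℂ, ∑ i, ‖∑ k, α i k * v k‖ ^ 2 ≤ C ^ 2 * ∑ k, ‖v k‖ ^ 2) :
    scalarOpNorm α ≤ C := by
  let := Classical.decEq κ
  unfold scalarOpNorm
  rw [Matrix.l2_opNorm_def]
  refine ContinuousLinearMap.opNorm_le_bound _ hC fun v => ?_
  refine (sq_le_sq₀ (norm_nonneg _) (by positivity)).mp ?_
  rw [mul_pow, EuclideanSpace.norm_sq_eq, EuclideanSpace.norm_sq_eq]
  simpa [Matrix.mulVec, dotProduct] using h v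

theorem scalarOpNorm_conjTranspose {ι κ : Type*} [Fintype ι] [Fintype κ] (α : Matrix ι κ ℂ) :
    scalarOpNorm α.conjTranspose = scalarOpNorm α := by
  let := Classical.decEq κ
  let := Classical.decEq ι
  exact Matrix.l2_opNorm_conjTranspose α

end L2norm

/-- The `0-1` matrix of a map `f`. -/
def selMat {ι κ : Type*} (f : κ → ι) : Matrix κ ι ℂ :=
  letI := Classical.decEq ι
  fun k i => if f k = i then 1 else 0

theorem scalarOpNorm_selMat_le {ι κ : Type*} [Fintype ι] [Fintype κ] (f : κ → ι)
    (hf : Function.Injective f) : scalarOpNorm (selMat f) ≤ 1 := by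
  classical
  refine scalarOpNorm_le _ zero_le_one fun v => ?_
  have : ∀ k, ∑ i, selMat f k i * v i = v (f k) := fun k => by simp [selMat]
  simp only [this, one_pow, one_mul]
  rw [← Finset.sum_image (f := fun i => ‖v i‖ ^ 2) (s := Finset.univ) (g := f) hf.injOn]
  exact Finset.sum_le_sum_of_subset_of_nonneg (Finset.subset_univ _) fun _ _ _ => by positivity

theorem scalarOpNorm_selMat_transpose_le {ι κ : Type*} [Fintype ι] [Fintype κ] (f : κ → ι)
    (hf : Function.Injective f) : scalarOpNorm (selMat f).transpose ≤ 1 := by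
  classical
  have : (selMat f).transpose = (selMat f).conjTranspose := by
    ext i k
    simp only [Matrix.transpose_apply, Matrix.conjTranspose_apply, selMat]
    split_ifs <;> simp
  rw [this, scalarOpNorm_conjTranspose]
  exact scalarOpNorm_selMat_le f hf

theorem scalarOpNorm_kronecker_one_le {ι κ μ : Type*} [Fintype ι] [Fintype κ] [Fintype μ]
    [DecidableEq μ] (α : Matrix ι κ ℂ) :
    scalarOpNorm (fun (p : ι × μ) (q : κ × μ) => if p.2 = q.2 then α p.1 q.1 else 0) ≤
      scalarOpNorm α := by
  refine scalarOpNorm_le _ (scalarOpNorm_nonneg _) fun v => ?_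
  have h : ∀ p : ι × μ, ∑ q : κ × μ, (if p.2 = q.2 then α p.1 q.1 else 0) * v q =
      ∑ k, α p.1 k * v (k, p.2) := fun p => by
    rw [Fintype.sum_prod_type]
    simp
  simp only [h]
  rw [Fintype.sum_prod_type_right, Fintype.sum_prod_type_right, Finset.mul_sum]
  exact Finset.sum_le_sum fun m _ => scalarOpNorm_bound α fun k => v (k, m)

/-- An (abstract) operator space structure on a normed space: norms on all finite square matrices
that restrict to the given norm on `1 × 1` matrices and satisfy Ruan's axioms. Matrices are indexed
by arbitrary finite types, which amounts to `n × n` matrices for all `n`. -/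
class OperatorSpace (E : Type*) [NormedAddCommGroup E] [NormedSpace ℂ E] where
  /-- The norm on square matrices with entries in `E`. -/
  mnorm : ∀ {ι : Type} [Fintype ι], Matrix ι ι E → ℝ
  mnorm_add_le : ∀ {ι : Type} [Fintype ι] (x y : Matrix ι ι E), mnorm (x + y) ≤ mnorm x + mnorm y
  mnorm_smul : ∀ {ι : Type} [Fintype ι] (c : ℂ) (x : Matrix ι ι E),
    mnorm (c • x) = ‖c‖ * mnorm x
  eq_zero_of_mnorm : ∀ {ι : Type} [Fintype ι] (x : Matrix ι ι E), mnorm x = 0 → x = 0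
  mnorm_unit : ∀ x : E, mnorm (fun _ _ : Unit => x) = ‖x‖
  mnorm_fromBlocks : ∀ {ι κ : Type} [Fintype ι] [Fintype κ] (x : Matrix ι ι E) (y : Matrix κ κ E),
    mnorm (Matrix.fromBlocks x 0 0 y) = max (mnorm x) (mnorm y)
  mnorm_sandwich_le : ∀ {ι κ : Type} [Fintype ι] [Fintype κ] (α : Matrix ι κ ℂ)
    (x : Matrix κ κ E) (β : Matrix κ ι ℂ),
    mnorm (matSandwich α x β) ≤ scalarOpNorm α * mnorm x * scalarOpNorm β

theorem matSandwich_selMat {ι κ E : Type*} [Fintype ι] [AddCommGroup E] [Module ℂ E]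
    (f g : κ → ι) (x : Matrix ι ι E) :
    matSandwich (selMat f) x (selMat g).transpose = x.submatrix f g := by
  classical
  ext i j
  simp [matSandwich, selMat, Matrix.transpose_apply]

/-- Auxiliary: matrix norms satisfying everything but the lower bound for block matrices. -/
abbrev OperatorSpace.mk' {E : Type*} [NormedAddCommGroup E] [NormedSpace ℂ E]
    (mnorm : ∀ {ι : Type} [Fintype ι], Matrix ι ι E → ℝ)
    (nonneg : ∀ {ι : Type} [Fintype ι] (x : Matrix ι ι E), 0 ≤ mnorm x)
    (add_le : ∀ {ι : Type} [Fintype ι] (x y : Matrix ι ι E), mnorm (x + y) ≤ mnorm x + mnorm y)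
    (smul_le : ∀ {ι : Type} [Fintype ι] (c : ℂ) (x : Matrix ι ι E),
      mnorm (c • x) ≤ ‖c‖ * mnorm x)
    (unit : ∀ x : E, mnorm (fun _ _ : Unit => x) = ‖x‖)
    (fromBlocks_le : ∀ {ι κ : Type} [Fintype ι] [Fintype κ] (x : Matrix ι ι E)
      (y : Matrix κ κ E), mnorm (Matrix.fromBlocks x 0 0 y) ≤ max (mnorm x) (mnorm y))
    (sandwich_le : ∀ {ι κ : Type} [Fintype ι] [Fintype κ] (α : Matrix ι κ ℂ)
      (x : Matrix κ κ E) (β : Matrix κ ι ℂ),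
      mnorm (matSandwich α x β) ≤ scalarOpNorm α * mnorm x * scalarOpNorm β) :
    OperatorSpace E :=
  have submatrix_le : ∀ {ι κ : Type} [Fintype ι] [Fintype κ] (f g : κ → ι)
      (_ : Function.Injective f) (_ : Function.Injective g) (x : Matrix ι ι E),
      mnorm (x.submatrix f g) ≤ mnorm x := by
    intro ι κ _ _ f g hf hg x
    rw [← matSandwich_selMat]
    refine (sandwich_le _ _ _).trans ?_
    calc _ ≤ 1 * mnorm x * 1 :=
          mul_le_mul (mul_le_mul_of_nonneg_right (scalarOpNorm_selMat_le f hf) (nonneg x))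
            (scalarOpNorm_selMat_transpose_le g hg) (scalarOpNorm_nonneg _)
            (mul_nonneg zero_le_one (nonneg x))
      _ = mnorm x := by ring
  { mnorm := mnorm
    mnorm_add_le := add_le
    mnorm_smul := by
      intro ι _ c x
      refine le_antisymm (smul_le c x) ?_
      rcases eq_or_ne c 0 with rfl | hc
      · simpa using nonneg _
      · have h := smul_le c⁻¹ (c • x)
        rw [inv_smul_smul₀ hc, norm_inv] at h
        have hc' : 0 < ‖c‖ := norm_pos_iff.2 hc
        calc ‖c‖ * mnorm x ≤ ‖c‖ * (‖c‖⁻¹ * mnorm (c • x)) :=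
              mul_le_mul_of_nonneg_left h hc'.le
          _ = mnorm (c • x) := by field_simp
    eq_zero_of_mnorm := by
      intro ι _ x hx
      ext i j
      have h := submatrix_le (fun _ : Unit => i) (fun _ => j)
        (Function.injective_of_subsingleton _) (Function.injective_of_subsingleton _) x
      rw [hx] at h
      have h2 : ‖x i j‖ ≤ 0 := by rw [← unit]; exact h
      simpa using norm_le_zero_iff.1 h2
    mnorm_unit := unit
    mnorm_fromBlocks := by
      intro ι κ _ _ x y
      refine le_antisymm (fromBlocks_le x y) (max_le ?_ ?_)
      · exact submatrix_le Sum.inl Sum.inl Sum.inl_injective Sum.inl_injective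
          (Matrix.fromBlocks x 0 0 y)
      · exact submatrix_le Sum.inr Sum.inr Sum.inr_injective Sum.inr_injective
          (Matrix.fromBlocks x 0 0 y)
    mnorm_sandwich_le := sandwich_le }

namespace OperatorSpace

section basic

variable {E : Type*} [NormedAddCommGroup E] [NormedSpace ℂ E] [OperatorSpace E]

theorem mnorm_zero {ι : Type} [Fintype ι] : mnorm (0 : Matrix ι ι E) = 0 := by
  simpa using mnorm_smul (0 : ℂ) (0 : Matrix ι ι E)

theorem mnorm_nonneg {ι : Type} [Fintype ι] (x : Matrix ι ι E) : 0 ≤ mnorm x := by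
  have h := mnorm_add_le x (-x)
  have h2 := mnorm_smul (-1 : ℂ) x
  rw [add_neg_cancel, mnorm_zero] at h
  simp only [neg_smul, one_smul, norm_neg, norm_one, one_mul] at h2
  linarith

theorem mnorm_sum_le {ι σ : Type} [Fintype ι] (s : Finset σ) (x : σ → Matrix ι ι E) :
    mnorm (∑ a ∈ s, x a) ≤ ∑ a ∈ s, mnorm (x a) := by
  classical
  induction s using Finset.induction_on with
  | empty => simp [mnorm_zero]
  | insert a s ha ih =>
    rw [Finset.sum_insert ha, Finset.sum_insert ha]
    exact (mnorm_add_le _ _).trans (by linarith)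

theorem mnorm_sandwich_le_of_le_one {ι κ : Type} [Fintype ι] [Fintype κ] (α : Matrix ι κ ℂ)
    (x : Matrix κ κ E) (β : Matrix κ ι ℂ) (hα : scalarOpNorm α ≤ 1) (hβ : scalarOpNorm β ≤ 1) :
    mnorm (matSandwich α x β) ≤ mnorm x := by
  refine (mnorm_sandwich_le _ _ _).trans ?_
  calc _ ≤ 1 * mnorm x * 1 :=
        mul_le_mul (mul_le_mul_of_nonneg_right hα (mnorm_nonneg x)) hβ (scalarOpNorm_nonneg _)
          (mul_nonneg zero_le_one (mnorm_nonneg x))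
    _ = mnorm x := by ring

theorem mnorm_submatrix_le {ι κ : Type} [Fintype ι] [Fintype κ] (f g : κ → ι)
    (hf : Function.Injective f) (hg : Function.Injective g) (x : Matrix ι ι E) :
    mnorm (x.submatrix f g) ≤ mnorm x := by
  rw [← matSandwich_selMat]
  exact mnorm_sandwich_le_of_le_one _ _ _ (scalarOpNorm_selMat_le f hf)
    (scalarOpNorm_selMat_transpose_le g hg)

theorem mnorm_reindex {ι κ : Type} [Fintype ι] [Fintype κ] (e : κ ≃ ι) (x : Matrix ι ι E) :
    mnorm (x.submatrix e e) = mnorm x := by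
  refine le_antisymm (mnorm_submatrix_le e e e.injective e.injective x) ?_
  have h := mnorm_submatrix_le e.symm e.symm e.symm.injective e.symm.injective (x.submatrix e e)
  simpa using h

end basic

/-- The operator space structure that a normed space inherits through an isometric linear map into
an operator space. -/
abbrev induced {E F : Type*} [NormedAddCommGroup E] [NormedSpace ℂ E] [NormedAddCommGroup F]
    [NormedSpace ℂ F] [OperatorSpace F] (f : E →ₗᵢ[ℂ] F) : OperatorSpace E where
  mnorm x := mnorm (x.map f)
  mnorm_add_le x y := by
    rw [Matrix.map_add f (map_add f)]
    exact mnorm_add_le _ _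
  mnorm_smul c x := by
    rw [← mnorm_smul]
    congr 1
    ext i j
    simp
  eq_zero_of_mnorm x hx := by
    have h := eq_zero_of_mnorm _ hx
    ext i j
    have h2 := congrFun (congrFun h i) j
    exact f.injective (by simpa using h2)
  mnorm_unit x := by
    rw [← f.norm_map, ← mnorm_unit]
    rfl
  mnorm_fromBlocks x y := by
    rw [← mnorm_fromBlocks, Matrix.fromBlocks_map, Matrix.map_zero _ (map_zero f),
      Matrix.map_zero _ (map_zero f)]
  mnorm_sandwich_le α x β := by
    have : (matSandwich α x β).map f = matSandwich α (x.map f) β := by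
      ext i j
      simp [matSandwich]
    rw [this]
    exact mnorm_sandwich_le _ _ _

section concrete

variable {H : Type*} [NormedAddCommGroup H] [InnerProductSpace ℂ H]

/-- A matrix `[x_{ij}]` of bounded operators on `H`, as an operator on the Hilbert space direct
sum of copies of `H`: `(x h)_i = ∑_j x_{ij} h_j`. -/
def matOp {ι : Type} [Fintype ι] (x : Matrix ι ι (H →L[ℂ] H)) :
    PiLp 2 (fun _ : ι => H) →L[ℂ] PiLp 2 (fun _ : ι => H) :=
  ((PiLp.continuousLinearEquiv 2 ℂ (fun _ : ι => H)).symm :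
      (ι → H) →L[ℂ] PiLp 2 (fun _ : ι => H)) ∘L
    ContinuousLinearMap.pi fun i => ∑ j, (x i j) ∘L PiLp.proj 2 (fun _ : ι => H) j

theorem matOp_apply {ι : Type} [Fintype ι] (x : Matrix ι ι (H →L[ℂ] H))
    (h : PiLp 2 (fun _ : ι => H)) (i : ι) : matOp x h i = ∑ j, x i j (h j) := by
  simp [matOp]

theorem norm_matOp_le {ι : Type} [Fintype ι] (x : Matrix ι ι (H →L[ℂ] H)) {C : ℝ} (hC : 0 ≤ C)
    (h : ∀ v : ι → H, ∑ i, ‖∑ j, x i j (v j)‖ ^ 2 ≤ C ^ 2 * ∑ j, ‖v j‖ ^ 2) : ‖matOp x‖ ≤ C := by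
  refine ContinuousLinearMap.opNorm_le_bound _ hC fun v => ?_
  refine (sq_le_sq₀ (norm_nonneg _) (by positivity)).mp ?_
  rw [mul_pow, PiLp.norm_sq_eq_of_L2, PiLp.norm_sq_eq_of_L2]
  simpa only [matOp_apply] using h v

theorem matOp_bound {ι : Type} [Fintype ι] (x : Matrix ι ι (H →L[ℂ] H)) (v : ι → H) :
    ∑ i, ‖∑ j, x i j (v j)‖ ^ 2 ≤ ‖matOp x‖ ^ 2 * ∑ j, ‖v j‖ ^ 2 := by
  have h2 := pow_le_pow_left₀ (norm_nonneg _) ((matOp x).le_opNorm (WithLp.toLp 2 v)) 2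
  rw [mul_pow, PiLp.norm_sq_eq_of_L2, PiLp.norm_sq_eq_of_L2] at h2
  simpa only [matOp_apply] using h2

theorem scalarOpNorm_bound_hilbert {ι κ : Type*} [Fintype ι] [Fintype κ] (α : Matrix ι κ ℂ)
    (v : κ → H) :
    ∑ i, ‖∑ k, α i k • v k‖ ^ 2 ≤ scalarOpNorm α ^ 2 * ∑ k, ‖v k‖ ^ 2 := by
  let S : Submodule ℂ H := Submodule.span ℂ (Set.range v)
  have : FiniteDimensional ℂ S := FiniteDimensional.span_of_finite ℂ (Set.finite_range v)
  let w : κ → S := fun k => ⟨v k, Submodule.subset_span ⟨k, rfl⟩⟩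
  let b := stdOrthonormalBasis ℂ S
  have key : ∀ s : S, ‖s‖ ^ 2 = ∑ a, ‖b.repr s a‖ ^ 2 := fun s => by
    rw [← b.repr.norm_map s, EuclideanSpace.norm_sq_eq]
  have h1 : ∀ i, ‖∑ k, α i k • v k‖ ^ 2 = ∑ a, ‖∑ k, α i k * b.repr (w k) a‖ ^ 2 := fun i => by
    have : ∑ k, α i k • v k = ((∑ k, α i k • w k : S) : H) := by simp [w]
    rw [this, Submodule.norm_coe, key]
    simp
  have h2 : ∀ k, ‖v k‖ ^ 2 = ∑ a, ‖b.repr (w k) a‖ ^ 2 := fun k => by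
    rw [← key]; rfl
  simp only [h1, h2]
  rw [Finset.sum_comm, Finset.sum_comm (s := (Finset.univ : Finset κ)), Finset.mul_sum]
  exact Finset.sum_le_sum fun a _ => scalarOpNorm_bound α fun k => b.repr (w k) a

/-- The canonical operator space structure of `B(H)`: a matrix over `B(H)` has the norm of the
operator that it defines on the Hilbert space direct sum of copies of `H`. -/
instance instBoundedOperators : OperatorSpace (H →L[ℂ] H) :=
  OperatorSpace.mk' (fun x => ‖matOp x‖) (fun x => (matOp x).opNorm_nonneg)
    (by
      intro ι _ x y
      have : matOp (x + y) = matOp x + matOp y := by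
        ext v i
        simp [matOp_apply, Finset.sum_add_distrib]
      rw [this]
      exact ContinuousLinearMap.opNorm_add_le _ _)
    (by
      intro ι _ c x
      have : matOp (c • x) = c • matOp x := by
        ext v i
        simp [matOp_apply, Finset.smul_sum]
      rw [this]
      exact ContinuousLinearMap.opNorm_smul_le _ _)
    (by
      intro x
      refine le_antisymm (norm_matOp_le _ (norm_nonneg x) fun v => ?_) ?_
      · simp only [Finset.univ_unique, Finset.sum_singleton]
        rw [← mul_pow]
        exact pow_le_pow_left₀ (norm_nonneg _) (x.le_opNorm _) 2
      · refine ContinuousLinearMap.opNorm_le_bound _ (ContinuousLinearMap.opNorm_nonneg _) fun v => ?_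
        have h := matOp_bound (fun _ _ : Unit => x) (fun _ => v)
        simp only [Finset.univ_unique, Finset.sum_singleton] at h
        rw [← mul_pow] at h
        exact (sq_le_sq₀ (norm_nonneg _) (by positivity)).mp h)
    (by
      intro ι κ _ _ x y
      refine norm_matOp_le _ (le_max_of_le_left (matOp x).opNorm_nonneg) fun v => ?_
      have hx := matOp_bound x (fun i => v (Sum.inl i))
      have hy := matOp_bound y (fun i => v (Sum.inr i))
      simp only [Fintype.sum_sum_type, Matrix.fromBlocks_apply₁₁, Matrix.fromBlocks_apply₁₂,
        Matrix.fromBlocks_apply₂₁, Matrix.fromBlocks_apply₂₂, Matrix.zero_apply,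
        zero_apply, Finset.sum_const_zero, add_zero, zero_add]
      rw [mul_add]
      refine add_le_add (hx.trans ?_) (hy.trans ?_)
      · exact mul_le_mul_of_nonneg_right
          (pow_le_pow_left₀ (matOp x).opNorm_nonneg (le_max_left _ _) 2) (by positivity)
      · exact mul_le_mul_of_nonneg_right
          (pow_le_pow_left₀ (matOp y).opNorm_nonneg (le_max_right _ _) 2) (by positivity))
    (by
      intro ι κ _ _ α x β
      refine norm_matOp_le _ (mul_nonneg (mul_nonneg (scalarOpNorm_nonneg _) (matOp x).opNorm_nonneg)
        (scalarOpNorm_nonneg _)) fun v => ?_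
      have e : ∀ i, ∑ j, matSandwich α x β i j (v j) =
          ∑ k, α i k • ∑ l, x k l (∑ j, β l j • v j) := fun i => by
        simp only [matSandwich, sum_apply, smul_apply,
          map_sum, map_smul, Finset.smul_sum, smul_smul]
        rw [Finset.sum_comm]
        refine Finset.sum_congr rfl fun k _ => ?_
        rw [Finset.sum_comm]
      simp only [e]
      have h1 := scalarOpNorm_bound_hilbert α (fun k => ∑ l, x k l (∑ j, β l j • v j))
      have h2 := matOp_bound x (fun l => ∑ j, β l j • v j)
      have h3 := scalarOpNorm_bound_hilbert β v
      calc _ ≤ _ := h1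
        _ ≤ scalarOpNorm α ^ 2 * (‖matOp x‖ ^ 2 * (scalarOpNorm β ^ 2 * ∑ k, ‖v k‖ ^ 2)) := by
            gcongr
            exact h2.trans (by gcongr)
        _ = _ := by ring)

end concrete

/-- The operator space `ℂ = B(ℂ)`. -/
instance instComplex : OperatorSpace ℂ :=
  induced (F := ℂ →L[ℂ] ℂ)
    { (ContinuousLinearMap.lsmul ℂ ℂ : ℂ →L[ℂ] ℂ →L[ℂ] ℂ).toLinearMap with
      norm_map' := fun z => by simp }

end OperatorSpace

open OperatorSpace

section CB

variable {V W : Type*} [NormedAddCommGroup V] [NormedSpace ℂ V] [OperatorSpace V]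
  [NormedAddCommGroup W] [NormedSpace ℂ W] [OperatorSpace W]

variable (V W) in
/-- The completely bounded linear maps between operator spaces. -/
def cbMaps : Submodule ℂ (V →ₗ[ℂ] W) where
  carrier := {T | ∃ C : ℝ, ∀ (κ : Type) [Fintype κ] (x : Matrix κ κ V),
    mnorm (x.map T) ≤ C * mnorm x}
  add_mem' := by
    rintro S T ⟨C, hC⟩ ⟨D, hD⟩
    refine ⟨C + D, fun κ _ x => ?_⟩
    have : x.map (S + T) = x.map S + x.map T := by ext i j; simp
    rw [this, add_mul]
    exact (mnorm_add_le _ _).trans (add_le_add (hC κ x) (hD κ x))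
  zero_mem' := by
    refine ⟨0, fun κ _ x => ?_⟩
    have : x.map (0 : V →ₗ[ℂ] W) = 0 := by ext i j; simp
    rw [this, mnorm_zero, zero_mul]
  smul_mem' := by
    rintro c T ⟨C, hC⟩
    refine ⟨‖c‖ * C, fun κ _ x => ?_⟩
    have : x.map (c • T) = c • x.map T := by ext i j; simp
    rw [this, mnorm_smul, mul_assoc]
    exact mul_le_mul_of_nonneg_left (hC κ x) (norm_nonneg c)

variable (V W) in
/-- The space `CB(V, W)` of completely bounded linear maps between operator spaces. -/
def CB : Type _ := cbMaps V W

namespace CB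

instance instAddCommGroup : AddCommGroup (CB V W) := inferInstanceAs (AddCommGroup (cbMaps V W))

instance instModule : Module ℂ (CB V W) := inferInstanceAs (Module ℂ (cbMaps V W))

/-- The underlying linear map. -/
def toLin (T : CB V W) : V →ₗ[ℂ] W := Subtype.val T

instance instFunLike : FunLike (CB V W) V W where
  coe T := T.toLin
  coe_injective _ _ h := Subtype.ext (DFunLike.coe_injective h)

instance instLinearMapClass : LinearMapClass (CB V W) ℂ V W where
  map_add T := T.toLin.map_add
  map_smulₛₗ T := T.toLin.map_smul

@[ext]
theorem ext {S T : CB V W} (h : ∀ v, S v = T v) : S = T := DFunLike.ext _ _ h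

@[simp]
theorem add_apply (S T : CB V W) (v : V) : (S + T) v = S v + T v := rfl

@[simp]
theorem smul_apply (c : ℂ) (T : CB V W) (v : V) : (c • T) v = c • T v := rfl

@[simp]
theorem zero_apply (v : V) : (0 : CB V W) v = 0 := rfl

theorem sum_apply {σ : Type*} (s : Finset σ) (T : σ → CB V W) (v : V) :
    (∑ a ∈ s, T a) v = ∑ a ∈ s, T a v := by
  classical
  induction s using Finset.induction_on with
  | empty => rfl
  | insert a s ha ih => rw [Finset.sum_insert ha, Finset.sum_insert ha, add_apply, ih]

theorem exists_bound (T : CB V W) : ∃ C : ℝ, ∀ (κ : Type) [Fintype κ] (x : Matrix κ κ V),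
    mnorm (x.map T) ≤ C * mnorm x := Subtype.property T

/-- The application of a matrix `[T_{ij}]` of maps to a matrix `[x_{kl}]`, namely the matrix
`[T_{ij} x_{kl}]` with rows indexed by `(i, k)` and columns indexed by `(j, l)`. -/
def amp {ι κ : Type} (T : Matrix ι ι (CB V W)) (x : Matrix κ κ V) :
    Matrix (ι × κ) (ι × κ) W :=
  fun p q => T p.1 q.1 (x p.2 q.2)

/-- The bounds for a matrix of completely bounded maps, seen as a map from `V` to a space of
matrices over `W`. -/
def bounds {ι : Type} [Fintype ι] (T : Matrix ι ι (CB V W)) : Set ℝ :=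
  {C | 0 ≤ C ∧ ∀ (κ : Type) [Fintype κ] (x : Matrix κ κ V), mnorm (amp T x) ≤ C * mnorm x}

/-- The norm of a matrix `[T_{ij}]` over `CB(V, W)`: the completely bounded norm of the map
`v ↦ [T_{ij} v]` from `V` to the matrices over `W`. -/
def matNorm {ι : Type} [Fintype ι] (T : Matrix ι ι (CB V W)) : ℝ := sInf (bounds T)

theorem bounds_nonempty {ι : Type} [Fintype ι] (T : Matrix ι ι (CB V W)) :
    (bounds T).Nonempty := by
  choose C hC using fun i j => (T i j).exists_bound
  refine ⟨∑ i, ∑ j, |C i j|, by positivity, fun κ _ x => ?_⟩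
  have e : amp T x = ∑ i, ∑ j, matSandwich (selMat fun k : κ => (i, k)).transpose
      (x.map (T i j)) (selMat fun k : κ => (j, k)) := by
    classical
    ext p q
    obtain ⟨i, k⟩ := p
    obtain ⟨j, l⟩ := q
    simp only [Matrix.sum_apply, matSandwich, Matrix.transpose_apply, selMat, Prod.mk.injEq,
      Matrix.map_apply, amp]
    rw [Finset.sum_eq_single i, Finset.sum_eq_single j, Finset.sum_eq_single k,
      Finset.sum_eq_single l]
    · simp
    · intro b _ hb; simp [hb]
    · simp
    · intro b _ hb; simp [hb]
    · simp
    · intro b _ hb; simp [hb]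
    · simp
    · intro b _ hb; simp [hb]
    · simp
  rw [e, Finset.sum_mul]
  refine (mnorm_sum_le _ _).trans (Finset.sum_le_sum fun i _ => ?_)
  rw [Finset.sum_mul]
  refine (mnorm_sum_le _ _).trans (Finset.sum_le_sum fun j _ => ?_)
  refine (mnorm_sandwich_le_of_le_one _ _ _
    (scalarOpNorm_selMat_transpose_le _ fun a b h => (Prod.mk.inj h).2)
    (scalarOpNorm_selMat_le _ fun a b h => (Prod.mk.inj h).2)).trans ?_
  exact (hC i j κ x).trans (mul_le_mul_of_nonneg_right (le_abs_self _) (mnorm_nonneg x))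

theorem bounds_bddBelow {ι : Type} [Fintype ι] (T : Matrix ι ι (CB V W)) :
    BddBelow (bounds T) := ⟨0, fun _ h => h.1⟩

theorem matNorm_nonneg {ι : Type} [Fintype ι] (T : Matrix ι ι (CB V W)) : 0 ≤ matNorm T :=
  le_csInf (bounds_nonempty T) fun _ h => h.1

theorem matNorm_le {ι : Type} [Fintype ι] (T : Matrix ι ι (CB V W)) {C : ℝ} (h0 : 0 ≤ C)
    (h : ∀ (κ : Type) [Fintype κ] (x : Matrix κ κ V), mnorm (amp T x) ≤ C * mnorm x) :
    matNorm T ≤ C := csInf_le (bounds_bddBelow T) ⟨h0, h⟩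

theorem le_matNorm {ι κ : Type} [Fintype ι] [Fintype κ] (T : Matrix ι ι (CB V W))
    (x : Matrix κ κ V) : mnorm (amp T x) ≤ matNorm T * mnorm x := by
  rcases (mnorm_nonneg x).eq_or_lt with h | h
  · obtain ⟨C, hC⟩ := bounds_nonempty T
    have := hC.2 κ x
    rw [← h] at this ⊢
    simpa using this
  · rw [← div_le_iff₀ h]
    exact le_csInf (bounds_nonempty T) fun C hC => (div_le_iff₀ h).2 (hC.2 κ x)

/-- The norm of `CB(V, W)` is the completely bounded norm. -/
instance instNorm : Norm (CB V W) :=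
  ⟨fun T => sInf {C : ℝ | 0 ≤ C ∧ ∀ (κ : Type) [Fintype κ] (x : Matrix κ κ V),
    mnorm (x.map T) ≤ C * mnorm x}⟩

theorem mnorm_amp_unit {κ : Type} [Fintype κ] (T : CB V W) (x : Matrix κ κ V) :
    mnorm (amp (fun _ _ : Unit => T) x) = mnorm (x.map T) := by
  rw [← mnorm_reindex (Equiv.punitProd κ) (x.map T)]
  rfl

theorem matNorm_unit (T : CB V W) : matNorm (fun _ _ : Unit => T) = ‖T‖ := by
  simp only [matNorm, bounds, mnorm_amp_unit]
  rfl

theorem mnorm_map_le {κ : Type} [Fintype κ] (T : CB V W) (x : Matrix κ κ V) :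
    mnorm (x.map T) ≤ ‖T‖ * mnorm x := by
  rw [← mnorm_amp_unit, ← matNorm_unit]
  exact le_matNorm _ _

theorem norm_le (T : CB V W) {C : ℝ} (h0 : 0 ≤ C)
    (h : ∀ (κ : Type) [Fintype κ] (x : Matrix κ κ V),
      mnorm (x.map T) ≤ C * mnorm x) : ‖T‖ ≤ C := by
  rw [← matNorm_unit]
  refine matNorm_le _ h0 fun κ _ x => ?_
  rw [mnorm_amp_unit]
  exact h κ x

theorem norm_nonneg' (T : CB V W) : 0 ≤ ‖T‖ := by
  rw [← matNorm_unit]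
  exact matNorm_nonneg _

theorem norm_apply_le (T : CB V W) (v : V) : ‖T v‖ ≤ ‖T‖ * ‖v‖ := by
  rw [← mnorm_unit, ← mnorm_unit v]
  exact mnorm_map_le T (fun _ _ : Unit => v)

theorem matNorm_add_le {ι : Type} [Fintype ι] (S T : Matrix ι ι (CB V W)) :
    matNorm (S + T) ≤ matNorm S + matNorm T := by
  refine matNorm_le _ (add_nonneg (matNorm_nonneg S) (matNorm_nonneg T)) fun κ _ x => ?_
  have : amp (S + T) x = amp S x + amp T x := by ext p q; simp [amp]
  rw [this, add_mul]
  exact (mnorm_add_le _ _).trans (add_le_add (le_matNorm S x) (le_matNorm T x))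

theorem matNorm_smul_le {ι : Type} [Fintype ι] (c : ℂ) (T : Matrix ι ι (CB V W)) :
    matNorm (c • T) ≤ ‖c‖ * matNorm T := by
  refine matNorm_le _ (mul_nonneg (norm_nonneg c) (matNorm_nonneg T)) fun κ _ x => ?_
  have : amp (c • T) x = c • amp T x := by ext p q; simp [amp]
  rw [this, mnorm_smul, mul_assoc]
  exact mul_le_mul_of_nonneg_left (le_matNorm T x) (norm_nonneg c)

theorem normCore : NormedSpace.Core ℂ (CB V W) where
  norm_nonneg := norm_nonneg'
  norm_smul c T := by
    have hle : ∀ (c : ℂ) (T : CB V W), ‖c • T‖ ≤ ‖c‖ * ‖T‖ := fun c T => by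
      rw [← matNorm_unit, ← matNorm_unit]
      exact matNorm_smul_le c _
    refine le_antisymm (hle c T) ?_
    rcases eq_or_ne c 0 with rfl | hc
    · simpa using norm_nonneg' _
    · have h := hle c⁻¹ (c • T)
      rw [inv_smul_smul₀ hc, norm_inv] at h
      have hc' : 0 < ‖c‖ := norm_pos_iff.2 hc
      calc ‖c‖ * ‖T‖ ≤ ‖c‖ * (‖c‖⁻¹ * ‖c • T‖) := mul_le_mul_of_nonneg_left h hc'.le
        _ = ‖c • T‖ := by field_simp
  norm_triangle S T := by
    rw [← matNorm_unit, ← matNorm_unit, ← matNorm_unit]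
    exact matNorm_add_le _ _
  norm_eq_zero_iff T := by
    constructor
    · intro h
      ext v
      have := norm_apply_le T v
      rw [h, zero_mul] at this
      simpa using norm_le_zero_iff.1 this
    · rintro rfl
      refine le_antisymm (norm_le _ le_rfl fun κ _ x => ?_) (norm_nonneg' _)
      have : x.map (0 : CB V W) = 0 := by ext i j; simp
      rw [this, mnorm_zero, zero_mul]

instance instNormedAddCommGroup : NormedAddCommGroup (CB V W) :=
  NormedAddCommGroup.ofCore normCore

instance instNormedSpace : NormedSpace ℂ (CB V W) :=
  NormedSpace.ofCore normCore

theorem matNorm_fromBlocks_le {ι μ : Type} [Fintype ι] [Fintype μ] (S : Matrix ι ι (CB V W))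
    (T : Matrix μ μ (CB V W)) :
    matNorm (Matrix.fromBlocks S 0 0 T) ≤ max (matNorm S) (matNorm T) := by
  refine matNorm_le _ (le_max_of_le_left (matNorm_nonneg S)) fun κ _ x => ?_
  have e : amp (Matrix.fromBlocks S 0 0 T) x =
      (Matrix.fromBlocks (amp S x) 0 0 (amp T x)).submatrix (Equiv.sumProdDistrib ι μ κ)
        (Equiv.sumProdDistrib ι μ κ) := by
    ext ⟨p, k⟩ ⟨q, l⟩
    rcases p with p | p <;> rcases q with q | q <;> simp [amp]
  rw [e, mnorm_reindex, mnorm_fromBlocks]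
  refine max_le ((le_matNorm S x).trans ?_) ((le_matNorm T x).trans ?_)
  · exact mul_le_mul_of_nonneg_right (le_max_left _ _) (mnorm_nonneg x)
  · exact mul_le_mul_of_nonneg_right (le_max_right _ _) (mnorm_nonneg x)

theorem matNorm_sandwich_le {ι μ : Type} [Fintype ι] [Fintype μ] (α : Matrix ι μ ℂ)
    (T : Matrix μ μ (CB V W)) (β : Matrix μ ι ℂ) :
    matNorm (matSandwich α T β) ≤ scalarOpNorm α * matNorm T * scalarOpNorm β := by
  refine matNorm_le _ (mul_nonneg (mul_nonneg (scalarOpNorm_nonneg _) (matNorm_nonneg T))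
    (scalarOpNorm_nonneg _)) fun κ _ x => ?_
  classical
  have e : amp (matSandwich α T β) x =
      matSandwich (fun (p : ι × κ) (q : μ × κ) => if p.2 = q.2 then α p.1 q.1 else 0)
        (amp T x) (fun (p : μ × κ) (q : ι × κ) => if p.2 = q.2 then β p.1 q.1 else 0) := by
    ext p q
    simp only [amp, matSandwich, Fintype.sum_prod_type, sum_apply, smul_apply]
    simp [ite_mul, mul_ite, ite_smul, Finset.sum_ite_eq, Finset.sum_ite_eq']
  rw [e]
  refine (mnorm_sandwich_le _ _ _).trans ?_
  calc _ ≤ scalarOpNorm α * (matNorm T * mnorm x) * scalarOpNorm β := by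
        refine mul_le_mul (mul_le_mul (scalarOpNorm_kronecker_one_le α) (le_matNorm T x)
          (mnorm_nonneg _) (scalarOpNorm_nonneg _)) (scalarOpNorm_kronecker_one_le β)
          (scalarOpNorm_nonneg _) (mul_nonneg (scalarOpNorm_nonneg _)
            (mul_nonneg (matNorm_nonneg T) (mnorm_nonneg x)))
    _ = _ := by ring

/-- The canonical operator space structure of `CB(V, W)`. -/
instance instOperatorSpace : OperatorSpace (CB V W) :=
  OperatorSpace.mk' (fun T => matNorm T) matNorm_nonneg matNorm_add_le matNorm_smul_le
    matNorm_unit matNorm_fromBlocks_le matNorm_sandwich_le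

end CB

end CB

namespace CB

variable {E : Type*} [NormedAddCommGroup E] [NormedSpace ℂ E] [OperatorSpace E]

/-- The product of `CB(E) = CB(E, E)` is the composition of maps. -/
instance instMul : Mul (CB E E) :=
  ⟨fun S T => ⟨S.toLin ∘ₗ T.toLin, ‖S‖ * ‖T‖, fun κ _ x => by
    rw [mul_assoc]
    exact (mnorm_map_le S (x.map T)).trans
      (mul_le_mul_of_nonneg_left (mnorm_map_le T x) (norm_nonneg S))⟩⟩

/-- The unit of `CB(E)` is the identity map. -/
instance instOne : One (CB E E) :=
  ⟨⟨LinearMap.id, 1, fun κ _ x => by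
    have : x.map (LinearMap.id : E →ₗ[ℂ] E) = x := by ext i j; simp
    rw [this, one_mul]⟩⟩

theorem mul_apply (S T : CB E E) (v : E) :
    (S * T) v = S (T v) := rfl

theorem one_apply (v : E) : (1 : CB E E) v = v := rfl

instance instNormedRing : NormedRing (CB E E) :=
  { (instNormedAddCommGroup : NormedAddCommGroup (CB E E)), instMul, instOne with
    left_distrib := fun R S T => by ext v; simp [mul_apply]
    right_distrib := fun R S T => by ext v; simp [mul_apply]
    zero_mul := fun T => by ext v; simp [mul_apply]
    mul_zero := fun T => by ext v; simp [mul_apply]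
    mul_assoc := fun R S T => by ext v; simp [mul_apply]
    one_mul := fun T => by ext v; simp [mul_apply, one_apply]
    mul_one := fun T => by ext v; simp [mul_apply, one_apply]
    norm_mul_le := fun S T => by
      refine norm_le _ (mul_nonneg (norm_nonneg S) (norm_nonneg T)) fun κ _ x => ?_
      rw [mul_assoc]
      exact (mnorm_map_le S (x.map T)).trans
        (mul_le_mul_of_nonneg_left (mnorm_map_le T x) (norm_nonneg S)) }

instance instAlgebra : Algebra ℂ (CB E E) :=
  Algebra.ofModule (fun c S T => by ext v; simp [mul_apply])
    (fun c S T => by ext v; simp [mul_apply])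

end CB

instance CB.instNormedAlgebra {E : Type*} [NormedAddCommGroup E] [NormedSpace ℂ E]
    [OperatorSpace E] : NormedAlgebra ℂ (CB E E) where
  norm_smul_le := norm_smul_le

/-- A quantized Banach algebra: a complete operator space with a multiplication that is (jointly)
completely bounded: the norms of the maps `([a_{ij}], [b_{kl}]) ↦ [a_{ij} b_{kl}]` are uniformly
bounded. -/
def IsQuantizedBanachAlgebra (A : Type*) [NonUnitalNormedRing A] [NormedSpace ℂ A]
    [OperatorSpace A] : Prop :=
  CompleteSpace A ∧ ∃ C : ℝ, ∀ (ι κ : Type) [Fintype ι] [Fintype κ] (a : Matrix ι ι A)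
    (b : Matrix κ κ A),
    mnorm (fun (p q : ι × κ) => a p.1 q.1 * b p.2 q.2) ≤ C * mnorm a * mnorm b

section Gelfand

variable {A : Type*} [NonUnitalNormedRing A] [NormedSpace ℂ A]

/-- The Gelfand transform `φ ↦ φ a` of `a` as a function on the character space. -/
def gelfandFun (a : A) : WeakDual.characterSpace ℂ A → ℂ := fun φ => φ a

variable (A)

/-- Semisimplicity of a commutative Banach algebra: the Gelfand transform is injective. -/
def IsGelfandSemisimple : Prop := Function.Injective (gelfandFun (A := A))

/-- Regularity of a commutative Banach algebra: Gelfand transforms separate points of the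
character space from closed sets. -/
def IsRegularBanachAlgebra : Prop :=
  ∀ F : Set (WeakDual.characterSpace ℂ A), IsClosed F → ∀ φ ∉ F,
    ∃ a : A, (∀ ψ ∈ F, gelfandFun a ψ = 0) ∧ gelfandFun a φ = 1

/-- A commutative Banach algebra is Tauberian if the elements whose Gelfand transforms have compact
support are dense. -/
def IsTauberian : Prop := Dense {a : A | HasCompactSupport (gelfandFun a)}

end Gelfand

section Predual

variable {H : Type*} [NormedAddCommGroup H] [InnerProductSpace ℂ H] [CompleteSpace H]

/-- A von Neumann algebra as a space of operators, with the norm and the operator space structure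
inherited from `B(H)`. -/
def VNSpace (M : VonNeumannAlgebra H) : Type _ := Subalgebra.toSubmodule M.toSubalgebra

namespace VNSpace

variable (M : VonNeumannAlgebra H)

instance instNormedAddCommGroup : NormedAddCommGroup (VNSpace M) :=
  inferInstanceAs (NormedAddCommGroup (Subalgebra.toSubmodule M.toSubalgebra))

instance instNormedSpace : NormedSpace ℂ (VNSpace M) :=
  inferInstanceAs (NormedSpace ℂ (Subalgebra.toSubmodule M.toSubalgebra))

/-- The inclusion of `M` into `B(H)`. -/
def incl : VNSpace M →ₗᵢ[ℂ] (H →L[ℂ] H) := (Subalgebra.toSubmodule M.toSubalgebra).subtypeₗᵢ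

instance instOperatorSpace : OperatorSpace (VNSpace M) := OperatorSpace.induced (incl M)

end VNSpace

/-- The vector functional `T ↦ ⟨T ξ, η⟩` on a von Neumann algebra (inner product linear in its
first variable). -/
def vectorFunctional (M : VonNeumannAlgebra H) (ξ η : H) : CB (VNSpace M) ℂ :=
  ⟨{ toFun := fun T => inner ℂ η (VNSpace.incl M T ξ)
     map_add' := fun S T => by simp
     map_smul' := fun c T => by simp },
   ‖η‖ * ‖ξ‖, fun κ _ x => by
    refine norm_matOp_le _ (mul_nonneg (mul_nonneg (norm_nonneg _) (norm_nonneg _))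
      (mnorm_nonneg x)) fun v => ?_
    have h : _ ≤ mnorm x ^ 2 * _ := matOp_bound (x.map (VNSpace.incl M)) (fun j => v j • ξ)
    simp only [Matrix.map_apply] at h
    have e : ∀ i, ∑ j, inner ℂ η (VNSpace.incl M (x i j) ξ) * v j =
        inner ℂ η (∑ j, VNSpace.incl M (x i j) (v j • ξ)) := fun i => by
      simp [mul_comm]
    calc _ = ∑ i, ‖∑ j, inner ℂ η (VNSpace.incl M (x i j) ξ) * v j‖ ^ 2 := rfl
      _ ≤ ∑ i, ‖η‖ ^ 2 * ‖∑ j, VNSpace.incl M (x i j) (v j • ξ)‖ ^ 2 := by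
          refine Finset.sum_le_sum fun i _ => ?_
          rw [e, ← mul_pow]
          exact pow_le_pow_left₀ (norm_nonneg _) (norm_inner_le_norm _ _) 2
      _ ≤ ‖η‖ ^ 2 * (mnorm x ^ 2 * ∑ j, ‖v j • ξ‖ ^ 2) := by
          rw [← Finset.mul_sum]
          exact mul_le_mul_of_nonneg_left h (by positivity)
      _ = _ := by
          simp only [norm_smul, mul_pow, ← Finset.sum_mul]
          ring⟩

/-- The normal functionals on a von Neumann algebra `M`, as a subspace of the operator space dual
`M^* = CB(M, ℂ)`: the norm closure of the linear span of the vector functionals. -/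
def normalFunctionals (M : VonNeumannAlgebra H) : Submodule ℂ (CB (VNSpace M) ℂ) :=
  (Submodule.span ℂ {φ | ∃ ξ η : H, φ = vectorFunctional M ξ η}).topologicalClosure

/-- The predual `M_*` of a von Neumann algebra `M`, with the operator space structure inherited
from `M^* = CB(M, ℂ)`. -/
def VNPredual (M : VonNeumannAlgebra H) : Type _ := normalFunctionals M

namespace VNPredual

variable (M : VonNeumannAlgebra H)

instance instNormedAddCommGroup : NormedAddCommGroup (VNPredual M) :=
  inferInstanceAs (NormedAddCommGroup (normalFunctionals M))

instance instNormedSpace : NormedSpace ℂ (VNPredual M) :=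
  inferInstanceAs (NormedSpace ℂ (normalFunctionals M))

/-- The inclusion of `M_*` into `M^*`. -/
def incl : VNPredual M →ₗᵢ[ℂ] CB (VNSpace M) ℂ := (normalFunctionals M).subtypeₗᵢ

instance instOperatorSpace : OperatorSpace (VNPredual M) := OperatorSpace.induced (incl M)

end VNPredual

end Predual

section Group

open MeasureTheory

variable (G : Type*) [Group G] [TopologicalSpace G] [IsTopologicalGroup G] [LocallyCompactSpace G]
  [MeasurableSpace G] [BorelSpace G]

/-- The Hilbert space `L²(G)` with respect to left Haar measure. -/
abbrev GroupL2 : Type _ := Lp ℂ 2 (Measure.haar : Measure G)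

variable {G} in
/-- The left regular representation: `(λ(s) ξ)(t) = ξ(s⁻¹ t)`. -/
def leftRegular (s : G) : GroupL2 G →L[ℂ] GroupL2 G :=
  (Lp.compMeasurePreservingₗᵢ ℂ (fun t : G => s⁻¹ * t)
    (measurePreserving_mul_left (Measure.haar : Measure G) s⁻¹)).toContinuousLinearMap

/-- The group von Neumann algebra `VN(G)`, generated by the left regular representation: the double
commutant of `{λ(s) : s ∈ G}`. -/
def groupVN : VonNeumannAlgebra (GroupL2 G) where
  toStarSubalgebra := StarSubalgebra.centralizer ℂ
    (StarSubalgebra.centralizer ℂ (Set.range (leftRegular (G := G))) :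
      Set (GroupL2 G →L[ℂ] GroupL2 G))
  centralizer_centralizer' := by
    simp

variable {G} in
theorem leftRegular_mem (s : G) : leftRegular s ∈ groupVN G := by
  have hsub : Set.range (leftRegular (G := G)) ⊆ Set.centralizer
      (StarSubalgebra.centralizer ℂ (Set.range (leftRegular (G := G))) :
        Set (GroupL2 G →L[ℂ] GroupL2 G)) := by
    rintro _ ⟨t, rfl⟩ T hT
    exact (hT _ (Or.inl ⟨t, rfl⟩)).symm
  have h : leftRegular s ∈ StarSubalgebra.centralizer ℂ
    (StarSubalgebra.centralizer ℂ (Set.range (leftRegular (G := G))) :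
      Set (GroupL2 G →L[ℂ] GroupL2 G)) := by
    rintro T (hT | hT)
    · exact hsub ⟨s, rfl⟩ T hT
    · have h2 : T ∈ StarSubalgebra.centralizer ℂ (Set.range (leftRegular (G := G))) := by
        have := star_mem (Set.mem_star.1 hT : star T ∈ StarSubalgebra.centralizer ℂ
          (Set.range (leftRegular (G := G))))
        rwa [star_star] at this
      exact hsub ⟨s, rfl⟩ T h2
  exact h

variable {G} in
/-- The operator `λ(s)` as an element of `VN(G)`. -/
def leftRegularVN (s : G) : VNSpace (groupVN G) := ⟨leftRegular s, leftRegular_mem s⟩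

/-- The Fourier algebra `A(G) = VN(G)_*` with its operator space structure as the predual of
`VN(G)`. -/
abbrev FourierAlgebra : Type _ := VNPredual (groupVN G)

variable {G}

/-- The function `s ↦ u(λ(s))` on `G` that an element `u` of `A(G) = VN(G)_*` is identified with. -/
def FourierAlgebra.toFun (u : FourierAlgebra G) : G → ℂ := fun s =>
  VNPredual.incl (groupVN G) u (leftRegularVN s)

theorem FourierAlgebra.toFun_add (u v : FourierAlgebra G) (s : G) :
    toFun (u + v) s = toFun u s + toFun v s := by
  simp only [toFun, map_add, CB.add_apply]

theorem FourierAlgebra.toFun_smul (c : ℂ) (u : FourierAlgebra G) (s : G) :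
    toFun (c • u) s = c * toFun u s := by
  simp only [toFun, map_smul, CB.smul_apply, smul_eq_mul]

theorem FourierAlgebra.toFun_zero (s : G) : toFun (0 : FourierAlgebra G) s = 0 := by
  simp only [toFun, map_zero, CB.zero_apply]

/-- The operator `T` on `A(G)` is the multiplication operator `M_f : u ↦ f u`. -/
def IsMulBy (T : CB (FourierAlgebra G) (FourierAlgebra G)) (f : G → ℂ) : Prop :=
  ∀ (u : FourierAlgebra G) (s : G),
    FourierAlgebra.toFun (T u) s = f s * FourierAlgebra.toFun u s

theorem IsMulBy.mul {S T : CB (FourierAlgebra G) (FourierAlgebra G)} {f g : G → ℂ}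
    (hS : IsMulBy S f) (hT : IsMulBy T g) : IsMulBy (S * T) (fun s => f s * g s) := fun u s => by
  rw [CB.mul_apply, hS, hT, mul_assoc]

theorem IsMulBy.add {S T : CB (FourierAlgebra G) (FourierAlgebra G)} {f g : G → ℂ}
    (hS : IsMulBy S f) (hT : IsMulBy T g) : IsMulBy (S + T) (fun s => f s + g s) := fun u s => by
  rw [CB.add_apply, FourierAlgebra.toFun_add, hS, hT, add_mul]

theorem IsMulBy.smul {T : CB (FourierAlgebra G) (FourierAlgebra G)} {f : G → ℂ} (c : ℂ)
    (hT : IsMulBy T f) : IsMulBy (c • T) (fun s => c * f s) := fun u s => by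
  rw [CB.smul_apply, FourierAlgebra.toFun_smul, hT, mul_assoc]

theorem IsMulBy.zero : IsMulBy (0 : CB (FourierAlgebra G) (FourierAlgebra G)) 0 := fun u s => by
  rw [CB.zero_apply, FourierAlgebra.toFun_zero, Pi.zero_apply, zero_mul]

theorem IsMulBy.one : IsMulBy (1 : CB (FourierAlgebra G) (FourierAlgebra G)) 1 := fun u s => by
  rw [CB.one_apply, Pi.one_apply, one_mul]

variable (G)

/-- The completely bounded operators on `A(G)` of the form `M_f : u ↦ f u` for some function `f`
on `G`. -/
def cbMultipliers : Subalgebra ℂ (CB (FourierAlgebra G) (FourierAlgebra G)) where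
  carrier := {T | ∃ f : G → ℂ, IsMulBy T f}
  mul_mem' := fun ⟨_, hf⟩ ⟨_, hg⟩ => ⟨_, hf.mul hg⟩
  add_mem' := fun ⟨_, hf⟩ ⟨_, hg⟩ => ⟨_, hf.add hg⟩
  algebraMap_mem' := fun c => by
    rw [Algebra.algebraMap_eq_smul_one]
    exact ⟨_, IsMulBy.one.smul c⟩

/-- The algebra `M_cb(A(G))` of completely bounded multipliers of `A(G)`, a subalgebra of
`CB(A(G))`. -/
def Mcb : Type _ := cbMultipliers G

namespace Mcb

instance instNormedRing : NormedRing (Mcb G) := inferInstanceAs (NormedRing (cbMultipliers G))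

instance instNormedAlgebra : NormedAlgebra ℂ (Mcb G) :=
  inferInstanceAs (NormedAlgebra ℂ (cbMultipliers G))

/-- The inclusion of `M_cb(A(G))` into `CB(A(G))`. -/
def incl : Mcb G →ₗᵢ[ℂ] CB (FourierAlgebra G) (FourierAlgebra G) where
  toLinearMap := (cbMultipliers G).val.toLinearMap
  norm_map' _ := rfl

instance instOperatorSpace : OperatorSpace (Mcb G) := OperatorSpace.induced (incl G)

end Mcb

/-- The Fourier algebra `A(G)` inside `M_cb(A(G))`: the completely bounded multipliers `M_f` whose
symbol `f` belongs to `A(G)`. -/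
def fourierMultipliers : NonUnitalSubalgebra ℂ (Mcb G) where
  carrier := {T | ∃ v : FourierAlgebra G, IsMulBy (Mcb.incl G T) (FourierAlgebra.toFun v)}
  mul_mem' := by
    rintro S T ⟨v, hv⟩ ⟨w, hw⟩
    refine ⟨Mcb.incl G S w, ?_⟩
    rw [funext (hv w)]
    exact hv.mul hw
  add_mem' := by
    rintro S T ⟨v, hv⟩ ⟨w, hw⟩
    refine ⟨v + w, ?_⟩
    rw [funext (FourierAlgebra.toFun_add v w)]
    exact hv.add hw
  zero_mem' := by
    refine ⟨0, ?_⟩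
    rw [funext FourierAlgebra.toFun_zero]
    exact IsMulBy.zero
  smul_mem' := by
    rintro c T ⟨v, hv⟩
    refine ⟨c • v, ?_⟩
    rw [funext (FourierAlgebra.toFun_smul c v)]
    exact hv.smul c

/-- `A_cb(G)`: the closure of `A(G)` in `M_cb(A(G))`. -/
def Acb : Type _ := (fourierMultipliers G).topologicalClosure

namespace Acb

instance instNonUnitalNormedRing : NonUnitalNormedRing (Acb G) :=
  inferInstanceAs (NonUnitalNormedRing (fourierMultipliers G).topologicalClosure)

instance instNormedSpace : NormedSpace ℂ (Acb G) :=
  inferInstanceAs (NormedSpace ℂ (fourierMultipliers G).topologicalClosure.toSubmodule)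

/-- The inclusion of `A_cb(G)` into `M_cb(A(G))`. -/
def incl : Acb G →ₗᵢ[ℂ] Mcb G where
  toLinearMap := (fourierMultipliers G).topologicalClosure.toSubmodule.subtype
  norm_map' _ := rfl

instance instOperatorSpace : OperatorSpace (Acb G) := OperatorSpace.induced (incl G)

variable {G} in
/-- The element `T` of `A_cb(G)` is the multiplication operator `M_f`, that is, `T` is identified
with the function `f` on `G`. -/
def IsSymbol (T : Acb G) (f : G → ℂ) : Prop := IsMulBy (Mcb.incl G (Acb.incl G T)) f

end Acb

end Group

end

/-! Everything is computed on coefficients `s ↦ ⟨λ(s)ξ, η⟩` of the regular representation. Since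
VN(G) is the dual of its predual, the vector functionals of unit vectors taken from a dense subspace
of L²(G) norm that dual. By Hahn-Banach and a successive approximation, every element of A(G) is
then an absolutely convergent combination of such functionals
(`VNPredual.exists_l1Combination_unitVec`); the dense subspace is the image of `C_c(G)`. A double
commutant argument in an amplification of L²(G) shows that an element of A(G) is determined by its
function on G (`FourierAlgebra.ext_toFun`).

That A(G) consists of completely bounded multipliers is Fell absorption. For f in `C_c(G)` let W_f
map ξ to `b ↦ f(b) λ(b⁻¹)ξ`, an element of L²(G) ⊗ L²(G); its norm is at most ‖f‖. Then W_g* (λ(s) ⊗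
1) W_f = v(s) λ(s), where v is the coefficient given by f and g. Hence T ↦ W_g* (T ⊗ 1) W_f is a
normal completely bounded map of VN(G) of norm at most ‖f‖‖g‖, and its preadjoint is multiplication
by v. Absolutely convergent sums give all of A(G). The multipliers form a closed subalgebra of the
complete algebra CB(A(G)), where composition is jointly completely contractive, so A_cb(G) is a
quantized Banach algebra; it is an algebra of functions, hence commutative and semisimple.

For the characters, the point is local. If f is supported near 1 and g near x, then W_f ξ is close
to f ⊗ ξ and W_g η to g ⊗ λ(x⁻¹)η. So, with k the coefficient of f, g and u that of ξ, η, the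
product uk is close to u(x)k in A(G). One can take k = 1 near x while ‖f‖‖g‖ ≤ 2, however small the
supports are. If a character φ takes the value 1 at every k that is 1 near x, then φ(u) = φ(uk) ≈
u(x), and φ is evaluation at x. If no x has this property, a finite cover of the support of a
compactly supported u gives u ∏(1 - k_i) = 0 with all φ(k_i) ≠ 1, so φ(u) = 0; by density φ = 0,
which is absurd. The same functions k show that evaluation is a homeomorphism and that A_cb(G) is
regular; density of the compactly supported functions makes it Tauberian. -/

noncomputable section

/-! ### Absolutely convergent expansions along a norming family -/

/-- The summation of an absolutely summable family of multiples of the members of a bounded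
family in a Banach space. -/
def l1Combination {ι A : Type*} [NormedAddCommGroup A] [NormedSpace ℂ A] [CompleteSpace A]
    (d : ι → A) (hd : ∀ i, ‖d i‖ ≤ 1) : lp (fun _ : ι => ℂ) 1 →L[ℂ] A :=
  (lp.tsumCLM ℂ ι A) ∘L
    lp.mapCLM 1 (fun i => ContinuousLinearMap.toSpanSingleton ℂ (d i)) zero_le_one
      fun i => by simpa using hd i

theorem hasSum_l1Combination {ι A : Type*} [NormedAddCommGroup A] [NormedSpace ℂ A]
    [CompleteSpace A] (d : ι → A) (hd : ∀ i, ‖d i‖ ≤ 1) (c : lp (fun _ : ι => ℂ) 1) :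
    HasSum (fun i => c i • d i) (l1Combination d hd c) := by
  have := (lp.memℓp (lp.mapCLM 1 (fun i => ContinuousLinearMap.toSpanSingleton ℂ (d i)) zero_le_one
      (fun i => by simpa using hd i) c)).summable_of_one
  exact this.hasSum

theorem l1Combination_single {ι A : Type*} [NormedAddCommGroup A] [NormedSpace ℂ A]
    [CompleteSpace A] [DecidableEq ι] (d : ι → A) (hd : ∀ i, ‖d i‖ ≤ 1) (i : ι) (z : ℂ) :
    l1Combination d hd (lp.single 1 i z) = z • d i := by
  refine (hasSum_l1Combination d hd _).unique ?_
  convert hasSum_single i ?_ using 1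
  · simp
  · intro j hj
    simp [hj]

/-- If the functionals of norm at most `1` on a bounded family are of norm at most `1`, then the
closed absolutely convex hull of the family contains the unit ball. -/
theorem exists_l1_approx {ι A : Type*} [NormedAddCommGroup A] [NormedSpace ℂ A]
    [CompleteSpace A] (d : ι → A) (hd : ∀ i, ‖d i‖ ≤ 1)
    (hn : ∀ F : StrongDual ℂ A, (∀ i, ‖F (d i)‖ ≤ 1) → ‖F‖ ≤ 1) (u : A) :
    ∃ c : lp (fun _ : ι => ℂ) 1, ‖c‖ ≤ ‖u‖ ∧ ‖u - l1Combination d hd c‖ ≤ ‖u‖ / 2 := by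
  classical
  rcases eq_or_ne u 0 with rfl | hu
  · exact ⟨0, by simp, by simp⟩
  have hu' : 0 < ‖u‖ := norm_pos_iff.2 hu
  set E : Set A := closure (l1Combination d hd '' Metric.closedBall 0 ‖u‖) with hE
  have hmem : u ∈ E := by
    by_contra hnot
    have hconv : Convex ℝ E := by
      refine Convex.closure ?_
      exact (convex_closedBall _ _).linear_image ((l1Combination d hd).toLinearMap.restrictScalars ℝ)
    obtain ⟨F, s, hF, hs⟩ := RCLike.geometric_hahn_banach_closed_point (𝕜 := ℂ) hconv
      isClosed_closure hnot
    have hs0 : 0 < s := by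
      have := hF 0 (subset_closure ⟨0, by simp, by simp⟩)
      simpa using this
    have hFd : ∀ i, ‖F (d i)‖ ≤ s / ‖u‖ := fun i => by
      rcases eq_or_ne (F (d i)) 0 with h0 | h0
      · rw [h0, norm_zero]; positivity
      have hn0 : ‖F (d i)‖ ≠ 0 := norm_ne_zero_iff.2 h0
      -- A multiple of `d i` of length ‖u‖, rotated so that F takes a nonnegative real value on it.
      let z : ℂ := ‖u‖ * (starRingEnd ℂ (F (d i)) / ‖F (d i)‖)
      have hz : ‖z‖ = ‖u‖ := by
        simp [z, hn0]
      have h1 := hF (l1Combination d hd (lp.single 1 i z)) (subset_closure ⟨_, by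
        rw [mem_closedBall_zero_iff, lp.norm_single one_pos, hz], rfl⟩)
      rw [l1Combination_single, map_smul, smul_eq_mul] at h1
      have h2 : z * F (d i) = ((‖u‖ * ‖F (d i)‖ : ℝ) : ℂ) := by
        have : (‖F (d i)‖ : ℂ) ≠ 0 := by exact_mod_cast hn0
        simp only [z]
        rw [mul_assoc, div_mul_eq_mul_div, Complex.conj_mul']
        push_cast
        field_simp
      rw [h2] at h1
      rw [le_div_iff₀ hu', mul_comm]
      exact le_of_lt (by simpa using h1)
    have hs' : 0 < s / ‖u‖ := by positivity
    -- The norming hypothesis for the rescaled functional gives ‖F‖ ≤ s/‖u‖, so Re F(u) ≤ s, against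
    -- the strict separation `hs`.
    have hG : ‖((s / ‖u‖ : ℝ) : ℂ)⁻¹ • F‖ ≤ 1 := hn _ fun i => by
      have := hFd i
      rw [smul_apply, norm_smul, norm_inv, Complex.norm_real, Real.norm_of_nonneg hs'.le]
      rwa [inv_mul_le_iff₀ hs', mul_one]
    rw [norm_smul, norm_inv, Complex.norm_real, Real.norm_of_nonneg hs'.le, inv_mul_le_iff₀ hs',
      mul_one] at hG
    have h3 : RCLike.re (F u) ≤ s := by
      refine (RCLike.re_le_norm _).trans ((F.le_opNorm u).trans ?_)
      calc _ ≤ s / ‖u‖ * ‖u‖ := by gcongr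
        _ = s := by field_simp
    linarith
  obtain ⟨_, ⟨c, hc, rfl⟩, h⟩ := Metric.mem_closure_iff.1 hmem (‖u‖ / 2) (by positivity)
  exact ⟨c, by simpa using hc, by rw [← dist_eq_norm]; exact h.le⟩

/-- If the functionals of norm at most `1` on a bounded family are of norm at most `1`, then every
vector is an absolutely convergent combination of the family. -/
theorem exists_l1Combination_eq {ι A : Type*} [NormedAddCommGroup A] [NormedSpace ℂ A]
    [CompleteSpace A] (d : ι → A) (hd : ∀ i, ‖d i‖ ≤ 1)
    (hn : ∀ F : StrongDual ℂ A, (∀ i, ‖F (d i)‖ ≤ 1) → ‖F‖ ≤ 1) (u : A) :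
    ∃ c : lp (fun _ : ι => ℂ) 1, ‖c‖ ≤ 2 * ‖u‖ ∧ l1Combination d hd c = u := by
  choose a ha ha' using exists_l1_approx d hd hn
  let r : ℕ → A := fun n => (fun v => v - l1Combination d hd (a v))^[n] u
  have hr : ∀ n, r (n + 1) = r n - l1Combination d hd (a (r n)) := fun n => by
    simp only [r, Function.iterate_succ_apply']
  -- Each correction halves the remainder. The bound ‖u‖/2ⁿ is written in the shape of
  -- `hasSum_geometric_two'`; its sum 2‖u‖ is the constant of the theorem.
  have hrn : ∀ n, ‖r n‖ ≤ ‖u‖ / 2 / 2 ^ n * 2 := fun n => by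
    induction n with
    | zero => simp [r]
    | succ n ih =>
      rw [hr]
      refine (ha' _).trans ?_
      rw [pow_succ]
      calc _ ≤ (‖u‖ / 2 / 2 ^ n * 2) / 2 := by gcongr
        _ = _ := by field_simp
  have hsum : HasSum (fun n => ‖u‖ / 2 / 2 ^ n * 2) (‖u‖ * 2) := (hasSum_geometric_two' ‖u‖).mul_right 2
  have hle : ∀ n, ‖a (r n)‖ ≤ ‖u‖ / 2 / 2 ^ n * 2 := fun n => (ha _).trans (hrn n)
  have hsa : Summable fun n => a (r n) := Summable.of_norm_bounded hsum.summable hle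
  refine ⟨∑' n, a (r n), (tsum_of_norm_bounded hsum hle).trans_eq (mul_comm _ _), ?_⟩
  have h1 := (hsa.hasSum.mapL (l1Combination d hd)).tendsto_sum_nat
  have h2 : ∀ n, ∑ i ∈ Finset.range n, l1Combination d hd (a (r i)) = u - r n := fun n => by
    induction n with
    | zero => simp [r]
    | succ n ih => rw [Finset.sum_range_succ, ih, hr]; abel
  have h3 : Filter.Tendsto r Filter.atTop (nhds 0) :=
    squeeze_zero_norm hrn hsum.summable.tendsto_atTop_zero
  have h4 := tendsto_const_nhds (x := u).sub h3
  rw [sub_zero] at h4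
  exact tendsto_nhds_unique h1 (h4.congr fun n => (h2 n).symm)

end

/-! ### Completeness of CB(V, W) and complete contractivity of composition -/

noncomputable section

open OperatorSpace

/-- A matrix is the sum of its entries placed singly, and placing one entry is a sandwich by
contractive selection matrices. -/
theorem OperatorSpace.mnorm_le_sum {E : Type*} [NormedAddCommGroup E] [NormedSpace ℂ E]
    [OperatorSpace E] {ι : Type} [Fintype ι] (x : Matrix ι ι E) :
    mnorm x ≤ ∑ i, ∑ j, ‖x i j‖ := by
  classical
  have e : x = ∑ i, ∑ j, matSandwich (selMat fun _ : Unit => i).transpose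
      (fun _ _ : Unit => x i j) (selMat fun _ : Unit => j) := by
    ext p q
    simp only [Matrix.sum_apply, matSandwich, Matrix.transpose_apply, selMat, Finset.univ_unique,
      Finset.sum_singleton]
    rw [Finset.sum_eq_single p, Finset.sum_eq_single q]
    · simp
    · intro b _ hb; simp [hb]
    · simp
    · intro b _ hb; simp [hb]
    · simp
  conv_lhs => rw [e]
  refine (mnorm_sum_le _ _).trans (Finset.sum_le_sum fun i _ => ?_)
  refine (mnorm_sum_le _ _).trans (Finset.sum_le_sum fun j _ => ?_)
  rw [← mnorm_unit (x i j)]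
  exact mnorm_sandwich_le_of_le_one _ _ _
    (scalarOpNorm_selMat_transpose_le _ (Function.injective_of_subsingleton _))
    (scalarOpNorm_selMat_le _ (Function.injective_of_subsingleton _))

theorem OperatorSpace.mnorm_sub_rev {E : Type*} [NormedAddCommGroup E] [NormedSpace ℂ E]
    [OperatorSpace E] {ι : Type} [Fintype ι] (x y : Matrix ι ι E) :
    mnorm (x - y) = mnorm (y - x) := by
  have := mnorm_smul (-1 : ℂ) (x - y)
  simpa using this.symm

/-- Matrix norm estimates therefore pass to entrywise limits, which is how complete bounds survive
pointwise limits of maps. -/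
theorem OperatorSpace.continuous_mnorm {E : Type*} [NormedAddCommGroup E] [NormedSpace ℂ E]
    [OperatorSpace E] {ι : Type} [Fintype ι] :
    Continuous (fun x : Matrix ι ι E => mnorm x) := by
  rw [continuous_iff_continuousAt]
  intro x
  rw [ContinuousAt, tendsto_iff_norm_sub_tendsto_zero]
  have hle : ∀ y : Matrix ι ι E, ‖mnorm y - mnorm x‖ ≤ ∑ i, ∑ j, ‖y i j - x i j‖ := fun y => by
    have h1 := mnorm_add_le (y - x) x
    have h2 := mnorm_add_le (x - y) y
    rw [sub_add_cancel] at h1 h2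
    rw [mnorm_sub_rev] at h2
    refine le_trans ?_ (mnorm_le_sum (y - x))
    rw [Real.norm_eq_abs, abs_le]
    constructor <;> linarith
  refine squeeze_zero (fun _ => norm_nonneg _) hle ?_
  have : Continuous fun y : Matrix ι ι E => ∑ i, ∑ j, ‖y i j - x i j‖ := by
    refine continuous_finsetSum _ fun i _ => continuous_finsetSum _ fun j _ => ?_
    fun_prop
  simpa using this.tendsto x

namespace CB

variable {V W : Type*} [NormedAddCommGroup V] [NormedSpace ℂ V] [OperatorSpace V]
  [NormedAddCommGroup W] [NormedSpace ℂ W] [OperatorSpace W]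

@[simp]
theorem sub_apply (S T : CB V W) (v : V) : (S - T) v = S v - T v := rfl

/-- A completely bounded linear map with a bound for its completely bounded norm. -/
def ofBound (T : V →ₗ[ℂ] W) (C : ℝ) (hC : ∀ (κ : Type) [Fintype κ] (x : Matrix κ κ V),
    mnorm (x.map T) ≤ C * mnorm x) : CB V W := ⟨T, C, hC⟩

theorem norm_ofBound_le (T : V →ₗ[ℂ] W) (C : ℝ) (h0 : 0 ≤ C)
    (hC : ∀ (κ : Type) [Fintype κ] (x : Matrix κ κ V),
    mnorm (x.map T) ≤ C * mnorm x) : ‖ofBound T C hC‖ ≤ C := norm_le _ h0 hC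

variable (W) in
/-- The evaluation at a vector, as a bounded operator on `CB(V, W)`. -/
def evalCLM (v : V) : CB V W →L[ℂ] W :=
  LinearMap.mkContinuous
    { toFun := fun T => T v
      map_add' := fun _ _ => rfl
      map_smul' := fun _ _ => rfl } ‖v‖ fun T => by
    rw [mul_comm]; exact norm_apply_le T v

instance instCompleteSpace [CompleteSpace W] : CompleteSpace (CB V W) := by
  refine Metric.complete_of_cauchySeq_tendsto fun T hT => ?_
  have hlim : ∀ v, ∃ w, Filter.Tendsto (fun n => T n v) Filter.atTop (nhds w) := fun v =>
    cauchySeq_tendsto_of_complete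
      ((evalCLM W v).uniformContinuous.comp_cauchySeq hT)
  choose L hL using hlim
  let Llin : V →ₗ[ℂ] W :=
    { toFun := L
      map_add' := fun v w => by
        refine tendsto_nhds_unique (hL (v + w)) ?_
        simpa using (hL v).add (hL w)
      map_smul' := fun c v => by
        refine tendsto_nhds_unique (hL (c • v)) ?_
        simpa using (hL v).const_smul c }
  -- The Cauchy estimate passes to the pointwise limit with one N for all matrix sizes; this is
  -- convergence in the completely bounded norm.
  have key : ∀ ε > 0, ∃ N, ∀ n ≥ N, ∀ (κ : Type) [Fintype κ] (x : Matrix κ κ V),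
      mnorm (x.map (T n) - x.map L) ≤ ε * mnorm x := fun ε hε => by
    obtain ⟨N, hN⟩ := Metric.cauchySeq_iff.1 hT ε hε
    refine ⟨N, fun n hn κ _ x => ?_⟩
    have h1 : Filter.Tendsto (fun m => x.map (T n) - x.map (T m)) Filter.atTop
        (nhds (x.map (T n) - x.map L)) := by
      refine tendsto_const_nhds.sub ?_
      exact tendsto_pi_nhds.2 fun i => tendsto_pi_nhds.2 fun j => hL (x i j)
    refine le_of_tendsto ((continuous_mnorm.tendsto _).comp h1) ?_
    filter_upwards [Filter.eventually_ge_atTop N] with m hm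
    have h2 := mnorm_map_le (T n - T m) x
    have h3 : x.map (T n - T m) = x.map (T n) - x.map (T m) := by ext i j; simp
    rw [h3] at h2
    refine h2.trans (mul_le_mul_of_nonneg_right ?_ (mnorm_nonneg x))
    rw [← dist_eq_norm]
    exact (hN n hn m hm).le
  obtain ⟨N, hN⟩ := key 1 one_pos
  let S : CB V W := ofBound Llin (‖T N‖ + 1) fun κ _ x => by
    have h1 := mnorm_add_le (x.map (T N)) (x.map L - x.map (T N))
    rw [add_sub_cancel, mnorm_sub_rev] at h1
    have h2 := hN N le_rfl κ x
    have h3 := mnorm_map_le (T N) x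
    calc mnorm (x.map L) ≤ _ := h1
      _ ≤ ‖T N‖ * mnorm x + 1 * mnorm x := add_le_add h3 h2
      _ = _ := by ring
  refine ⟨S, ?_⟩
  rw [Metric.tendsto_atTop]
  intro ε hε
  obtain ⟨N, hN⟩ := key (ε / 2) (by positivity)
  refine ⟨N, fun n hn => ?_⟩
  rw [dist_eq_norm]
  refine lt_of_le_of_lt (norm_le _ (by positivity) fun κ _ x => ?_) (half_lt_self hε)
  have h3 : x.map (T n - S) = x.map (T n) - x.map L := by ext i j; rfl
  rw [h3]
  exact hN n hn κ x

/-- The composition of completely bounded maps is multiplicatively contractive on matrices. -/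
theorem mnorm_mul_le {E : Type*} [NormedAddCommGroup E] [NormedSpace ℂ E] [OperatorSpace E]
    {ι κ : Type} [Fintype ι] [Fintype κ] (a : Matrix ι ι (CB E E)) (b : Matrix κ κ (CB E E)) :
    mnorm (fun (p q : ι × κ) => a p.1 q.1 * b p.2 q.2) ≤ mnorm a * mnorm b := by
  refine matNorm_le _ (mul_nonneg (mnorm_nonneg a) (mnorm_nonneg b)) fun μ _ x => ?_
  have e : amp (fun (p q : ι × κ) => a p.1 q.1 * b p.2 q.2) x =
      (amp a (amp b x)).submatrix (Equiv.prodAssoc ι κ μ) (Equiv.prodAssoc ι κ μ) := by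
    ext p q; rfl
  rw [e, mnorm_reindex, mul_assoc]
  exact (le_matNorm a _).trans (mul_le_mul_of_nonneg_left (le_matNorm b x) (matNorm_nonneg a))

end CB

end

/-! ### Amplifications and vector functionals -/

noncomputable section

open OperatorSpace

theorem lp_hasSum_norm_sq {H I : Type*} [NormedAddCommGroup H] (ξ : lp (fun _ : I => H) 2) :
    HasSum (fun i => ‖ξ i‖ ^ 2) (‖ξ‖ ^ 2) := by
  have := lp.hasSum_norm (p := 2) (by simp) ξ
  simpa using this

section Amplification

variable {H : Type*} [NormedAddCommGroup H] [InnerProductSpace ℂ H] {I : Type*}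

/-- The amplification of an operator on `H` to the Hilbert space direct sum of copies of `H`. -/
def lpAmp (I : Type*) (T : H →L[ℂ] H) :
    lp (fun _ : I => H) 2 →L[ℂ] lp (fun _ : I => H) 2 :=
  lp.mapCLM 2 (fun _ => T) (norm_nonneg T) fun _ => le_rfl

@[simp]
theorem lpAmp_apply (T : H →L[ℂ] H) (ξ : lp (fun _ : I => H) 2) (i : I) :
    lpAmp I T ξ i = T (ξ i) := rfl

theorem hasSum_inner_lpAmp (T : H →L[ℂ] H) (ξ η : lp (fun _ : I => H) 2) :
    HasSum (fun i => inner ℂ (η i) (T (ξ i))) (inner ℂ η (lpAmp I T ξ)) :=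
  lp.hasSum_inner η (lpAmp I T ξ)

theorem inner_lpAmp_adjoint [CompleteSpace H] (T : H →L[ℂ] H) (ξ η : lp (fun _ : I => H) 2) :
    inner ℂ (lpAmp I (star T) η) ξ = inner ℂ η (lpAmp I T ξ) := by
  refine (lp.hasSum_inner (lpAmp I (star T) η) ξ).unique ?_
  have e : ∀ i, inner ℂ (lpAmp I (star T) η i) (ξ i) = inner ℂ (η i) (T (ξ i)) := fun i =>
    ContinuousLinearMap.adjoint_inner_left T (ξ i) (η i)
  simpa only [e] using hasSum_inner_lpAmp T ξ η

/-- A matrix of amplifications is of norm at most that of the matrix. -/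
theorem lpAmp_matrix_bound {κ : Type} [Fintype κ] (x : Matrix κ κ (H →L[ℂ] H))
    (ξ : κ → lp (fun _ : I => H) 2) :
    ∑ k, ‖∑ l, lpAmp I (x k l) (ξ l)‖ ^ 2 ≤ mnorm x ^ 2 * ∑ l, ‖ξ l‖ ^ 2 := by
  have h1 : HasSum (fun i => ∑ k, ‖(∑ l, lpAmp I (x k l) (ξ l) : lp (fun _ : I => H) 2) i‖ ^ 2)
      (∑ k, ‖∑ l, lpAmp I (x k l) (ξ l)‖ ^ 2) :=
    hasSum_sum fun k _ => lp_hasSum_norm_sq _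
  have h2 : HasSum (fun i => mnorm x ^ 2 * ∑ l, ‖ξ l i‖ ^ 2) (mnorm x ^ 2 * ∑ l, ‖ξ l‖ ^ 2) :=
    (hasSum_sum fun l _ => lp_hasSum_norm_sq (ξ l)).mul_left _
  -- The matrix acts separately on each coordinate i of the direct sum, so the estimate in H is
  -- summed over i.
  refine hasSum_le (fun i => ?_) h1 h2
  have h3 := matOp_bound x fun l => ξ l i
  simp only [lp.coeFn_sum, Finset.sum_apply, lpAmp_apply]
  exact h3

end Amplification

section Predual

variable {H : Type*} [NormedAddCommGroup H] [InnerProductSpace ℂ H] [CompleteSpace H]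
  (M : VonNeumannAlgebra H)

namespace VNPredual

instance instCompleteSpace : CompleteSpace (VNPredual M) :=
  (Submodule.isClosed_topologicalClosure (Submodule.span ℂ
    {φ | ∃ ξ η : H, φ = vectorFunctional M ξ η})).completeSpace_coe

variable {M} in
theorem ext_apply {u v : VNPredual M} (h : ∀ T, incl M u T = incl M v T) : u = v :=
  (incl M).injective (CB.ext h)

/-- The evaluation of normal functionals at an operator. -/
def eval (T : VNSpace M) : VNPredual M →L[ℂ] ℂ := CB.evalCLM ℂ T ∘L (incl M).toContinuousLinearMap

/-- The vector functional `T ↦ ⟨T ξ, η⟩` as an element of the predual. -/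
def vec (ξ η : H) : VNPredual M :=
  ⟨vectorFunctional M ξ η, subset_closure (Submodule.subset_span ⟨ξ, η, rfl⟩)⟩

@[simp]
theorem incl_vec (ξ η : H) (T : VNSpace M) :
    incl M (vec M ξ η) T = inner ℂ η (VNSpace.incl M T ξ) := rfl

theorem vec_add_left (ξ ξ' η : H) : vec M (ξ + ξ') η = vec M ξ η + vec M ξ' η :=
  ext_apply fun T => by simp

theorem vec_add_right (ξ η η' : H) : vec M ξ (η + η') = vec M ξ η + vec M ξ η' :=
  ext_apply fun T => by simp

theorem vec_smul_left (c : ℂ) (ξ η : H) : vec M (c • ξ) η = c • vec M ξ η :=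
  ext_apply fun T => by simp

theorem vec_smul_right (c : ℂ) (ξ η : H) : vec M ξ (c • η) = starRingEnd ℂ c • vec M ξ η :=
  ext_apply fun T => by simp [mul_comm]

theorem norm_vec_le (ξ η : H) : ‖vec M ξ η‖ ≤ ‖η‖ * ‖ξ‖ := by
  refine CB.norm_le _ (by positivity) fun κ _ x => ?_
  refine norm_matOp_le _ (mul_nonneg (mul_nonneg (norm_nonneg _) (norm_nonneg _))
    (mnorm_nonneg x)) fun v => ?_
  have h : _ ≤ mnorm x ^ 2 * _ := matOp_bound (x.map (VNSpace.incl M)) (fun j => v j • ξ)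
  simp only [Matrix.map_apply] at h
  have e : ∀ i, ∑ j, inner ℂ η (VNSpace.incl M (x i j) ξ) * v j =
      inner ℂ η (∑ j, VNSpace.incl M (x i j) (v j • ξ)) := fun i => by
    simp [mul_comm]
  calc _ = ∑ i, ‖∑ j, inner ℂ η (VNSpace.incl M (x i j) ξ) * v j‖ ^ 2 := rfl
    _ ≤ ∑ i, ‖η‖ ^ 2 * ‖∑ j, VNSpace.incl M (x i j) (v j • ξ)‖ ^ 2 := by
        refine Finset.sum_le_sum fun i _ => ?_
        rw [e, ← mul_pow]
        exact pow_le_pow_left₀ (norm_nonneg _) (norm_inner_le_norm _ _) 2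
    _ ≤ ‖η‖ ^ 2 * (mnorm x ^ 2 * ∑ j, ‖v j • ξ‖ ^ 2) := by
        rw [← Finset.mul_sum]
        exact mul_le_mul_of_nonneg_left h (by positivity)
    _ = _ := by
        simp only [norm_smul, mul_pow, ← Finset.sum_mul]
        ring

/-- The vector functionals as a bounded sesquilinear map. -/
def vecL : H →L⋆[ℂ] H →L[ℂ] VNPredual M :=
  LinearMap.mkContinuous₂ (LinearMap.mk₂'ₛₗ (starRingEnd ℂ) (RingHom.id ℂ)
    (fun η ξ => vec M ξ η) (fun η η' ξ => vec_add_right M ξ η η')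
    (fun c η ξ => vec_smul_right M c ξ η) (fun η ξ ξ' => vec_add_left M ξ ξ' η)
    (fun c η ξ => vec_smul_left M c ξ η)) 1 fun η ξ => by
      rw [one_mul]; exact norm_vec_le M ξ η

theorem continuous_vec : Continuous fun p : H × H => vec M p.1 p.2 := by
  have : Continuous fun p : H × H => vecL M p.2 p.1 := by fun_prop
  exact this

variable {M} in
/-- A closed subspace of the predual that contains the vector functionals of vectors from a dense
set is everything. -/
theorem mem_of_isClosed_of_vec_mem {S : Submodule ℂ (VNPredual M)}
    (hS : IsClosed (S : Set (VNPredual M)))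
    {D : Set H} (hD : Dense D) (h : ∀ ξ ∈ D, ∀ η ∈ D, vec M ξ η ∈ S) (u : VNPredual M) :
    u ∈ S := by
  have h1 : ∀ ξ η, vec M ξ η ∈ S := fun ξ η => by
    have h2 : D ×ˢ D ⊆ (fun p : H × H => vec M p.1 p.2) ⁻¹' (S : Set (VNPredual M)) :=
      fun p hp => h _ hp.1 _ hp.2
    have h3 := closure_minimal h2 (hS.preimage (continuous_vec M))
    rw [(hD.prod hD).closure_eq] at h3
    exact h3 (Set.mem_univ (ξ, η))
  have h2 : ∀ φ ∈ Submodule.span ℂ {φ | ∃ ξ η : H, φ = vectorFunctional M ξ η},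
      φ ∈ S.map (incl M).toLinearMap := fun φ hφ => by
    refine Submodule.span_le.2 ?_ hφ
    rintro _ ⟨ξ, η, rfl⟩
    exact ⟨vec M ξ η, h1 ξ η, rfl⟩
  have h3 : IsClosed (S.map (incl M).toLinearMap : Set (CB (VNSpace M) ℂ)) :=
    (incl M).isometry.isClosedEmbedding.isClosedMap _ hS
  obtain ⟨w, hw, hwu⟩ := closure_minimal h2 h3 u.2
  rwa [(incl M).injective hwu] at hw

end VNPredual

end Predual

end

/-! ### Duality between a von Neumann algebra and its predual -/

noncomputable section

open OperatorSpace

theorem lp_summable_norm_mul_norm {H I : Type*} [NormedAddCommGroup H]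
    (ξ η : lp (fun _ : I => H) 2) :
    Summable (fun i => ‖η i‖ * ‖ξ i‖) ∧ ∑' i, ‖η i‖ * ‖ξ i‖ ≤ ‖η‖ * ‖ξ‖ := by
  have hpq : (2 : ENNReal).toReal.HolderConjugate (2 : ENNReal).toReal := by
    simpa using Real.HolderConjugate.two_two
  exact ⟨lp.summable_mul hpq η ξ, lp.tsum_mul_le_mul_norm' hpq η ξ⟩

universe u

section Predual

variable {H : Type u} [NormedAddCommGroup H] [InnerProductSpace ℂ H] [CompleteSpace H]
  (M : VonNeumannAlgebra H)

namespace VNPredual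

/-- This identity places the operator that represents a functional on the predual in the bicommutant
of M. -/
theorem vec_commutant_left {S : H →L[ℂ] H} (hS : S ∈ M.commutant) (ξ η : H) :
    vec M (S ξ) η = vec M ξ (star S η) := by
  refine ext_apply fun T => ?_
  have h : VNSpace.incl M T * S = S * VNSpace.incl M T :=
    VonNeumannAlgebra.mem_commutant_iff.1 hS (VNSpace.incl M T) T.2
  rw [incl_vec, incl_vec, ContinuousLinearMap.star_eq_adjoint,
    ContinuousLinearMap.adjoint_inner_left]
  exact congrArg (inner ℂ η) (congrArg (fun R : H →L[ℂ] H => R ξ) h)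

/-- A von Neumann algebra is the dual of its predual. -/
theorem exists_eval_eq (F : StrongDual ℂ (VNPredual M)) : ∃ T : VNSpace M, F = eval M T := by
  -- The operator is the one that represents the bounded sesquilinear form (η, ξ) ↦ F(ω_{ξ,η}).
  let B : H →L⋆[ℂ] H →L[ℂ] ℂ := (ContinuousLinearMap.compL ℂ H (VNPredual M) ℂ F).comp (vecL M)
  let R : H →L[ℂ] H := star (InnerProductSpace.continuousLinearMapOfBilin B)
  have hR : ∀ ξ η, inner ℂ η (R ξ) = F (vec M ξ η) := fun ξ η => by
    simp only [R, ContinuousLinearMap.star_eq_adjoint, ContinuousLinearMap.adjoint_inner_right,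
      InnerProductSpace.continuousLinearMapOfBilin_apply]
    rfl
  -- R commutes with the commutant of M, so it lies in M by the bicommutant theorem.
  have hmem : R ∈ M := by
    rw [← VonNeumannAlgebra.commutant_commutant M, VonNeumannAlgebra.mem_commutant_iff]
    intro S hS
    ext ξ
    refine ext_inner_left ℂ fun η => ?_
    have h1 : inner ℂ η (S (R ξ)) = inner ℂ (star S η) (R ξ) := by
      rw [ContinuousLinearMap.star_eq_adjoint, ContinuousLinearMap.adjoint_inner_left]
    change inner ℂ η (S (R ξ)) = inner ℂ η (R (S ξ))
    rw [h1, hR, hR, vec_commutant_left M hS]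
  refine ⟨⟨R, hmem⟩, ?_⟩
  let S : Submodule ℂ (VNPredual M) := LinearMap.eqLocus F.toLinearMap
    (eval M ⟨R, hmem⟩).toLinearMap
  have hS : IsClosed (S : Set (VNPredual M)) :=
    isClosed_eq F.continuous (eval M ⟨R, hmem⟩).continuous
  ext u
  exact mem_of_isClosed_of_vec_mem hS dense_univ (fun ξ _ η _ => (hR ξ η).symm) u

/-- The vector functionals of vectors from the unit ball of a dense subspace. -/
def unitVec (D : Submodule ℂ H) (p : {p : D × D // ‖p.1‖ ≤ 1 ∧ ‖p.2‖ ≤ 1}) : VNPredual M :=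
  vec M p.1.1 p.1.2

theorem norm_unitVec_le (D : Submodule ℂ H) (p : {p : D × D // ‖p.1‖ ≤ 1 ∧ ‖p.2‖ ≤ 1}) :
    ‖unitVec M D p‖ ≤ 1 :=
  (norm_vec_le M _ _).trans (mul_le_one₀ p.2.2 (norm_nonneg _) p.2.1)

/-- The functional F is evaluation at some T in M. The bound on vector functionals says |⟨Tξ, η⟩| ≤
‖ξ‖‖η‖ for ξ, η in D, hence everywhere by density, so ‖T‖ ≤ 1. This is the norming hypothesis of
`exists_l1Combination_eq`. -/
theorem norm_le_one_of_unitVec {D : Submodule ℂ H} (hD : Dense (D : Set H))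
    (F : StrongDual ℂ (VNPredual M)) (hF : ∀ p, ‖F (unitVec M D p)‖ ≤ 1) : ‖F‖ ≤ 1 := by
  have h1 : ∀ ξ ∈ D, ∀ η ∈ D, ‖F (vec M ξ η)‖ ≤ ‖ξ‖ * ‖η‖ := fun ξ hξ η hη => by
    rcases eq_or_ne ξ 0 with rfl | h0
    · have : vec M 0 η = 0 := by simpa using vec_smul_left M 0 0 η
      simp [this]
    rcases eq_or_ne η 0 with rfl | h0'
    · have : vec M ξ 0 = 0 := by simpa using vec_smul_right M 0 ξ 0
      simp [this]
    have hξ0 : (‖ξ‖ : ℂ) ≠ 0 := by exact_mod_cast norm_ne_zero_iff.2 h0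
    have hη0 : (‖η‖ : ℂ) ≠ 0 := by exact_mod_cast norm_ne_zero_iff.2 h0'
    have h2 := hF ⟨(⟨(‖ξ‖ : ℂ)⁻¹ • ξ, D.smul_mem _ hξ⟩, ⟨(‖η‖ : ℂ)⁻¹ • η, D.smul_mem _ hη⟩), by
      constructor
      · simp [norm_smul, h0]
      · simp [norm_smul, h0']⟩
    have h3 : vec M ξ η = ((‖ξ‖ : ℂ) * ‖η‖) • vec M ((‖ξ‖ : ℂ)⁻¹ • ξ) ((‖η‖ : ℂ)⁻¹ • η) := by
      rw [vec_smul_left, vec_smul_right, smul_smul, smul_smul, map_inv₀, Complex.conj_ofReal]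
      rw [show (‖ξ‖ : ℂ) * ‖η‖ * (‖ξ‖ : ℂ)⁻¹ * (‖η‖ : ℂ)⁻¹ = 1 by field_simp, one_smul]
    rw [h3, map_smul, norm_smul]
    simp only [norm_mul, Complex.norm_real, norm_norm]
    exact mul_le_of_le_one_right (by positivity) h2
  obtain ⟨T, rfl⟩ := exists_eval_eq M F
  have h2 : ∀ ξ η, ‖inner ℂ η (VNSpace.incl M T ξ)‖ ≤ ‖ξ‖ * ‖η‖ := fun ξ η => by
    have hcl : IsClosed {p : H × H | ‖inner ℂ p.2 (VNSpace.incl M T p.1)‖ ≤ ‖p.1‖ * ‖p.2‖} :=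
      isClosed_le (by fun_prop) (by fun_prop)
    have := closure_minimal (s := (D : Set H) ×ˢ (D : Set H))
      (fun p hp => h1 _ hp.1 _ hp.2) hcl
    rw [(hD.prod hD).closure_eq] at this
    exact this (Set.mem_univ (ξ, η))
  have h3 : ‖T‖ ≤ 1 := by
    rw [← (VNSpace.incl M).norm_map]
    refine ContinuousLinearMap.opNorm_le_bound _ zero_le_one fun ξ => ?_
    have h4 := h2 ξ (VNSpace.incl M T ξ)
    rw [inner_self_eq_norm_sq_to_K] at h4
    rcases eq_or_ne (VNSpace.incl M T ξ) 0 with h5 | h5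
    · rw [h5, norm_zero]; positivity
    · have h6 : 0 < ‖VNSpace.incl M T ξ‖ := norm_pos_iff.2 h5
      rw [one_mul]
      refine le_of_mul_le_mul_right ?_ h6
      simpa [pow_two] using h4
  refine ContinuousLinearMap.opNorm_le_bound _ zero_le_one fun u => ?_
  rw [one_mul]
  calc _ ≤ ‖u‖ * ‖T‖ := CB.norm_apply_le (incl M u) T
    _ ≤ ‖u‖ := mul_le_of_le_one_right (norm_nonneg _) h3

/-- Every normal functional is an absolutely convergent combination of vector functionals of
vectors from the unit ball of a given dense subspace. -/
theorem exists_l1Combination_unitVec {D : Submodule ℂ H} (hD : Dense (D : Set H))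
    (u : VNPredual M) : ∃ c : lp (fun _ : {p : D × D // ‖p.1‖ ≤ 1 ∧ ‖p.2‖ ≤ 1} => ℂ) 1,
      ‖c‖ ≤ 2 * ‖u‖ ∧ HasSum (fun p => c p • unitVec M D p) u := by
  obtain ⟨c, hc, hcu⟩ := exists_l1Combination_eq (unitVec M D) (norm_unitVec_le M D)
    (norm_le_one_of_unitVec M hD) u
  have h := hasSum_l1Combination (unitVec M D) (norm_unitVec_le M D) c
  rw [hcu] at h
  exact ⟨c, hc, h⟩

variable {I : Type*}

theorem summable_vec (ξ η : lp (fun _ : I => H) 2) : Summable fun i => vec M (ξ i) (η i) :=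
  Summable.of_norm_bounded (lp_summable_norm_mul_norm ξ η).1 fun _ => norm_vec_le M _ _

/-- The normal functional `T ↦ ⟨T^∞ ξ, η⟩`, where `T^∞` is an amplification of `T`. -/
def vecSum (ξ η : lp (fun _ : I => H) 2) : VNPredual M := ∑' i, vec M (ξ i) (η i)

theorem norm_vecSum_le (ξ η : lp (fun _ : I => H) 2) : ‖vecSum M ξ η‖ ≤ ‖η‖ * ‖ξ‖ :=
  (tsum_of_norm_bounded (lp_summable_norm_mul_norm ξ η).1.hasSum
    fun i => norm_vec_le M (ξ i) (η i)).trans (lp_summable_norm_mul_norm ξ η).2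

@[simp]
theorem incl_vecSum (ξ η : lp (fun _ : I => H) 2) (T : VNSpace M) :
    incl M (vecSum M ξ η) T = inner ℂ η (lpAmp I (VNSpace.incl M T) ξ) :=
  ((summable_vec M ξ η).hasSum.mapL (eval M T)).unique (hasSum_inner_lpAmp _ ξ η)

/-- In an expansion with summable coefficients c, each c is split as a·conj(b) with |a|² = |b|² =
|c|; absorbing a and b into the vectors makes both families square summable. -/
theorem exists_eq_vecSum (u : VNPredual M) :
    ∃ (I : Type u) (ξ η : lp (fun _ : I => H) 2), u = vecSum M ξ η := by
  obtain ⟨c, -, hu⟩ := exists_l1Combination_unitVec M (D := ⊤) (by simp) u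
  have hc : Summable fun p => ‖c p‖ := by simpa using (lp.memℓp c).summable (by simp)
  -- At z = 0 the convention z/0 = 0 gives the value 0, as required.
  let a : ℂ → ℂ := fun z => z / (Real.sqrt ‖z‖ : ℂ)
  let b : ℂ → ℂ := fun z => (Real.sqrt ‖z‖ : ℂ)
  have hab : ∀ z, starRingEnd ℂ (b z) * a z = z := fun z => by
    rcases eq_or_ne z 0 with rfl | hz
    · simp [a]
    · have : (Real.sqrt ‖z‖ : ℂ) ≠ 0 := by
        exact_mod_cast (Real.sqrt_pos.2 (norm_pos_iff.2 hz)).ne'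
      simp only [a, b, Complex.conj_ofReal]
      field_simp
  have hb : ∀ z, ‖b z‖ ^ 2 = ‖z‖ := fun z => by
    simp [b, Real.sq_sqrt, abs_of_nonneg]
  have ha : ∀ z, ‖a z‖ ^ 2 = ‖z‖ := fun z => by
    rcases eq_or_ne z 0 with rfl | hz
    · simp [a]
    · simp only [a, norm_div, div_pow, Complex.norm_real, Real.norm_eq_abs, sq_abs,
        Real.sq_sqrt (norm_nonneg z)]
      have := norm_ne_zero_iff.2 hz
      field_simp
  have hmem : ∀ (a : ℂ → ℂ) (ha : ∀ z, ‖a z‖ ^ 2 = ‖z‖)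
      (x : {p : (⊤ : Submodule ℂ H) × (⊤ : Submodule ℂ H) // ‖p.1‖ ≤ 1 ∧ ‖p.2‖ ≤ 1} → H)
      (_ : ∀ p, ‖x p‖ ≤ 1), Memℓp (fun p => a (c p) • x p) 2 := fun a ha x hx => by
    refine memℓp_gen ?_
    refine Summable.of_nonneg_of_le (fun p => by positivity) (fun p => ?_) hc
    rw [norm_smul]
    simp only [ENNReal.toReal_ofNat, Real.rpow_ofNat]
    rw [mul_pow, ha]
    exact mul_le_of_le_one_right (norm_nonneg _) (pow_le_one₀ (norm_nonneg _) (hx p))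
  have h1 := hmem a ha (fun p => (p.1.1 : H)) fun p => p.2.1
  have h2 := hmem b hb (fun p => (p.1.2 : H)) fun p => p.2.2
  refine ⟨_, (⟨_, h1⟩ : lp (fun _ => H) 2), (⟨_, h2⟩ : lp (fun _ => H) 2), ?_⟩
  refine hu.unique ?_
  have h3 := (summable_vec M (⟨_, h1⟩ : lp (fun _ => H) 2) (⟨_, h2⟩ : lp (fun _ => H) 2)).hasSum
  have e : ∀ p, vec M (a (c p) • (p.1.1 : H)) (b (c p) • (p.1.2 : H)) = c p • unitVec M ⊤ p :=
    fun p => by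
      rw [vec_smul_left, vec_smul_right, smul_smul, mul_comm, hab]
      rfl
  simpa only [vecSum, e] using h3

/-- If every operator in `M` commutes with the operators that commute with a self-adjoint
semigroup `S` in `M`, then a normal functional that vanishes on `S` is zero. -/
theorem eq_zero_of_forall_mem {S : Set (H →L[ℂ] H)} (hstar : ∀ s ∈ S, star s ∈ S)
    (hmul : ∀ s ∈ S, ∀ t ∈ S, s * t ∈ S) (hone : 1 ∈ S)
    (hcomm : ∀ X : H →L[ℂ] H, (∀ s ∈ S, s * X = X * s) → ∀ T : VNSpace M,
      VNSpace.incl M T * X = X * VNSpace.incl M T)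
    (hSM : ∀ s ∈ S, s ∈ M)
    {u : VNPredual M} (hu : ∀ T, VNSpace.incl M T ∈ S → incl M u T = 0) : u = 0 := by
  classical
  obtain ⟨I, ξ, η, rfl⟩ := exists_eq_vecSum M u
  -- The closed cyclic subspace generated by ξ under the amplified S. The aim is that amplified
  -- operators of M also map ξ into K, which is orthogonal to η.
  let K : Submodule ℂ (lp (fun _ : I => H) 2) :=
    (Submodule.span ℂ ((fun s => lpAmp I s ξ) '' S)).topologicalClosure
  have hKc : IsClosed (K : Set (lp (fun _ : I => H) 2)) :=
    Submodule.isClosed_topologicalClosure _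
  have : CompleteSpace K := hKc.completeSpace_coe
  have hinv : ∀ s ∈ S, ∀ x ∈ K, lpAmp I s x ∈ K := fun s hs => by
    have h1 : (Submodule.span ℂ ((fun s => lpAmp I s ξ) '' S)) ≤
        K.comap (lpAmp I s).toLinearMap := by
      refine Submodule.span_le.2 ?_
      rintro _ ⟨t, ht, rfl⟩
      exact subset_closure (Submodule.subset_span ⟨s * t, hmul s hs t ht, rfl⟩)
    exact Submodule.topologicalClosure_minimal _ h1 (hKc.preimage (lpAmp I s).continuous)
  have hP : ∀ s ∈ S, ∀ x, K.starProjection (lpAmp I s x) = lpAmp I s (K.starProjection x) :=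
    fun s hs x => by
    refine Submodule.eq_starProjection_of_mem_orthogonal (hinv s hs _ ?_) ?_
    · exact K.starProjection_apply_mem x
    · rw [← map_sub, Submodule.mem_orthogonal]
      intro k hk
      rw [← inner_lpAmp_adjoint]
      exact Submodule.sub_starProjection_mem_orthogonal x _ (hinv _ (hstar s hs) k hk)
  -- The matrix entries of the projection onto K. They commute with S because K reduces the
  -- amplified S, hence with M by `hcomm`, and so the projection commutes with the amplified M.
  let X : I → I → H →L[ℂ] H := fun i j => lp.evalCLM ℂ (fun _ : I => H) 2 i ∘L
    K.starProjection ∘L lp.singleContinuousLinearMap ℂ (fun _ : I => H) 2 j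
  have hsingle : ∀ (R : H →L[ℂ] H) (j : I) (h : H),
      lpAmp I R (lp.single 2 j h) = lp.single 2 j (R h) := fun R j h => by
    ext i
    rcases eq_or_ne i j with rfl | hij
    · simp
    · simp [hij]
  have hX : ∀ i j, ∀ s ∈ S, s * X i j = X i j * s := fun i j s hs => by
    ext h
    have h1 := hP s hs (lp.single 2 j h)
    rw [hsingle] at h1
    exact (congrArg (fun f : lp (fun _ : I => H) 2 => f i) h1).symm
  have hT : ∀ T : VNSpace M, ∀ x, K.starProjection (lpAmp I (VNSpace.incl M T) x) =
      lpAmp I (VNSpace.incl M T) (K.starProjection x) := fun T => by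
    have : K.starProjection ∘L lpAmp I (VNSpace.incl M T) =
        lpAmp I (VNSpace.incl M T) ∘L K.starProjection := by
      refine lp.ext_continuousLinearMap (by simp) fun j => ?_
      ext h i
      have h1 := congrArg (fun R : H →L[ℂ] H => R h) (hcomm (X i j) (hX i j) T)
      change K.starProjection (lpAmp I (VNSpace.incl M T) (lp.single 2 j h)) i =
        VNSpace.incl M T (K.starProjection (lp.single 2 j h) i)
      rw [hsingle]
      exact h1.symm
    intro x
    exact congrArg (fun R : lp (fun _ : I => H) 2 →L[ℂ] lp (fun _ : I => H) 2 => R x) this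
  have hξ : ξ ∈ K := subset_closure (Submodule.subset_span ⟨1, hone, by ext i; rfl⟩)
  -- Vanishing of the functional on S says exactly that η is orthogonal to the generators of K.
  have hη : K ≤ (innerSL ℂ η).ker := by
    refine Submodule.topologicalClosure_minimal _ (Submodule.span_le.2 ?_)
      (innerSL ℂ η).isClosed_ker
    rintro _ ⟨s, hs, rfl⟩
    let T : VNSpace M := ⟨s, hSM s hs⟩
    have := hu T hs
    rw [incl_vecSum] at this
    exact this
  refine ext_apply fun T => ?_
  rw [incl_vecSum, map_zero, CB.zero_apply]
  refine hη ?_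
  rw [← Submodule.starProjection_eq_self_iff.2 hξ, ← hT]
  exact K.starProjection_apply_mem _

end VNPredual

end Predual

end

/-! ### The regular representation and the function of an element of A(G) -/

noncomputable section

open OperatorSpace MeasureTheory
open scoped CompactlySupported

section Group

variable {G : Type*} [Group G] [TopologicalSpace G] [IsTopologicalGroup G] [LocallyCompactSpace G]
  [MeasurableSpace G] [BorelSpace G]

theorem leftRegular_eq_smul (s : G) (ξ : GroupL2 G) :
    leftRegular s ξ = DomMulAct.mk s⁻¹ • ξ := rfl

theorem leftRegular_one : leftRegular (1 : G) = 1 := by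
  ext1 ξ
  simp [leftRegular_eq_smul]

theorem leftRegular_mul (s t : G) : leftRegular (s * t) = leftRegular s * leftRegular t := by
  ext1 ξ
  change _ = leftRegular s (leftRegular t ξ)
  rw [leftRegular_eq_smul, leftRegular_eq_smul, leftRegular_eq_smul, smul_smul, mul_inv_rev,
    DomMulAct.mk_mul]

theorem leftRegular_mul_apply (s t : G) (ξ : GroupL2 G) :
    leftRegular (s * t) ξ = leftRegular s (leftRegular t ξ) := by
  rw [leftRegular_mul]; rfl

theorem leftRegular_inv_apply_self (s : G) (ξ : GroupL2 G) :
    leftRegular s⁻¹ (leftRegular s ξ) = ξ := by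
  rw [← leftRegular_mul_apply, inv_mul_cancel, leftRegular_one]; rfl

theorem norm_leftRegular_apply (s : G) (ξ : GroupL2 G) : ‖leftRegular s ξ‖ = ‖ξ‖ :=
  (Lp.compMeasurePreservingₗᵢ ℂ (fun t : G => s⁻¹ * t)
    (measurePreserving_mul_left (Measure.haar : Measure G) s⁻¹)).norm_map ξ

theorem inner_leftRegular_apply (s : G) (ξ η : GroupL2 G) :
    inner ℂ (leftRegular s η) (leftRegular s ξ) = inner ℂ η ξ :=
  (Lp.compMeasurePreservingₗᵢ ℂ (fun t : G => s⁻¹ * t)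
    (measurePreserving_mul_left (Measure.haar : Measure G) s⁻¹)).inner_map_map η ξ

theorem star_leftRegular (s : G) : star (leftRegular s) = leftRegular s⁻¹ := by
  ext1 ξ
  refine ext_inner_right ℂ fun η => ?_
  rw [ContinuousLinearMap.star_eq_adjoint, ContinuousLinearMap.adjoint_inner_left,
    ← inner_leftRegular_apply s⁻¹, leftRegular_inv_apply_self]

theorem continuous_leftRegular_apply (ξ : GroupL2 G) : Continuous fun s : G => leftRegular s ξ := by
  have : Fact ((2 : ENNReal) ≠ ⊤) := ⟨by simp⟩
  have h : Continuous fun s : G => DomMulAct.mk s⁻¹ • ξ := by fun_prop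
  exact h

/-- The operators λ(s) form a self-adjoint semigroup with unit, and VN(G) is its double commutant,
so a normal functional that vanishes on all λ(s) is zero. -/
theorem FourierAlgebra.ext_toFun {u v : FourierAlgebra G} (h : ∀ s, u.toFun s = v.toFun s) :
    u = v := by
  rw [← sub_eq_zero]
  refine VNPredual.eq_zero_of_forall_mem (groupVN G) (S := Set.range leftRegular) ?_ ?_ ?_ ?_ ?_ ?_
  · rintro _ ⟨s, rfl⟩
    exact ⟨s⁻¹, (star_leftRegular s).symm⟩
  · rintro _ ⟨s, rfl⟩ _ ⟨t, rfl⟩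
    exact ⟨s * t, leftRegular_mul s t⟩
  · exact ⟨1, leftRegular_one⟩
  · intro X hX T
    have h1 : X ∈ StarSubalgebra.centralizer ℂ (Set.range (leftRegular (G := G))) := by
      rw [StarSubalgebra.mem_centralizer_iff]
      rintro _ ⟨s, rfl⟩
      refine ⟨hX _ ⟨s, rfl⟩, ?_⟩
      rw [star_leftRegular]
      exact hX _ ⟨s⁻¹, rfl⟩
    have h2 : VNSpace.incl _ T ∈ StarSubalgebra.centralizer ℂ
        (StarSubalgebra.centralizer ℂ (Set.range (leftRegular (G := G))) :
          Set (GroupL2 G →L[ℂ] GroupL2 G)) := T.2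
    exact ((StarSubalgebra.mem_centralizer_iff ℂ).1 h2 X h1).1.symm
  · rintro _ ⟨s, rfl⟩
    exact leftRegular_mem s
  · rintro T ⟨s, hs⟩
    have hT : T = leftRegularVN s := (VNSpace.incl _).injective hs.symm
    rw [hT, map_sub, CB.sub_apply, sub_eq_zero]
    exact h s

theorem toFun_vec (ξ η : GroupL2 G) (s : G) :
    FourierAlgebra.toFun (VNPredual.vec (groupVN G) ξ η) s = inner ℂ η (leftRegular s ξ) := rfl

theorem norm_leftRegularVN_le (s : G) : ‖leftRegularVN s‖ ≤ 1 := by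
  refine ContinuousLinearMap.opNorm_le_bound (leftRegular s) zero_le_one fun ξ => ?_
  rw [norm_leftRegular_apply, one_mul]

theorem FourierAlgebra.norm_toFun_le (u : FourierAlgebra G) (s : G) : ‖u.toFun s‖ ≤ ‖u‖ :=
  (CB.norm_apply_le (VNPredual.incl _ u) (leftRegularVN s)).trans
    (mul_le_of_le_one_right (norm_nonneg _) (norm_leftRegularVN_le s))

/-- The evaluation of `u ∈ A(G)` at a point of `G`. -/
def FourierAlgebra.toFunL (s : G) : FourierAlgebra G →L[ℂ] ℂ :=
  VNPredual.eval (groupVN G) (leftRegularVN s)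

@[simp]
theorem FourierAlgebra.toFunL_apply (s : G) (u : FourierAlgebra G) : toFunL s u = u.toFun s := rfl

/-! ### Compactly supported continuous functions in L² -/

section CompactlySupported

variable {X : Type*} [TopologicalSpace X] [MeasurableSpace X] [BorelSpace X] {μ : Measure X}
  [IsFiniteMeasureOnCompacts μ]
  {E : Type*} [NormedAddCommGroup E] [InnerProductSpace ℂ E]

/-- A compactly supported continuous function as an element of `L²`. -/
def ccLp (μ : Measure X) [IsFiniteMeasureOnCompacts μ] : C_c(X, E) →ₗ[ℂ] Lp E 2 μ where
  toFun f := (f.1.continuous.memLp_of_hasCompactSupport (μ := μ) f.2).toLp f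
  map_add' _ _ := rfl
  map_smul' _ _ := rfl

theorem coeFn_ccLp (f : C_c(X, E)) : ccLp μ f =ᵐ[μ] f :=
  MemLp.coeFn_toLp (f.1.continuous.memLp_of_hasCompactSupport (μ := μ) f.2)

theorem integrable_norm_sq_cc (f : C_c(X, E)) : Integrable (fun x => ‖f x‖ ^ 2) μ := by
  refine Continuous.integrable_of_hasCompactSupport (f.1.continuous.norm.pow 2) ?_
  refine f.2.mono fun x hx hgx => hx ?_
  have : f x = 0 := hgx
  simp [this]

theorem inner_ccLp (f g : C_c(X, E)) :
    inner ℂ (ccLp μ f) (ccLp μ g) = ∫ x, inner ℂ (f x) (g x) ∂μ := by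
  rw [L2.inner_def]
  refine integral_congr_ae ?_
  filter_upwards [coeFn_ccLp (μ := μ) f, coeFn_ccLp (μ := μ) g] with x hf hg
  rw [hf, hg]

theorem norm_sq_ccLp (f : C_c(X, E)) : ‖ccLp μ f‖ ^ 2 = ∫ x, ‖f x‖ ^ 2 ∂μ := by
  have h := inner_ccLp (μ := μ) f f
  rw [inner_self_eq_norm_sq_to_K] at h
  simp only [inner_self_eq_norm_sq_to_K] at h
  have h2 : ∫ x, ((‖f x‖ : ℂ) ^ 2) ∂μ = ((∫ x, ‖f x‖ ^ 2 ∂μ : ℝ) : ℂ) := by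
    rw [← integral_complex_ofReal]
    simp
  have h3 : ((‖ccLp μ f‖ ^ 2 : ℝ) : ℂ) = ((∫ x, ‖f x‖ ^ 2 ∂μ : ℝ) : ℂ) := by
    rw [← h2]; push_cast; exact h
  exact_mod_cast h3

/-- The set t is approximated from inside by a compact closed s, and s from outside by an open u. A
Urysohn function equal to 1 on s and 0 off u differs from the indicator of t only on (u \ s) ∪ (t \
s), by at most 1, and this set has small measure. -/
theorem exists_cc_eLpNorm_sub_indicator_le {X E : Type*} [TopologicalSpace X] [MeasurableSpace X]
    [BorelSpace X] [NormedAddCommGroup E] [NormedSpace ℝ E] {μ : Measure X}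
    [R1Space X] [WeaklyLocallyCompactSpace X] [μ.Regular] (c : E) {t : Set X}
    (ht : MeasurableSet t) (hμ : μ t < ⊤) {ε : ENNReal} (hε : ε ≠ 0) :
    ∃ g : X → E, eLpNorm (g - t.indicator fun _ => c) 2 μ ≤ ε ∧ Continuous g ∧
      HasCompactSupport g := by
  obtain ⟨η, ηpos, hη⟩ := exists_eLpNorm_indicator_le (μ := μ) (p := 2) (by simp) c hε
  have hη2 : ((η / 2 : NNReal) : ENNReal) ≠ 0 := by
    simpa using ηpos.ne'
  obtain ⟨s, st, hsc, hscl, hμs⟩ := ht.exists_isCompact_isClosed_sdiff_lt hμ.ne hη2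
  obtain ⟨u, hsu, huo, hμu⟩ := hsc.exists_isOpen_lt_add (μ := μ) hη2
  obtain ⟨f, hf1, hf0, hfc, hf01⟩ := exists_continuous_one_zero_of_isCompact hsc huo.isClosed_compl
    (Set.disjoint_compl_right_iff_subset.2 hsu)
  refine ⟨fun x => f x • c, ?_, by fun_prop, hfc.smul_right⟩
  refine le_trans (eLpNorm_mono (g := ((u \ s) ∪ (t \ s)).indicator fun _ => c) fun x => ?_)
    (hη _ ?_)
  · by_cases hxs : x ∈ s
    · simp [hxs, st hxs, hf1 hxs]
    · by_cases hxt : x ∈ t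
      · have := hf01 x
        simp only [Pi.sub_apply, Set.indicator_of_mem hxt,
          Set.indicator_of_mem (show x ∈ (u \ s) ∪ (t \ s) from Or.inr ⟨hxt, hxs⟩)]
        rw [show f x • c - c = (f x - 1) • c by rw [sub_smul, one_smul], norm_smul]
        refine mul_le_of_le_one_left (norm_nonneg _) ?_
        rw [Real.norm_eq_abs, abs_le]
        constructor <;> linarith [this.1, this.2]
      · by_cases hxu : x ∈ u
        · have := hf01 x
          simp only [Pi.sub_apply, Set.indicator_of_notMem hxt, sub_zero,
            Set.indicator_of_mem (show x ∈ (u \ s) ∪ (t \ s) from Or.inl ⟨hxu, hxs⟩)]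
          rw [norm_smul]
          refine mul_le_of_le_one_left (norm_nonneg _) ?_
          rw [Real.norm_eq_abs, abs_le]
          constructor <;> linarith [this.1, this.2]
        · simp [hxt, hxu, hf0 hxu]
  · refine (measure_union_le _ _).trans ?_
    have h1 : μ (u \ s) ≤ (η / 2 : NNReal) := by
      rw [measure_sdiff hsu hscl.nullMeasurableSet hsc.measure_ne_top]
      exact tsub_le_iff_left.2 hμu.le
    refine (add_le_add h1 hμs.le).trans_eq ?_
    rw [← ENNReal.coe_add, add_halves]

/-- For vectors from this dense subspace the coefficients of λ are explicit integrals of continuous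
functions. -/
theorem dense_range_ccLp {μ : Measure X} [R1Space X] [WeaklyLocallyCompactSpace X] [μ.Regular] :
    Dense ((ccLp μ : C_c(X, E) →ₗ[ℂ] Lp E 2 μ).range : Set (Lp E 2 μ)) := by
  intro f
  refine EMetric.mem_closure_iff.2 fun ε hε => ?_
  obtain ⟨δ, hδ0, hδ⟩ := exists_between hε
  obtain ⟨g, hfg, hgc, hg⟩ := (Lp.memLp f).induction_dense (by simp)
    (fun g : X → E => Continuous g ∧ HasCompactSupport g)
    (fun c t ht hμ ε hε => exists_cc_eLpNorm_sub_indicator_le c ht hμ hε)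
    (fun f g hf hg => ⟨hf.1.add hg.1, hf.2.add hg.2⟩)
    (fun f hf => (hf.1.memLp_of_hasCompactSupport (μ := μ) (p := 2) hf.2).aestronglyMeasurable)
    hδ0.ne'
  refine ⟨_, ⟨⟨⟨g, hgc⟩, hg⟩, rfl⟩, lt_of_le_of_lt ?_ hδ⟩
  rw [Lp.edist_def]
  refine le_trans (le_of_eq (eLpNorm_congr_ae ?_)) hfg
  filter_upwards [coeFn_ccLp (μ := μ) (⟨⟨g, hgc⟩, hg⟩ : C_c(X, E))] with x hx
  simp only [Pi.sub_apply, hx]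
  rfl

end CompactlySupported

end Group

end

/-! ### Hilbert space valued functions as families of coordinates -/

noncomputable section

open OperatorSpace MeasureTheory
open scoped CompactlySupported

section HilbertValued

variable {X : Type*} [TopologicalSpace X] [MeasurableSpace X] [BorelSpace X] {μ : Measure X}
  [IsFiniteMeasureOnCompacts μ]
  {E : Type*} [NormedAddCommGroup E] [InnerProductSpace ℂ E] {ι : Type*} (e : HilbertBasis ι ℂ E)

/-- The coordinate of a vector-valued function with respect to a Hilbert basis. -/
def ccCoord (i : ι) : C_c(X, E) →ₗ[ℂ] C_c(X, ℂ) where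
  toFun Ψ := ⟨⟨fun x => inner ℂ (e i) (Ψ x), continuous_const.inner Ψ.1.continuous⟩,
    Ψ.2.mono fun x hx hΨ => hx (by
      have : Ψ x = 0 := hΨ
      simp [this])⟩
  map_add' Ψ Θ := by ext x; exact inner_add_right _ _ _
  map_smul' c Ψ := by ext x; exact inner_smul_right _ _ _

@[simp]
theorem ccCoord_apply (i : ι) (Ψ : C_c(X, E)) (x : X) : ccCoord e i Ψ x = inner ℂ (e i) (Ψ x) := rfl

theorem sum_norm_sq_ccCoord (Ψ : C_c(X, E)) (s : Finset ι) :
    ∑ i ∈ s, ‖ccLp μ (ccCoord e i Ψ)‖ ^ 2 = ∫ x, ∑ i ∈ s, ‖ccCoord e i Ψ x‖ ^ 2 ∂μ := by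
  rw [integral_finsetSum s fun i _ => integrable_norm_sq_cc (ccCoord e i Ψ)]
  exact Finset.sum_congr rfl fun i _ => norm_sq_ccLp _

theorem hasSum_norm_sq_inner (v : E) : HasSum (fun i => ‖inner ℂ (e i) v‖ ^ 2) (‖v‖ ^ 2) := by
  have h := lp_hasSum_norm_sq (e.repr v)
  simpa [HilbertBasis.repr_apply_apply] using h

/-- Parseval holds pointwise, but the basis may be uncountable, so convergence theorems for
sequences do not apply. The finite partial sums are continuous and increase to a continuous limit,
so by Dini's theorem they converge uniformly on the compact support. -/
theorem hasSum_norm_sq_ccCoord (Ψ : C_c(X, E)) :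
    HasSum (fun i => ‖ccLp μ (ccCoord e i Ψ)‖ ^ 2) (∫ x, ‖Ψ x‖ ^ 2 ∂μ) := by
  have hK : IsCompact (tsupport Ψ) := Ψ.2
  have hunif : TendstoUniformlyOn (fun (s : Finset ι) x => ∑ i ∈ s, ‖ccCoord e i Ψ x‖ ^ 2)
      (fun x => ‖Ψ x‖ ^ 2) Filter.atTop (tsupport Ψ) := by
    refine Monotone.tendstoUniformlyOn_of_forall_tendsto hK (fun s => ?_) (fun x _ s t hst => ?_)
      (Ψ.1.continuous.norm.pow 2).continuousOn (fun x _ => hasSum_norm_sq_inner e (Ψ x))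
    · refine (continuous_finsetSum s fun i _ => ?_).continuousOn
      exact (continuous_const.inner Ψ.1.continuous).norm.pow 2
    · exact Finset.sum_le_sum_of_subset_of_nonneg hst fun _ _ _ => by positivity
  refine Metric.tendsto_nhds.2 fun ε hε => ?_
  -- Adding 1 covers the case of a support of measure zero.
  have hδ : 0 < ε / (μ.real (tsupport Ψ) + 1) := by positivity
  filter_upwards [Metric.tendstoUniformlyOn_iff.1 hunif _ hδ] with s hs
  rw [sum_norm_sq_ccCoord, dist_eq_norm, ← integral_sub
    (integrable_finsetSum s fun i _ => integrable_norm_sq_cc (ccCoord e i Ψ))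
    (integrable_norm_sq_cc Ψ), ← setIntegral_eq_integral_of_forall_compl_eq_zero
    (s := tsupport Ψ) fun x hx => by simp [image_eq_zero_of_notMem_tsupport hx]]
  refine lt_of_le_of_lt (norm_setIntegral_le_of_norm_le_const hK.measure_lt_top
    (C := ε / (μ.real (tsupport Ψ) + 1)) fun x hx => ?_) ?_
  · rw [← dist_eq_norm, dist_comm]
    exact (hs x hx).le
  · rw [div_mul_eq_mul_div, div_lt_iff₀ (by positivity)]
    gcongr
    linarith

/-- The coordinates of a compactly supported continuous function with values in a Hilbert space,
as a family in `ℓ²(L²)`. -/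
def ccL2 (μ : Measure X) [IsFiniteMeasureOnCompacts μ] :
    C_c(X, E) →ₗ[ℂ] lp (fun _ : ι => Lp ℂ 2 μ) 2 where
  toFun Ψ := ⟨fun i => ccLp μ (ccCoord e i Ψ), memℓp_gen (by
    simpa using (hasSum_norm_sq_ccCoord (μ := μ) e Ψ).summable)⟩
  map_add' Ψ Θ := by
    ext1; funext i
    simp only [map_add]; rfl
  map_smul' c Ψ := by
    ext1; funext i
    simp only [map_smul]; rfl

theorem norm_sq_ccL2 (Ψ : C_c(X, E)) : ‖ccL2 e μ Ψ‖ ^ 2 = ∫ x, ‖Ψ x‖ ^ 2 ∂μ :=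
  (lp_hasSum_norm_sq (ccL2 e μ Ψ)).unique (hasSum_norm_sq_ccCoord e Ψ)

theorem norm_ccL2 (Ψ : C_c(X, E)) : ‖ccL2 e μ Ψ‖ = ‖ccLp μ Ψ‖ := by
  rw [← sq_eq_sq₀ (norm_nonneg _) (norm_nonneg _), norm_sq_ccL2, norm_sq_ccLp]

/-- Polarization of `norm_ccL2`. Inner products in L²(G) ⊗ L²(G), modelled as a direct sum of copies
of L²(G), thereby become integrals of continuous functions. -/
theorem inner_ccL2 (Ψ Θ : C_c(X, E)) :
    inner ℂ (ccL2 e μ Θ) (ccL2 e μ Ψ) = ∫ x, inner ℂ (Θ x) (Ψ x) ∂μ := by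
  rw [← inner_ccLp, inner_eq_sum_norm_sq_div_four, inner_eq_sum_norm_sq_div_four]
  simp only [← map_smul, ← map_add, ← map_sub, norm_ccL2]

end HilbertValued

end

/-! ### Preadjoints of normal completely bounded maps -/

noncomputable section

open OperatorSpace MeasureTheory
open scoped CompactlySupported

namespace CB

variable {V W Z : Type*} [NormedAddCommGroup V] [NormedSpace ℂ V] [OperatorSpace V]
  [NormedAddCommGroup W] [NormedSpace ℂ W] [OperatorSpace W]
  [NormedAddCommGroup Z] [NormedSpace ℂ Z] [OperatorSpace Z]

/-- The composition of completely bounded maps. -/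
def comp (T : CB W Z) (S : CB V W) : CB V Z :=
  ofBound (T.toLin ∘ₗ S.toLin) (‖T‖ * ‖S‖) fun κ _ x => by
    rw [mul_assoc]
    exact (mnorm_map_le T (x.map S)).trans
      (mul_le_mul_of_nonneg_left (mnorm_map_le S x) (norm_nonneg T))

theorem norm_comp_le (T : CB W Z) (S : CB V W) : ‖T.comp S‖ ≤ ‖T‖ * ‖S‖ :=
  norm_ofBound_le _ _ (by positivity) _

variable (Z) in
/-- The composition with a completely bounded map from the right, as a bounded operator. -/
def precomp (S : CB V W) : CB W Z →L[ℂ] CB V Z :=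
  LinearMap.mkContinuous
    { toFun := fun T => T.comp S
      map_add' := fun _ _ => rfl
      map_smul' := fun _ _ => rfl } ‖S‖ fun T => by
    rw [mul_comm]; exact norm_comp_le T S

end CB

namespace VNPredual

variable {H : Type*} [NormedAddCommGroup H] [InnerProductSpace ℂ H] [CompleteSpace H]
  {M : VonNeumannAlgebra H}

/-- A completely bounded map on a von Neumann algebra is normal if it maps vector functionals to
normal functionals. -/
theorem exists_incl_eq_comp (S : CB (VNSpace M) (VNSpace M))
    (hS : ∀ ξ η : H, ∃ w : VNPredual M, ∀ T, incl M w T = inner ℂ η (VNSpace.incl M (S T) ξ))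
    (u : VNPredual M) : ∃ w : VNPredual M, ∀ T, incl M w T = incl M u (S T) := by
  -- The functionals whose composition with S is again normal. They form a closed subspace because
  -- the predual is complete, so its isometric image in the dual is closed.
  let N : Submodule ℂ (VNPredual M) :=
    (incl M).range.comap ((CB.precomp ℂ S).toLinearMap ∘ₗ (incl M).toLinearMap)
  have hN : IsClosed (N : Set (VNPredual M)) := by
    have h1 : IsClosed (Set.range (incl M)) := (incl M).isometry.isClosedEmbedding.isClosed_range
    exact h1.preimage ((CB.precomp ℂ S).continuous.comp (incl M).continuous)
  obtain ⟨w, hw⟩ := mem_of_isClosed_of_vec_mem hN dense_univ (fun ξ _ η _ => by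
    obtain ⟨w, hw⟩ := hS ξ η
    exact ⟨w, CB.ext hw⟩) u
  exact ⟨w, fun T => congrArg (fun φ : CB (VNSpace M) ℂ => φ T) hw⟩

/-- The preadjoint of a normal completely bounded map on a von Neumann algebra. -/
theorem exists_preadjoint (S : CB (VNSpace M) (VNSpace M))
    (hS : ∀ ξ η : H, ∃ w : VNPredual M, ∀ T, incl M w T = inner ℂ η (VNSpace.incl M (S T) ξ)) :
    ∃ P : CB (VNPredual M) (VNPredual M), ‖P‖ ≤ ‖S‖ ∧
      ∀ u T, incl M (P u) T = incl M u (S T) := by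
  choose P hP using exists_incl_eq_comp S hS
  let L : VNPredual M →ₗ[ℂ] VNPredual M :=
    { toFun := P
      map_add' := fun u v => ext_apply fun T => by simp [hP]
      map_smul' := fun c u => ext_apply fun T => by simp [hP] }
  have hL : ∀ (κ : Type) [Fintype κ] (x : Matrix κ κ (VNPredual M)),
      mnorm (x.map L) ≤ ‖S‖ * mnorm x := fun κ _ x => by
    -- The norm of a matrix over the predual is that of T ↦ [x_{ij}(T)], and the preadjoint acts on
    -- it by precomposition with S.
    refine CB.matNorm_le _ (mul_nonneg (norm_nonneg _) (mnorm_nonneg x)) fun μ _ T => ?_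
    have e : CB.amp ((x.map L).map (incl M)) T = CB.amp (x.map (incl M)) (T.map S) := by
      ext p q
      exact hP _ _
    have h1 : mnorm (CB.amp (x.map (incl M)) (T.map S)) ≤ mnorm x * mnorm (T.map S) :=
      CB.le_matNorm (x.map (incl M)) (T.map S)
    refine (le_of_eq (congrArg mnorm e)).trans (h1.trans ?_)
    calc mnorm x * mnorm (T.map S) ≤ mnorm x * (‖S‖ * mnorm T) :=
          mul_le_mul_of_nonneg_left (CB.mnorm_map_le S T) (mnorm_nonneg x)
      _ = _ := by ring
  exact ⟨CB.ofBound L ‖S‖ hL, CB.norm_ofBound_le _ _ (norm_nonneg _) _, hP⟩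

end VNPredual

/-! ### Fell absorption and multiplication by coefficients of `C_c(G)` -/

section Group

variable {G : Type*} [Group G] [TopologicalSpace G] [IsTopologicalGroup G] [LocallyCompactSpace G]
  [MeasurableSpace G] [BorelSpace G]

variable (G) in
/-- An index type for an orthonormal basis of `L²(G)`. -/
abbrev GroupL2Index : Type _ := (exists_hilbertBasis ℂ (GroupL2 G)).choose

variable (G) in
/-- An orthonormal basis of `L²(G)`. -/
def groupL2Basis : HilbertBasis (GroupL2Index G) ℂ (GroupL2 G) :=
  (exists_hilbertBasis ℂ (GroupL2 G)).choose_spec.choose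

variable (G) in
/-- The Hilbert space tensor product `L²(G) ⊗ L²(G)`, as a direct sum of copies of `L²(G)`. -/
abbrev GroupL2Sum : Type _ := lp (fun _ : GroupL2Index G => GroupL2 G) 2

/-- A compactly supported continuous function from `G` to `L²(G)` as an element of
`L²(G) ⊗ L²(G)`. -/
def ccSum : C_c(G, GroupL2 G) →ₗ[ℂ] GroupL2Sum G := ccL2 (groupL2Basis G) Measure.haar

/-- Left translation of compactly supported continuous functions. -/
def ccTranslate {E : Type*} [TopologicalSpace E] [Zero E] (s : G) (Ψ : C_c(G, E)) : C_c(G, E) :=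
  ⟨⟨fun b => Ψ (s⁻¹ * b), Ψ.1.continuous.comp (continuous_const_mul s⁻¹)⟩,
    Ψ.2.comp_homeomorph (Homeomorph.mulLeft s⁻¹)⟩

@[simp]
theorem ccTranslate_apply {E : Type*} [TopologicalSpace E] [Zero E] (s : G) (Ψ : C_c(G, E))
    (b : G) : ccTranslate s Ψ b = Ψ (s⁻¹ * b) := rfl

theorem leftRegular_ccLp (s : G) (f : C_c(G, ℂ)) :
    leftRegular s (ccLp Measure.haar f) = ccLp Measure.haar (ccTranslate s f) := rfl

/-- The element of `A(G)` defined by two vectors of `L²(G) ⊗ L²(G)`. -/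
theorem toFun_vecSum_ccSum (Ψ Θ : C_c(G, GroupL2 G)) (s : G) :
    FourierAlgebra.toFun (VNPredual.vecSum (groupVN G) (ccSum Ψ) (ccSum Θ)) s =
      ∫ b, inner ℂ (Θ b) (Ψ (s⁻¹ * b)) ∂Measure.haar := by
  have h := VNPredual.incl_vecSum (groupVN G) (ccSum Ψ) (ccSum Θ) (leftRegularVN s)
  refine h.trans ?_
  exact inner_ccL2 (groupL2Basis G) (ccTranslate s Ψ) Θ

theorem toFun_vec_ccLp (f g : C_c(G, ℂ)) (s : G) :
    FourierAlgebra.toFun (VNPredual.vec (groupVN G) (ccLp Measure.haar f) (ccLp Measure.haar g)) s =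
      ∫ b, inner ℂ (g b) (f (s⁻¹ * b)) ∂Measure.haar :=
  inner_ccLp g (ccTranslate s f)

/-- The function `b ↦ f(b) λ(b⁻¹) ξ`. -/
def ccOrbit (f : C_c(G, ℂ)) (ξ : GroupL2 G) : C_c(G, GroupL2 G) where
  toFun b := f b • leftRegular b⁻¹ ξ
  continuous_toFun := by
    have h1 : Continuous f := f.1.continuous
    have h2 : Continuous fun b : G => leftRegular b⁻¹ ξ :=
      (continuous_leftRegular_apply ξ).comp continuous_inv
    exact h1.smul h2
  hasCompactSupport' := by
    refine f.2.mono fun b hb hf => hb ?_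
    have h : f b = 0 := hf
    exact (congrArg (· • leftRegular b⁻¹ ξ) h).trans (zero_smul ℂ _)

@[simp]
theorem ccOrbit_apply (f : C_c(G, ℂ)) (ξ : GroupL2 G) (b : G) :
    ccOrbit f ξ b = f b • leftRegular b⁻¹ ξ := rfl

theorem norm_ccLp_ccOrbit (f : C_c(G, ℂ)) (ξ : GroupL2 G) :
    ‖ccLp Measure.haar (ccOrbit f ξ)‖ = ‖ccLp Measure.haar f‖ * ‖ξ‖ := by
  rw [← sq_eq_sq₀ (norm_nonneg _) (by positivity), mul_pow, norm_sq_ccLp, norm_sq_ccLp,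
    ← integral_mul_const]
  simp only [ccOrbit_apply, norm_smul, mul_pow, norm_leftRegular_apply]

/-- The operator from `L²(G)` to `L²(G) ⊗ L²(G)` that maps `ξ` to `b ↦ f(b) λ(b⁻¹) ξ`. -/
def orbitMap (f : C_c(G, ℂ)) : GroupL2 G →L[ℂ] GroupL2Sum G :=
  LinearMap.mkContinuous
    { toFun := fun ξ => ccSum (ccOrbit f ξ)
      map_add' := fun ξ η => by
        rw [← map_add]
        congr 1
        ext1 b
        simp
      map_smul' := fun c ξ => by
        rw [RingHom.id_apply, ← map_smul]
        congr 1
        ext1 b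
        rw [ccOrbit_apply, map_smul, smul_comm]
        rfl } ‖ccLp Measure.haar f‖ fun ξ => by
    refine le_of_eq ?_
    rw [← norm_ccLp_ccOrbit]
    exact norm_ccL2 _ _

theorem orbitMap_apply (f : C_c(G, ℂ)) (ξ : GroupL2 G) : orbitMap f ξ = ccSum (ccOrbit f ξ) := rfl

theorem norm_orbitMap_le (f : C_c(G, ℂ)) : ‖orbitMap f‖ ≤ ‖ccLp Measure.haar f‖ :=
  LinearMap.mkContinuous_norm_le _ (norm_nonneg _) _

/-- Fell absorption: the product of coefficients of `λ` is a coefficient of a multiple of `λ`. -/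
theorem toFun_vecSum_orbitMap (f g : C_c(G, ℂ)) (ξ η : GroupL2 G) (s : G) :
    FourierAlgebra.toFun (VNPredual.vecSum (groupVN G) (orbitMap f ξ) (orbitMap g η)) s =
      FourierAlgebra.toFun
        (VNPredual.vec (groupVN G) (ccLp Measure.haar f) (ccLp Measure.haar g)) s *
      inner ℂ η (leftRegular s ξ) := by
  rw [orbitMap_apply, orbitMap_apply, toFun_vecSum_ccSum, toFun_vec_ccLp, ← integral_mul_const]
  congr 1
  ext b
  -- Since (s⁻¹b)⁻¹ = b⁻¹s, the vectors under the integral are λ(b⁻¹)λ(s)ξ and λ(b⁻¹)η; unitarity of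
  -- λ(b⁻¹) removes b from their inner product, which leaves the integral as a constant.
  rw [ccOrbit_apply, ccOrbit_apply, inner_smul_left, inner_smul_right, mul_inv_rev, inv_inv,
    leftRegular_mul_apply, inner_leftRegular_apply]
  simp
  ring

/-- The set λ(G) is closed under adjoints, so the commutation conditions on adjoints in the
definition of the centralizer are automatic. -/
theorem mem_groupVN_iff {T : GroupL2 G →L[ℂ] GroupL2 G} : T ∈ groupVN G ↔
    ∀ X : GroupL2 G →L[ℂ] GroupL2 G, (∀ s : G, leftRegular s * X = X * leftRegular s) →
      X * T = T * X := by
  have h0 : T ∈ groupVN G ↔ T ∈ StarSubalgebra.centralizer ℂ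
        (StarSubalgebra.centralizer ℂ (Set.range (leftRegular (G := G))) :
          Set (GroupL2 G →L[ℂ] GroupL2 G)) := Iff.rfl
  have h1 : ∀ X : GroupL2 G →L[ℂ] GroupL2 G,
      X ∈ StarSubalgebra.centralizer ℂ (Set.range (leftRegular (G := G))) ↔
      ∀ s : G, leftRegular s * X = X * leftRegular s := fun X => by
    rw [StarSubalgebra.mem_centralizer_iff]
    constructor
    · exact fun h s => (h _ ⟨s, rfl⟩).1
    · rintro h _ ⟨s, rfl⟩
      rw [star_leftRegular]
      exact ⟨h s, h s⁻¹⟩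
  rw [h0, StarSubalgebra.mem_centralizer_iff]
  constructor
  · exact fun h X hX => (h X ((h1 X).2 hX)).1
  · intro h X hX
    exact ⟨h X ((h1 X).1 hX), h (star X) ((h1 _).1 (star_mem hX))⟩

/-- The operator `T ↦ v · T` on `B(L²(G))`, where `v` is the coefficient of `λ` given by `f` and
`g`. -/
def actOp (f g : C_c(G, ℂ)) :
    (GroupL2 G →L[ℂ] GroupL2 G) →ₗ[ℂ] (GroupL2 G →L[ℂ] GroupL2 G) where
  toFun T := (orbitMap g).adjoint ∘L lpAmp (GroupL2Index G) T ∘L orbitMap f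
  map_add' S T := by
    have : lpAmp (GroupL2Index G) (S + T) = lpAmp (GroupL2Index G) S + lpAmp (GroupL2Index G) T := by
      ext ξ i; rfl
    rw [this, ContinuousLinearMap.add_comp, ContinuousLinearMap.comp_add]
  map_smul' c T := by
    have : lpAmp (GroupL2Index G) (c • T) = c • lpAmp (GroupL2Index G) T := by
      ext ξ i; rfl
    rw [this, ContinuousLinearMap.smul_comp, ContinuousLinearMap.comp_smul]
    rfl

/-- The coefficients of `actOp f g` are normal functionals of T, which is the normality needed for a
preadjoint. -/
theorem inner_actOp (f g : C_c(G, ℂ)) (T : VNSpace (groupVN G)) (ξ η : GroupL2 G) :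
    inner ℂ η (actOp f g (VNSpace.incl _ T) ξ) =
      VNPredual.incl _ (VNPredual.vecSum (groupVN G) (orbitMap f ξ) (orbitMap g η)) T := by
  rw [VNPredual.incl_vecSum]
  exact ContinuousLinearMap.adjoint_inner_right (orbitMap g) η
    (lpAmp (GroupL2Index G) (VNSpace.incl _ T) (orbitMap f ξ))

/-- For X commuting with λ(G), the coefficients of `actOp f g T` at (Xξ, η) and (ξ, X*η) are the
values at T of two elements of A(G). Their functions on G agree by Fell absorption, so the elements
agree by `FourierAlgebra.ext_toFun`, and `actOp f g T` commutes with X. -/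
theorem actOp_mem (f g : C_c(G, ℂ)) (T : VNSpace (groupVN G)) :
    actOp f g (VNSpace.incl _ T) ∈ groupVN G := by
  rw [mem_groupVN_iff]
  intro X hX
  ext1 ξ
  refine ext_inner_left ℂ fun η => ?_
  change inner ℂ η (X (actOp f g (VNSpace.incl _ T) ξ)) =
    inner ℂ η (actOp f g (VNSpace.incl _ T) (X ξ))
  rw [← ContinuousLinearMap.adjoint_inner_left X, inner_actOp, inner_actOp]
  congr 2
  refine FourierAlgebra.ext_toFun fun s => ?_
  rw [toFun_vecSum_orbitMap, toFun_vecSum_orbitMap, ContinuousLinearMap.adjoint_inner_left]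
  congr 2
  exact (congrArg (fun R : GroupL2 G →L[ℂ] GroupL2 G => R ξ) (hX s)).symm

theorem actOp_leftRegular (f g : C_c(G, ℂ)) (s : G) : actOp f g (leftRegular s) =
    FourierAlgebra.toFun (VNPredual.vec (groupVN G) (ccLp Measure.haar f) (ccLp Measure.haar g)) s •
      leftRegular s := by
  ext1 ξ
  refine ext_inner_left ℂ fun η => ?_
  refine (inner_actOp f g (leftRegularVN s) ξ η).trans ?_
  rw [smul_apply, inner_smul_right]
  exact toFun_vecSum_orbitMap f g ξ η s

/-- A map A*(T ⊗ 1)B has completely bounded norm at most ‖A‖‖B‖, because amplification does not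
increase matrix norms. -/
theorem mnorm_map_actOp_le (f g : C_c(G, ℂ)) {κ : Type} [Fintype κ]
    (x : Matrix κ κ (GroupL2 G →L[ℂ] GroupL2 G)) :
    mnorm (x.map (actOp f g)) ≤ ‖ccLp Measure.haar g‖ * ‖ccLp Measure.haar f‖ * mnorm x := by
  refine norm_matOp_le _ (mul_nonneg (by positivity) (mnorm_nonneg x)) fun v => ?_
  have e : ∀ k, ∑ l, x.map (actOp f g) k l (v l) =
      (orbitMap g).adjoint (∑ l, lpAmp (GroupL2Index G) (x k l) (orbitMap f (v l))) := fun k => by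
    rw [map_sum]; rfl
  have h1 : ∀ w, ‖(orbitMap g).adjoint w‖ ^ 2 ≤ ‖ccLp Measure.haar g‖ ^ 2 * ‖w‖ ^ 2 := fun w => by
    rw [← mul_pow]
    refine pow_le_pow_left₀ (norm_nonneg _) (ContinuousLinearMap.le_of_opNorm_le _ ?_ w) 2
    rw [LinearIsometryEquiv.norm_map]
    exact norm_orbitMap_le g
  have h2 : ∀ w, ‖orbitMap f w‖ ^ 2 ≤ ‖ccLp Measure.haar f‖ ^ 2 * ‖w‖ ^ 2 := fun w => by
    rw [← mul_pow]
    exact pow_le_pow_left₀ (norm_nonneg _)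
      (ContinuousLinearMap.le_of_opNorm_le _ (norm_orbitMap_le f) w) 2
  calc _ = ∑ k, ‖(orbitMap g).adjoint
        (∑ l, lpAmp (GroupL2Index G) (x k l) (orbitMap f (v l)))‖ ^ 2 := by simp only [e]
    _ ≤ ∑ k, ‖ccLp Measure.haar g‖ ^ 2 *
        ‖∑ l, lpAmp (GroupL2Index G) (x k l) (orbitMap f (v l))‖ ^ 2 :=
        Finset.sum_le_sum fun k _ => h1 _
    _ ≤ ‖ccLp Measure.haar g‖ ^ 2 * (mnorm x ^ 2 * ∑ l, ‖orbitMap f (v l)‖ ^ 2) := by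
        rw [← Finset.mul_sum]
        exact mul_le_mul_of_nonneg_left (lpAmp_matrix_bound x _) (by positivity)
    _ ≤ ‖ccLp Measure.haar g‖ ^ 2 * (mnorm x ^ 2 *
        ∑ l, ‖ccLp Measure.haar f‖ ^ 2 * ‖v l‖ ^ 2) := by
        gcongr with l
        exact h2 _
    _ = _ := by
        rw [← Finset.mul_sum]
        ring

/-- Coefficients of `λ` given by compactly supported continuous functions are completely bounded
multipliers of `A(G)`. -/
theorem exists_isMulBy_vec_ccLp (f g : C_c(G, ℂ)) :
    ∃ P : CB (FourierAlgebra G) (FourierAlgebra G),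
      ‖P‖ ≤ ‖ccLp Measure.haar g‖ * ‖ccLp Measure.haar f‖ ∧
      IsMulBy P (FourierAlgebra.toFun
        (VNPredual.vec (groupVN G) (ccLp Measure.haar f) (ccLp Measure.haar g))) := by
  let L : VNSpace (groupVN G) →ₗ[ℂ] VNSpace (groupVN G) :=
    { toFun := fun T => ⟨actOp f g (VNSpace.incl _ T), actOp_mem f g T⟩
      map_add' := fun S T => (VNSpace.incl _).injective ((actOp f g).map_add _ _)
      map_smul' := fun c T => (VNSpace.incl _).injective ((actOp f g).map_smul _ _) }
  have hL : ∀ (κ : Type) [Fintype κ] (x : Matrix κ κ (VNSpace (groupVN G))),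
      mnorm (x.map L) ≤ ‖ccLp Measure.haar g‖ * ‖ccLp Measure.haar f‖ * mnorm x := fun κ _ x =>
    mnorm_map_actOp_le f g (x.map (VNSpace.incl _))
  -- Each λ(s) is an eigenvector of T ↦ v·T with eigenvalue v(s), so the preadjoint multiplies
  -- functions by v.
  obtain ⟨P, hP, hPL⟩ := VNPredual.exists_preadjoint (CB.ofBound L _ hL) fun ξ η =>
    ⟨VNPredual.vecSum (groupVN G) (orbitMap f ξ) (orbitMap g η),
      fun T => (inner_actOp f g T ξ η).symm⟩
  refine ⟨P, hP.trans (CB.norm_ofBound_le _ _ (by positivity) _), fun u s => ?_⟩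
  refine (hPL u (leftRegularVN s)).trans ?_
  have h : CB.ofBound L _ hL (leftRegularVN s) = FourierAlgebra.toFun
      (VNPredual.vec (groupVN G) (ccLp Measure.haar f) (ccLp Measure.haar g)) s •
      leftRegularVN s := (VNSpace.incl _).injective (actOp_leftRegular f g s)
  rw [h, map_smul]
  rfl

end Group

end

/-! ### A(G) inside M_cb(A(G)), and the function algebra A_cb(G) -/

noncomputable section

open OperatorSpace MeasureTheory
open scoped CompactlySupported

section Group

variable {G : Type*} [Group G] [TopologicalSpace G] [IsTopologicalGroup G] [LocallyCompactSpace G]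
  [MeasurableSpace G] [BorelSpace G]

/-- The coefficient of ζ and λ(s)ζ has the value ‖ζ‖² at s. Since A(G) thus has no common zero, a
multiplier determines its symbol. -/
theorem FourierAlgebra.exists_toFun_eq_one (s : G) : ∃ u : FourierAlgebra G, u.toFun s = 1 := by
  obtain ⟨f, hfc, hf0, hf1⟩ := exists_continuous_nonneg_pos (1 : G)
  let g : C_c(G, ℂ) := ⟨⟨fun x => (f x : ℂ), by fun_prop⟩, hfc.comp_left Complex.ofReal_zero⟩
  have hg : 0 < ‖ccLp Measure.haar g‖ ^ 2 := by
    rw [norm_sq_ccLp]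
    refine Continuous.integral_pos_of_hasCompactSupport_nonneg_nonzero (x := 1)
      (g.1.continuous.norm.pow 2) ?_ (fun x => by positivity) ?_
    · refine g.2.mono fun x hx hgx => hx ?_
      have : g x = 0 := hgx
      simp [this]
    · have : g 1 = (f 1 : ℂ) := rfl
      rw [this]
      simpa using hf1
  refine ⟨((‖ccLp Measure.haar g‖ : ℂ) ^ 2)⁻¹ •
    VNPredual.vec (groupVN G) (ccLp Measure.haar g) (leftRegular s (ccLp Measure.haar g)), ?_⟩
  rw [toFun_smul, toFun_vec, inner_self_eq_norm_sq_to_K, norm_leftRegular_apply]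
  exact inv_mul_cancel₀ (by exact_mod_cast hg.ne')

theorem IsMulBy.unique {S T : CB (FourierAlgebra G) (FourierAlgebra G)} {f : G → ℂ}
    (hS : IsMulBy S f) (hT : IsMulBy T f) : S = T :=
  CB.ext fun u => FourierAlgebra.ext_toFun fun s => by rw [hS, hT]

theorem IsMulBy.symbol_unique {T : CB (FourierAlgebra G) (FourierAlgebra G)} {f g : G → ℂ}
    (hf : IsMulBy T f) (hg : IsMulBy T g) : f = g := by
  funext s
  obtain ⟨u, hu⟩ := FourierAlgebra.exists_toFun_eq_one s
  have h := (hf u s).symm.trans (hg u s)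
  simpa [hu] using h

/-- A description of multipliers without the symbol, by equations continuous in T, so that the
multipliers form a closed set. The symbol is recovered at s by applying T to an element with value 1
there. -/
theorem mem_cbMultipliers_iff {T : CB (FourierAlgebra G) (FourierAlgebra G)} :
    T ∈ cbMultipliers G ↔ ∀ (u w : FourierAlgebra G) (s : G),
      (T u).toFun s * w.toFun s = (T w).toFun s * u.toFun s := by
  constructor
  · rintro ⟨f, hf⟩ u w s
    rw [hf, hf]
    ring
  · intro h
    choose w hw using FourierAlgebra.exists_toFun_eq_one (G := G)
    exact ⟨fun s => (T (w s)).toFun s, fun u s => by rw [← h, hw, mul_one]⟩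

theorem isClosed_cbMultipliers :
    IsClosed (cbMultipliers G : Set (CB (FourierAlgebra G) (FourierAlgebra G))) := by
  have h : (cbMultipliers G : Set (CB (FourierAlgebra G) (FourierAlgebra G))) =
      ⋂ (u : FourierAlgebra G) (w : FourierAlgebra G) (s : G),
        {T | FourierAlgebra.toFunL s (CB.evalCLM _ u T) * w.toFun s =
          FourierAlgebra.toFunL s (CB.evalCLM _ w T) * u.toFun s} := by
    ext T
    simp only [Set.mem_iInter]
    exact mem_cbMultipliers_iff
  rw [h]
  refine isClosed_iInter fun u => isClosed_iInter fun w => isClosed_iInter fun s => ?_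
  exact isClosed_eq (by fun_prop) (by fun_prop)

instance Mcb.instCompleteSpace : CompleteSpace (Mcb G) :=
  isClosed_cbMultipliers.completeSpace_coe

/-- Every element of `A(G)` is a completely bounded multiplier of `A(G)`. -/
theorem exists_isMulBy_toFun (v : FourierAlgebra G) :
    ∃ T : Mcb G, ‖T‖ ≤ 2 * ‖v‖ ∧ IsMulBy (Mcb.incl G T) v.toFun := by
  obtain ⟨c, hc, hv⟩ := VNPredual.exists_l1Combination_unitVec (groupVN G)
    (dense_range_ccLp (μ := (Measure.haar : Measure G)) (E := ℂ)) v
  -- A coefficient of two unit ball vectors from `C_c(G)` has a multiplier of norm at most 1, so the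
  -- ℓ¹ expansion of v converges in M_cb(A(G)) as well, with the constant 2 coming from the ℓ¹ norm.
  have hT : ∀ p, ∃ T : Mcb G, ‖T‖ ≤ 1 ∧ IsMulBy (Mcb.incl G T)
      (FourierAlgebra.toFun (VNPredual.unitVec (groupVN G)
        (ccLp (Measure.haar : Measure G) : C_c(G, ℂ) →ₗ[ℂ] _).range p)) := by
    rintro ⟨⟨⟨_, f, rfl⟩, ⟨_, g, rfl⟩⟩, hf, hg⟩
    obtain ⟨P, hP, hPm⟩ := exists_isMulBy_vec_ccLp f g
    exact ⟨⟨P, _, hPm⟩, hP.trans (mul_le_one₀ hg (norm_nonneg _) hf), hPm⟩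
  choose T hT1 hTm using hT
  refine ⟨l1Combination T hT1 c, ?_, fun u s => ?_⟩
  · refine (ContinuousLinearMap.le_of_opNorm_le (l1Combination T hT1) (c := 1) ?_ c).trans
      (by rwa [one_mul])
    refine (ContinuousLinearMap.opNorm_comp_le _ _).trans ?_
    exact mul_le_one₀ lp.norm_tsumCLM_le (norm_nonneg _) (lp.norm_mapCLM_le _ _ _ _)
  · have h1 := (hasSum_l1Combination T hT1 c).mapL (FourierAlgebra.toFunL s ∘L
      CB.evalCLM _ u ∘L (Mcb.incl G).toContinuousLinearMap)
    have h2 := (hv.mapL (FourierAlgebra.toFunL s)).mul_right (u.toFun s)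
    refine h1.unique ?_
    rw [show (fun p => (FourierAlgebra.toFunL s ∘L CB.evalCLM _ u ∘L
        (Mcb.incl G).toContinuousLinearMap) (c p • T p)) = fun p => FourierAlgebra.toFunL s (c p •
        VNPredual.unitVec (groupVN G) _ p) * u.toFun s from funext fun p => ?_]
    · exact h2
    · rw [map_smul, map_smul, smul_eq_mul, smul_eq_mul, mul_assoc]
      exact congrArg (c p * ·) (hTm p u s)

/-! ### The symbols of A_cb(G) and the embedding of A(G) -/

namespace Acb

instance instCompleteSpace : CompleteSpace (Acb G) :=
  (NonUnitalSubalgebra.isClosed_topologicalClosure (fourierMultipliers G)).completeSpace_coe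

theorem exists_isSymbol (T : Acb G) : ∃ f, T.IsSymbol f := (incl G T).2

/-- The function that an element of `A_cb(G)` is identified with. -/
def symbol (T : Acb G) : G → ℂ := T.exists_isSymbol.choose

theorem isSymbol_symbol (T : Acb G) : T.IsSymbol T.symbol := T.exists_isSymbol.choose_spec

theorem IsSymbol.eq {T : Acb G} {f : G → ℂ} (h : T.IsSymbol f) : T.symbol = f :=
  T.isSymbol_symbol.symbol_unique h

theorem ext_symbol {S T : Acb G} (h : S.symbol = T.symbol) : S = T := by
  have hS := S.isSymbol_symbol
  rw [h] at hS
  exact (incl G).injective ((Mcb.incl G).injective (IsMulBy.unique hS T.isSymbol_symbol))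

theorem symbol_add (S T : Acb G) (s : G) : (S + T).symbol s = S.symbol s + T.symbol s := by
  have h : (S + T).IsSymbol fun s => S.symbol s + T.symbol s := by
    rw [IsSymbol, map_add, map_add]
    exact IsMulBy.add S.isSymbol_symbol T.isSymbol_symbol
  rw [h.eq]

theorem symbol_smul (c : ℂ) (T : Acb G) (s : G) : (c • T).symbol s = c * T.symbol s := by
  have h : (c • T).IsSymbol fun s => c * T.symbol s := by
    rw [IsSymbol, map_smul, map_smul]
    exact IsMulBy.smul c T.isSymbol_symbol
  rw [h.eq]

theorem incl_mul (S T : Acb G) :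
    Mcb.incl G (incl G (S * T)) = Mcb.incl G (incl G S) * Mcb.incl G (incl G T) := rfl

theorem symbol_mul (S T : Acb G) (s : G) : (S * T).symbol s = S.symbol s * T.symbol s := by
  have h : (S * T).IsSymbol fun s => S.symbol s * T.symbol s := by
    rw [IsSymbol, incl_mul]
    exact IsMulBy.mul S.isSymbol_symbol T.isSymbol_symbol
  rw [h.eq]

theorem toFun_apply (T : Acb G) (u : FourierAlgebra G) (s : G) :
    (Mcb.incl G (incl G T) u).toFun s = T.symbol s * u.toFun s := T.isSymbol_symbol u s

theorem mul_comm (S T : Acb G) : S * T = T * S :=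
  ext_symbol (funext fun s => by rw [symbol_mul, symbol_mul, _root_.mul_comm])

/-- The evaluation of the elements of `A_cb(G)` at a point of `G`. -/
def evalL (s : G) : Acb G →L[ℂ] ℂ :=
  LinearMap.mkContinuousOfExistsBound
    { toFun := fun T => T.symbol s
      map_add' := fun S T => symbol_add S T s
      map_smul' := fun c T => symbol_smul c T s } (by
    -- With u(s) = 1, the value of the symbol at s is (Tu)(s), which is at most ‖T‖‖u‖.
    obtain ⟨u, hu⟩ := FourierAlgebra.exists_toFun_eq_one s
    refine ⟨‖u‖, fun T => ?_⟩
    have h := toFun_apply T u s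
    rw [hu, mul_one] at h
    change ‖T.symbol s‖ ≤ _
    rw [← h, _root_.mul_comm]
    exact (FourierAlgebra.norm_toFun_le _ s).trans
      (CB.norm_apply_le (Mcb.incl G (incl G T)) u))

@[simp]
theorem evalL_apply (s : G) (T : Acb G) : evalL s T = T.symbol s := rfl

theorem exists_isSymbol_toFun (v : FourierAlgebra G) :
    ∃ T : Acb G, ‖T‖ ≤ 2 * ‖v‖ ∧ T.IsSymbol v.toFun := by
  obtain ⟨T, hT, hTv⟩ := exists_isMulBy_toFun v
  exact ⟨⟨T, subset_closure ⟨v, hTv⟩⟩, hT, hTv⟩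

/-- The embedding of `A(G)` into `A_cb(G)`. -/
def ofFourier : FourierAlgebra G →L[ℂ] Acb G :=
  LinearMap.mkContinuous
    { toFun := fun v => (exists_isSymbol_toFun v).choose
      map_add' := fun v w => ext_symbol (by
        funext s
        rw [symbol_add, (exists_isSymbol_toFun (v + w)).choose_spec.2.eq,
          (exists_isSymbol_toFun v).choose_spec.2.eq, (exists_isSymbol_toFun w).choose_spec.2.eq,
          FourierAlgebra.toFun_add])
      map_smul' := fun c v => ext_symbol (by
        funext s
        rw [RingHom.id_apply, symbol_smul, (exists_isSymbol_toFun (c • v)).choose_spec.2.eq,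
          (exists_isSymbol_toFun v).choose_spec.2.eq, FourierAlgebra.toFun_smul]) }
    2 fun v => (exists_isSymbol_toFun v).choose_spec.1

@[simp]
theorem symbol_ofFourier (v : FourierAlgebra G) : (ofFourier v).symbol = v.toFun :=
  (exists_isSymbol_toFun v).choose_spec.2.eq

/-- A multiplier with symbol in A(G) is the image of that symbol, because the symbol determines the
operator. Identities between continuous maps on A_cb(G) can thus be checked on A(G). -/
theorem denseRange_ofFourier : DenseRange (ofFourier (G := G)) := by
  intro T
  obtain ⟨S, hS, hlim⟩ := mem_closure_iff_seq_limit.1 T.2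
  choose v hv using hS
  refine mem_closure_of_tendsto (b := Filter.atTop) (f := fun n => ofFourier (v n)) ?_
    (Filter.Eventually.of_forall fun n => ⟨v n, rfl⟩)
  have h : ∀ n, incl G (ofFourier (v n)) = S n := fun n => by
    refine (Mcb.incl G).injective (IsMulBy.unique (ofFourier (v n)).isSymbol_symbol ?_)
    rw [symbol_ofFourier]
    exact hv n
  rw [(incl G).isometry.isUniformInducing.isInducing.tendsto_nhds_iff]
  exact hlim.congr fun n => (h n).symm

theorem isQuantizedBanachAlgebra : IsQuantizedBanachAlgebra (Acb G) := by
  refine ⟨inferInstance, 1, fun ι κ _ _ a b => ?_⟩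
  rw [one_mul]
  exact CB.mnorm_mul_le (a.map fun T => Mcb.incl G (incl G T)) (b.map fun T => Mcb.incl G (incl G T))

end Acb

end Group

end

/-! ### Local behaviour of products in A(G) -/

noncomputable section

open OperatorSpace MeasureTheory
open scoped CompactlySupported Topology Pointwise

namespace VNPredual

variable {H : Type*} [NormedAddCommGroup H] [InnerProductSpace ℂ H] [CompleteSpace H]
  (M : VonNeumannAlgebra H) {I : Type*}

theorem vecSum_sub_left (ξ ξ' η : lp (fun _ : I => H) 2) :
    vecSum M (ξ - ξ') η = vecSum M ξ η - vecSum M ξ' η := by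
  refine ext_apply fun T => ?_
  rw [map_sub, CB.sub_apply, incl_vecSum, incl_vecSum, incl_vecSum, map_sub, inner_sub_right]

theorem vecSum_sub_right (ξ η η' : lp (fun _ : I => H) 2) :
    vecSum M ξ (η - η') = vecSum M ξ η - vecSum M ξ η' := by
  refine ext_apply fun T => ?_
  rw [map_sub, CB.sub_apply, incl_vecSum, incl_vecSum, incl_vecSum, inner_sub_left]

theorem norm_vecSum_sub_le (ξ ξ' η η' : lp (fun _ : I => H) 2) :
    ‖vecSum M ξ η - vecSum M ξ' η'‖ ≤ ‖η‖ * ‖ξ - ξ'‖ + ‖η - η'‖ * ‖ξ'‖ := by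
  have h : vecSum M ξ η - vecSum M ξ' η' =
      vecSum M (ξ - ξ') η + vecSum M ξ' (η - η') := by
    rw [vecSum_sub_left, vecSum_sub_right]; abel
  rw [h]
  exact (norm_add_le _ _).trans (add_le_add (norm_vecSum_le _ _ _) (norm_vecSum_le _ _ _))

end VNPredual

section Group

variable {G : Type*} [Group G] [TopologicalSpace G] [IsTopologicalGroup G] [LocallyCompactSpace G]
  [MeasurableSpace G] [BorelSpace G]

/-- The function `b ↦ f(b) ξ`. -/
def ccConst (f : C_c(G, ℂ)) (ξ : GroupL2 G) : C_c(G, GroupL2 G) where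
  toFun b := f b • ξ
  continuous_toFun := f.1.continuous.smul continuous_const
  hasCompactSupport' := by
    refine f.2.mono fun b hb hf => hb ?_
    have h : f b = 0 := hf
    exact (congrArg (· • ξ) h).trans (zero_smul ℂ _)

@[simp]
theorem ccConst_apply (f : C_c(G, ℂ)) (ξ : GroupL2 G) (b : G) : ccConst f ξ b = f b • ξ := rfl

theorem norm_ccSum (Ψ : C_c(G, GroupL2 G)) : ‖ccSum Ψ‖ = ‖ccLp Measure.haar Ψ‖ := norm_ccL2 _ _

theorem norm_ccSum_le_of_forall {Ψ : C_c(G, GroupL2 G)} {f : C_c(G, ℂ)} {δ : ℝ} (hδ : 0 ≤ δ)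
    (h : ∀ b, ‖Ψ b‖ ≤ δ * ‖f b‖) : ‖ccSum Ψ‖ ≤ δ * ‖ccLp Measure.haar f‖ := by
  rw [norm_ccSum, ← sq_le_sq₀ (norm_nonneg _) (by positivity), mul_pow, norm_sq_ccLp, norm_sq_ccLp,
    ← integral_const_mul]
  refine integral_mono (integrable_norm_sq_cc Ψ) ((integrable_norm_sq_cc f).const_mul _) fun b => ?_
  change ‖Ψ b‖ ^ 2 ≤ δ ^ 2 * ‖f b‖ ^ 2
  rw [← mul_pow]
  exact pow_le_pow_left₀ (norm_nonneg _) (h b) 2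

theorem norm_ccSum_ccConst_le (f : C_c(G, ℂ)) (ξ : GroupL2 G) :
    ‖ccSum (ccConst f ξ)‖ ≤ ‖ξ‖ * ‖ccLp Measure.haar f‖ :=
  norm_ccSum_le_of_forall (norm_nonneg _) fun b => by rw [ccConst_apply, norm_smul, mul_comm]

/-- If the orbit of ξ is nearly constant where f does not vanish, then W_f ξ is nearly an elementary
tensor; the error scales with ‖f‖, whatever the size of the support. -/
theorem norm_orbitMap_sub_ccConst_le {f : C_c(G, ℂ)} {ξ ξ' : GroupL2 G} {δ : ℝ} (hδ : 0 ≤ δ)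
    (h : ∀ b, f b ≠ 0 → ‖leftRegular b⁻¹ ξ - ξ'‖ ≤ δ) :
    ‖orbitMap f ξ - ccSum (ccConst f ξ')‖ ≤ δ * ‖ccLp Measure.haar f‖ := by
  rw [orbitMap_apply, ← map_sub]
  refine norm_ccSum_le_of_forall hδ fun b => ?_
  change ‖f b • leftRegular b⁻¹ ξ - f b • ξ'‖ ≤ _
  rw [← smul_sub, norm_smul, mul_comm]
  by_cases hb : f b = 0
  · simp [hb]
  · exact mul_le_mul_of_nonneg_right (h b hb) (norm_nonneg _)

/-- The amplified λ acts on the first tensor factor only, so the second one contributes the scalar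
⟨ξ, η⟩. -/
theorem vecSum_ccConst (f g : C_c(G, ℂ)) (ξ η : GroupL2 G) :
    VNPredual.vecSum (groupVN G) (ccSum (ccConst f ξ)) (ccSum (ccConst g η)) = inner ℂ η ξ •
      VNPredual.vec (groupVN G) (ccLp Measure.haar f) (ccLp Measure.haar g) := by
  refine FourierAlgebra.ext_toFun fun s => ?_
  rw [FourierAlgebra.toFun_smul, toFun_vecSum_ccSum, toFun_vec_ccLp, ← integral_const_mul]
  congr 1
  ext b
  rw [ccConst_apply, ccConst_apply, inner_smul_left, inner_smul_right]
  simp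
  ring

/-- Multiplication by a coefficient with support close to `x` is close to multiplication by the
value at `x`. -/
theorem norm_vecSum_orbitMap_sub_le {f g : C_c(G, ℂ)} {ξ η : GroupL2 G} {x : G} {δ : ℝ}
    (hδ : 0 ≤ δ) (hf : ∀ b, f b ≠ 0 → ‖leftRegular b⁻¹ ξ - ξ‖ ≤ δ)
    (hg : ∀ b, g b ≠ 0 → ‖leftRegular b⁻¹ η - leftRegular x⁻¹ η‖ ≤ δ) :
    ‖VNPredual.vecSum (groupVN G) (orbitMap f ξ) (orbitMap g η) - inner ℂ η (leftRegular x ξ) •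
      VNPredual.vec (groupVN G) (ccLp Measure.haar f) (ccLp Measure.haar g)‖ ≤
      δ * (‖η‖ + ‖ξ‖) * (‖ccLp Measure.haar f‖ * ‖ccLp Measure.haar g‖) := by
  -- The translation by x is moved to η: near 1 the orbit of ξ is close to ξ, and near x that of η
  -- is close to λ(x⁻¹)η.
  have h : inner ℂ η (leftRegular x ξ) = inner ℂ (leftRegular x⁻¹ η) ξ := by
    rw [← inner_leftRegular_apply x⁻¹, leftRegular_inv_apply_self]
  rw [h, ← vecSum_ccConst]
  refine (VNPredual.norm_vecSum_sub_le _ _ _ _ _).trans ?_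
  have h1 := norm_orbitMap_sub_ccConst_le hδ hf
  have h2 := norm_orbitMap_sub_ccConst_le hδ hg
  have h3 := norm_ccSum_ccConst_le f ξ
  have h4 : ‖orbitMap g η‖ ≤ ‖ccLp Measure.haar g‖ * ‖η‖ :=
    ContinuousLinearMap.le_of_opNorm_le _ (norm_orbitMap_le g) η
  calc _ ≤ (‖ccLp Measure.haar g‖ * ‖η‖) * (δ * ‖ccLp Measure.haar f‖) +
        (δ * ‖ccLp Measure.haar g‖) * (‖ξ‖ * ‖ccLp Measure.haar f‖) := by gcongr
    _ = _ := by ring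

/-- A real-valued continuous function of compact support as a complex-valued one. -/
def ccOfReal (h : C(G, ℝ)) (hh : HasCompactSupport h) (c : ℝ) : C_c(G, ℂ) :=
  ⟨⟨fun x => ((c * h x : ℝ) : ℂ), by fun_prop⟩, by
    refine hh.mono fun x hx h0 => hx ?_
    have : h x = 0 := h0
    simp [this]⟩

theorem toFun_vec_ccLp_eq_integral {f g : C_c(G, ℂ)} {s : G} (h : ∀ b, f (s⁻¹ * b) ≠ 0 → g b = 1) :
    FourierAlgebra.toFun (VNPredual.vec (groupVN G) (ccLp Measure.haar f) (ccLp Measure.haar g)) s =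
      ∫ b, f b ∂Measure.haar := by
  rw [toFun_vec_ccLp, ← integral_mul_left_eq_self (fun b => f b) s⁻¹]
  congr 1
  ext b
  by_cases hb : f (s⁻¹ * b) = 0
  · rw [hb, inner_zero_right]
  · rw [h b hb]; simp

theorem toFun_vec_ccLp_eq_zero {f g : C_c(G, ℂ)} {s : G} (h : ∀ b, f (s⁻¹ * b) = 0 ∨ g b = 0) :
    FourierAlgebra.toFun
      (VNPredual.vec (groupVN G) (ccLp Measure.haar f) (ccLp Measure.haar g)) s = 0 := by
  rw [toFun_vec_ccLp, integral_eq_zero_of_ae (Filter.Eventually.of_forall fun b => ?_)]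
  rcases h b with h | h <;> simp [h]

/-- Coefficients of `λ` that are `1` near `x`, given by functions with small supports. -/
theorem exists_cc_eventually_eq_one [T2Space G] (x : G) {U : Set G} (hU : U ∈ 𝓝 (1 : G)) :
    ∃ f g : C_c(G, ℂ), (∀ b, f b ≠ 0 → b ∈ U) ∧ (∀ b, g b ≠ 0 → x⁻¹ * b ∈ U) ∧
      ‖ccLp Measure.haar f‖ * ‖ccLp Measure.haar g‖ ≤ 2 ∧
      ∀ᶠ s in 𝓝 x, FourierAlgebra.toFun
        (VNPredual.vec (groupVN G) (ccLp Measure.haar f) (ccLp Measure.haar g)) s = 1 := by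
  -- The norm bound must not depend on U. To this end V ⊂ O have measures within a factor 2, and h,
  -- k are Urysohn functions with V ≺ h ≺ k ≺ O. With f = h/∫h and g the translate of k by x, ‖f‖² ≤
  -- 1/μ(V) and ‖g‖² ≤ 2μ(V).
  obtain ⟨V, hV, hVU, hVc⟩ := local_compact_nhds (interior_mem_nhds.2 hU)
  have hVpos : (Measure.haar : Measure G) V ≠ 0 := (Measure.measure_pos_of_mem_nhds _ hV).ne'
  have hVtop : (Measure.haar : Measure G) V ≠ ⊤ := hVc.measure_ne_top
  obtain ⟨O, hVO, hO, hOμ⟩ := hVc.exists_isOpen_lt_add (μ := (Measure.haar : Measure G)) hVpos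
  have hO' : IsOpen (O ∩ interior U) := hO.inter isOpen_interior
  have hV0 : 0 < (Measure.haar : Measure G).real V := ENNReal.toReal_pos hVpos hVtop
  have hμO : (Measure.haar : Measure G) (O ∩ interior U) ≤ Measure.haar V + Measure.haar V :=
    (measure_mono Set.inter_subset_left).trans hOμ.le
  have hμtop : (Measure.haar : Measure G) (O ∩ interior U) ≠ ⊤ :=
    (hμO.trans_lt (ENNReal.add_lt_top.2 ⟨hVtop.lt_top, hVtop.lt_top⟩)).ne
  have hμO' : (Measure.haar : Measure G).real (O ∩ interior U) ≤ 2 * Measure.haar.real V := by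
    have := ENNReal.toReal_mono (ENNReal.add_ne_top.2 ⟨hVtop, hVtop⟩) hμO
    rw [ENNReal.toReal_add hVtop hVtop] at this
    change _ ≤ 2 * (Measure.haar V).toReal
    rw [two_mul]; exact this
  obtain ⟨h, hh1, hhc, hhO, hh01⟩ := exists_continuousMap_one_of_isCompact_subset_isOpen hVc hO'
    (Set.subset_inter hVO hVU)
  obtain ⟨L, hL, hhL, hLO⟩ := exists_compact_between hhc hO' hhO
  obtain ⟨k, hk1, hkc, hkO, hk01⟩ := exists_continuousMap_one_of_isCompact_subset_isOpen hL hO' hLO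
  -- As long as x⁻¹s lies in W, the translate of the support of h stays where k = 1, so the
  -- coefficient at s is ∫ f = 1.
  obtain ⟨W, hW, hWL⟩ := compact_open_separated_mul_left hhc isOpen_interior hhL
  have hint : Integrable h (Measure.haar : Measure G) :=
    h.continuous.integrable_of_hasCompactSupport hhc
  set I : ℝ := ∫ b, h b ∂Measure.haar with hI
  have hVI : Measure.haar.real V ≤ I := by
    have h1 : ∫ b in V, h b ∂Measure.haar = Measure.haar.real V := by
      rw [setIntegral_congr_fun hVc.isClosed.measurableSet hh1]
      simp
    rw [← h1]
    exact setIntegral_le_integral hint (Filter.Eventually.of_forall fun b => (hh01 b).1)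
  have hI0 : 0 < I := hV0.trans_le hVI
  let f := ccOfReal h hhc I⁻¹
  let g := ccTranslate x (ccOfReal k hkc 1)
  have hfn : ‖ccLp Measure.haar f‖ ^ 2 ≤ I⁻¹ := by
    rw [norm_sq_ccLp]
    calc _ ≤ ∫ b, I⁻¹ ^ 2 * h b ∂Measure.haar := by
          refine integral_mono (integrable_norm_sq_cc f) (hint.const_mul _) fun b => ?_
          change ‖((I⁻¹ * h b : ℝ) : ℂ)‖ ^ 2 ≤ _
          rw [Complex.norm_real, Real.norm_eq_abs, sq_abs, mul_pow]
          exact mul_le_mul_of_nonneg_left (by nlinarith [(hh01 b).1, (hh01 b).2]) (by positivity)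
      _ = I⁻¹ := by
          rw [integral_const_mul, ← hI]
          field_simp
  have hgn : ‖ccLp Measure.haar g‖ ^ 2 ≤ 2 * Measure.haar.real V := by
    refine le_trans ?_ hμO'
    rw [← leftRegular_ccLp, norm_leftRegular_apply, norm_sq_ccLp]
    calc _ ≤ ∫ b, (O ∩ interior U).indicator (fun _ => (1 : ℝ)) b ∂Measure.haar := by
          refine integral_mono (integrable_norm_sq_cc _)
            ((integrable_indicator_iff hO'.measurableSet).2 (integrableOn_const hμtop)) fun b => ?_
          change ‖((1 * k b : ℝ) : ℂ)‖ ^ 2 ≤ _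
          by_cases hb : b ∈ O ∩ interior U
          · rw [Set.indicator_of_mem hb, one_mul, Complex.norm_real, Real.norm_eq_abs, sq_abs]
            nlinarith [(hk01 b).1, (hk01 b).2]
          · rw [Set.indicator_of_notMem hb, image_eq_zero_of_notMem_tsupport fun h => hb (hkO h)]
            simp
      _ = _ := by
          rw [integral_indicator hO'.measurableSet]
          simp
  refine ⟨f, g, fun b hb => ?_, fun b hb => ?_, ?_, ?_⟩
  · refine interior_subset (hhO (subset_tsupport _ fun h0 => hb ?_)).2
    change ((I⁻¹ * h b : ℝ) : ℂ) = 0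
    rw [h0]; simp
  · refine interior_subset (hkO (subset_tsupport _ fun h0 => hb ?_)).2
    change ((1 * k (x⁻¹ * b) : ℝ) : ℂ) = 0
    rw [h0]; simp
  · refine (sq_le_sq₀ (by positivity) (by norm_num)).1 ?_
    rw [mul_pow]
    calc _ ≤ I⁻¹ * (2 * Measure.haar.real V) :=
          mul_le_mul hfn hgn (by positivity) (by positivity)
      _ ≤ I⁻¹ * (2 * I) := by gcongr
      _ ≤ 2 ^ 2 := by field_simp; norm_num
  · have hx : ∀ᶠ s in 𝓝 x, x⁻¹ * s ∈ W := by
      have : Filter.Tendsto (fun s => x⁻¹ * s) (𝓝 x) (𝓝 1) := by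
        simpa using (continuous_const_mul x⁻¹).tendsto x
      exact this hW
    filter_upwards [hx] with s hs
    rw [toFun_vec_ccLp_eq_integral fun b hb => ?_]
    · change ∫ b, ((I⁻¹ * h b : ℝ) : ℂ) ∂Measure.haar = 1
      rw [integral_complex_ofReal, integral_const_mul, ← hI, inv_mul_cancel₀ hI0.ne']
      simp
    · have hb1 : s⁻¹ * b ∈ tsupport h := by
        refine subset_tsupport _ fun h0 => hb ?_
        change ((I⁻¹ * h (s⁻¹ * b) : ℝ) : ℂ) = 0
        rw [h0]; simp
      have hb2 : x⁻¹ * b ∈ L := interior_subset (hWL ⟨x⁻¹ * s, hs, s⁻¹ * b, hb1, by group⟩)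
      change ((1 * k (x⁻¹ * b) : ℝ) : ℂ) = 1
      rw [hk1 hb2]; simp

end Group

end

/-! ### Continuity, compact supports and bump functions in A(G) -/

noncomputable section

open OperatorSpace MeasureTheory
open scoped CompactlySupported Topology Pointwise

section Group

variable {G : Type*} [Group G] [TopologicalSpace G] [IsTopologicalGroup G] [LocallyCompactSpace G]
  [MeasurableSpace G] [BorelSpace G]

/-- Coefficients are continuous by strong continuity of λ, and the norm of A(G) dominates the
supremum norm, so uniform limits finish the argument. -/
theorem FourierAlgebra.continuous_toFun (u : FourierAlgebra G) : Continuous u.toFun := by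
  let N : Submodule ℂ (FourierAlgebra G) :=
    { carrier := {u | Continuous u.toFun}
      add_mem' := fun {u v} hu hv => by
        change Continuous (toFun (u + v))
        rw [funext (toFun_add u v)]
        exact Continuous.add hu hv
      zero_mem' := by
        change Continuous (toFun 0)
        rw [funext toFun_zero]
        exact continuous_const
      smul_mem' := fun c u hu => by
        change Continuous (toFun (c • u))
        rw [funext (toFun_smul c u)]
        exact Continuous.const_smul hu c }
  have hN : IsClosed (N : Set (FourierAlgebra G)) := by
    refine isClosed_of_closure_subset fun u hu => ?_
    refine continuous_of_uniform_approx_of_continuous fun V hV => ?_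
    obtain ⟨ε, hε, hεV⟩ := Metric.mem_uniformity_dist.1 hV
    obtain ⟨v, hv, huv⟩ := Metric.mem_closure_iff.1 hu ε hε
    refine ⟨v.toFun, hv, fun s => hεV ?_⟩
    rw [dist_eq_norm] at huv ⊢
    refine lt_of_le_of_lt ?_ huv
    exact (congrArg norm (map_sub (toFunL s) u v).symm).trans_le (norm_toFun_le (u - v) s)
  refine VNPredual.mem_of_isClosed_of_vec_mem (S := N) hN dense_univ (fun ξ _ η _ => ?_) u
  exact continuous_const.inner (continuous_leftRegular_apply ξ)

variable (G) in
/-- The functions of compact support in `A(G)`. -/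
def compactlySupportedFourier : Submodule ℂ (FourierAlgebra G) where
  carrier := {u | HasCompactSupport u.toFun}
  add_mem' := fun {u v} hu hv => by
    change HasCompactSupport (FourierAlgebra.toFun (u + v))
    rw [funext (FourierAlgebra.toFun_add u v)]
    exact HasCompactSupport.add hu hv
  zero_mem' := by
    change HasCompactSupport (FourierAlgebra.toFun 0)
    rw [funext FourierAlgebra.toFun_zero]
    exact HasCompactSupport.zero
  smul_mem' := fun c u hu => by
    change HasCompactSupport (FourierAlgebra.toFun (c • u))
    rw [funext (FourierAlgebra.toFun_smul c u)]
    exact HasCompactSupport.mul_left hu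

/-- The coefficient of f and g in `C_c(G)` vanishes outside supp g · (supp f)⁻¹, and such
coefficients span a dense subspace. -/
theorem dense_compactlySupportedFourier [T2Space G] :
    Dense (compactlySupportedFourier G : Set (FourierAlgebra G)) := by
  refine fun u => VNPredual.mem_of_isClosed_of_vec_mem
    (S := (compactlySupportedFourier G).topologicalClosure)
    (Submodule.isClosed_topologicalClosure _)
    (dense_range_ccLp (μ := (Measure.haar : Measure G)) (E := ℂ)) ?_ u
  rintro _ ⟨f, rfl⟩ _ ⟨g, rfl⟩
  refine Submodule.le_topologicalClosure _ ?_
  refine HasCompactSupport.intro (g.2.isCompact.mul f.2.isCompact.inv) fun s hs => ?_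
  refine toFun_vec_ccLp_eq_zero fun b => ?_
  by_contra! hb
  exact hs ⟨b, subset_tsupport _ hb.2, b⁻¹ * s,
    by rw [Set.mem_inv, mul_inv_rev, inv_inv]; exact subset_tsupport _ hb.1, by group⟩

/-- Locally at `x`, a coefficient of `λ` acts on `A(G)` almost as its value at `x`. -/
theorem exists_mul_near_smul [T2Space G] (ξ η : GroupL2 G) (x : G) {ε : ℝ} (hε : 0 < ε) :
    ∃ k w : FourierAlgebra G, (∀ᶠ s in 𝓝 x, k.toFun s = 1) ∧
      (∀ s, w.toFun s = FourierAlgebra.toFun (VNPredual.vec (groupVN G) ξ η) s * k.toFun s) ∧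
      ‖w - FourierAlgebra.toFun (VNPredual.vec (groupVN G) ξ η) x • k‖ < ε := by
  -- The factor 2 is the bound for ‖f‖‖g‖, available for every neighbourhood; the 1 in the
  -- denominator covers ξ = η = 0.
  obtain ⟨δ, hδ, hδε⟩ : ∃ δ : ℝ, 0 < δ ∧ δ * (‖η‖ + ‖ξ‖) * 2 < ε := by
    refine ⟨ε / (2 * (‖η‖ + ‖ξ‖) + 1), by positivity, ?_⟩
    rw [mul_assoc, div_mul_eq_mul_div, div_lt_iff₀ (by positivity)]
    nlinarith
  have h1 : ∀ᶠ b in 𝓝 (1 : G), ‖leftRegular b⁻¹ ξ - ξ‖ < δ := by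
    have hc : Continuous fun b : G => ‖leftRegular b⁻¹ ξ - ξ‖ :=
      (((continuous_leftRegular_apply ξ).comp continuous_inv).sub continuous_const).norm
    refine hc.tendsto 1 (gt_mem_nhds ?_)
    simpa [leftRegular_one] using hδ
  have h2 : ∀ᶠ b in 𝓝 (1 : G), ‖leftRegular (x * b)⁻¹ η - leftRegular x⁻¹ η‖ < δ := by
    have hc : Continuous fun b : G => ‖leftRegular (x * b)⁻¹ η - leftRegular x⁻¹ η‖ :=
      (((continuous_leftRegular_apply η).comp
        (continuous_const_mul x).inv).sub continuous_const).norm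
    refine hc.tendsto 1 (gt_mem_nhds ?_)
    simpa using hδ
  obtain ⟨f, g, hf, hg, hfg, hk⟩ := exists_cc_eventually_eq_one x (h1.and h2)
  refine ⟨_, VNPredual.vecSum (groupVN G) (orbitMap f ξ) (orbitMap g η), hk, fun s => ?_,
    lt_of_le_of_lt ?_ hδε⟩
  · rw [toFun_vecSum_orbitMap, mul_comm, toFun_vec ξ η]
  · refine (norm_vecSum_orbitMap_sub_le (x := x) hδ.le (fun b hb => (hf b hb).1.le)
      fun b hb => ?_).trans (mul_le_mul_of_nonneg_left hfg (by positivity))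
    have := (hg b hb).2.le
    rwa [mul_inv_cancel_left] at this

/-- If f and g live in U and xU, their coefficient lives in x U U⁻¹, which lies in O for small U. -/
theorem exists_toFun_bump [T2Space G] {x : G} {O : Set G} (hO : O ∈ 𝓝 x) :
    ∃ k : FourierAlgebra G, (∀ᶠ s in 𝓝 x, k.toFun s = 1) ∧ ∀ s ∉ O, k.toFun s = 0 := by
  have hc : Filter.Tendsto (fun p : G × G => x * p.1 * p.2⁻¹) (𝓝 1 ×ˢ 𝓝 1) (𝓝 x) := by
    have h : Continuous fun p : G × G => x * p.1 * p.2⁻¹ := by fun_prop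
    simpa [nhds_prod_eq] using h.tendsto ((1 : G), (1 : G))
  obtain ⟨U, hU, hUO⟩ := Filter.mem_prod_same_iff.1 (hc hO)
  obtain ⟨f, g, hf, hg, -, hk⟩ := exists_cc_eventually_eq_one x hU
  refine ⟨_, hk, fun s hs => toFun_vec_ccLp_eq_zero fun b => ?_⟩
  by_contra! hb
  refine hs ?_
  have h : x * (x⁻¹ * b) * (s⁻¹ * b)⁻¹ ∈ O :=
    @hUO (x⁻¹ * b, s⁻¹ * b) ⟨hg b hb.2, hf _ hb.1⟩
  rwa [show x * (x⁻¹ * b) * (s⁻¹ * b)⁻¹ = s by group] at h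

/-! ### The character space of A_cb(G) -/

namespace Acb

theorem symbol_sub (S T : Acb G) (s : G) : (S - T).symbol s = S.symbol s - T.symbol s :=
  map_sub (evalL s) S T

theorem ofFourier_eq_mul {u v w : FourierAlgebra G} (h : ∀ s, w.toFun s = u.toFun s * v.toFun s) :
    ofFourier w = ofFourier u * ofFourier v :=
  ext_symbol (funext fun s => by simp [symbol_mul, h])

/-- If k is 1 near x, the symbol of T agrees near x with the function of Tk, an element of A(G). -/
theorem continuous_symbol [T2Space G] (T : Acb G) : Continuous T.symbol := by
  refine continuous_iff_continuousAt.2 fun x => ?_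
  obtain ⟨k, hk, -⟩ := exists_toFun_bump (Filter.univ_mem (f := 𝓝 x))
  refine (FourierAlgebra.continuous_toFun (Mcb.incl G (incl G T) k)).continuousAt.congr ?_
  filter_upwards [hk] with s hs
  rw [toFun_apply, hs, mul_one]

/-- The character of `A_cb(G)` given by the evaluation at a point of `G`. -/
def evalChar (x : G) : WeakDual.characterSpace ℂ (Acb G) :=
  ⟨StrongDual.toWeakDual (evalL x), by
    obtain ⟨u, hu⟩ := FourierAlgebra.exists_toFun_eq_one x
    refine fun h => one_ne_zero (α := ℂ) ?_
    rw [← hu, ← symbol_ofFourier]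
    exact congrArg (fun φ : WeakDual ℂ (Acb G) => φ (ofFourier u)) h,
  fun S T => symbol_mul S T x⟩

@[simp]
theorem evalChar_apply (x : G) (T : Acb G) : evalChar x T = T.symbol x := rfl

theorem continuous_evalChar [T2Space G] : Continuous (evalChar (G := G)) :=
  Continuous.subtype_mk (WeakDual.continuous_of_continuous_eval fun T => continuous_symbol T) _

/-- A bump k at x that vanishes off O makes the weak-* open set φ(k) ≠ 0 pull back into O. -/
theorem isInducing_evalChar [T2Space G] : Topology.IsInducing (evalChar (G := G)) := by
  refine Topology.isInducing_iff_nhds.2 fun x =>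
    le_antisymm (continuous_evalChar.tendsto x).le_comap fun O hO => ?_
  obtain ⟨k, hk, hkO⟩ := exists_toFun_bump hO
  have hc : Continuous fun φ : WeakDual.characterSpace ℂ (Acb G) => φ (ofFourier k) :=
    (WeakDual.eval_continuous (ofFourier k)).comp continuous_subtype_val
  refine ⟨{φ | φ (ofFourier k) ≠ 0}, (isOpen_ne.preimage hc).mem_nhds ?_, fun s hs => ?_⟩
  · simp [hk.self_of_nhds]
  · by_contra hsO
    exact hs (by simp [hkO s hsO])

/-- A character is determined by its values on the image of `A(G)`. -/
theorem eq_evalChar_of_forall [T2Space G] {φ : WeakDual.characterSpace ℂ (Acb G)} {x : G}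
    (h : ∀ k : FourierAlgebra G, (∀ᶠ s in 𝓝 x, k.toFun s = 1) → φ (ofFourier k) = 1) :
    φ = evalChar x := by
  let F : FourierAlgebra G →L[ℂ] ℂ := WeakDual.CharacterSpace.toCLM φ ∘L ofFourier
  have hF : ∀ u, F u = φ (ofFourier u) := fun u => rfl
  have h1 : ∀ u : FourierAlgebra G, F u = FourierAlgebra.toFunL x u := by
    refine VNPredual.mem_of_isClosed_of_vec_mem (S := LinearMap.eqLocus F.toLinearMap (FourierAlgebra.toFunL x).toLinearMap)
      (isClosed_eq F.continuous (FourierAlgebra.toFunL x).continuous) dense_univ fun ξ _ η _ => ?_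
    refine LinearMap.mem_eqLocus.2 ?_
    change F (VNPredual.vec (groupVN G) ξ η) =
      FourierAlgebra.toFun (VNPredual.vec (groupVN G) ξ η) x
    set u := VNPredual.vec (groupVN G) ξ η
    rw [← sub_eq_zero, ← norm_le_zero_iff]
    refine le_of_forall_pos_le_add fun ε hε => ?_
    obtain ⟨k, w, hk, hw, hwk⟩ := exists_mul_near_smul ξ η x
      (show 0 < ε / (‖F‖ + 1) by positivity)
    -- With w = uk and φ(k) = 1, multiplicativity gives φ(w) = φ(u), while w is close to u(x)k in
    -- norm.
    have h2 : F w = F u := by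
      rw [hF, ofFourier_eq_mul hw, map_mul, h k hk, mul_one]; rfl
    have h3 : F (FourierAlgebra.toFun u x • k) = FourierAlgebra.toFun u x := by
      rw [map_smul, hF, h k hk, smul_eq_mul, mul_one]
    rw [← h3, ← h2, ← map_sub, zero_add]
    refine (F.le_opNorm_of_le hwk.le).trans ?_
    rw [mul_div_assoc', div_le_iff₀ (by positivity)]
    nlinarith [norm_nonneg F]
  refine WeakDual.CharacterSpace.ext fun T => ?_
  refine congrFun (denseRange_ofFourier.equalizer (WeakDual.CharacterSpace.toCLM φ).continuous
    (evalL x).continuous (funext fun u => ?_)) T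
  refine (h1 u).trans ?_
  simp

/-- If φ is no point evaluation, every x has some k equal to 1 near x with φ(k) ≠ 1. Finitely many
of these neighbourhoods cover the support of a compactly supported u, so u ∏(1 - k_i) = 0 and φ(u) =
0. Such u are dense, so φ = 0. -/
theorem surjective_evalChar [T2Space G] : Function.Surjective (evalChar (G := G)) := by
  intro φ
  by_contra! hφ
  have hk : ∀ x : G, ∃ k : FourierAlgebra G, (∀ᶠ s in 𝓝 x, k.toFun s = 1) ∧
      φ (ofFourier k) ≠ 1 := fun x => by
    by_contra! h
    exact hφ x (eq_evalChar_of_forall h).symm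
  -- Here b plays the role of a ∏(1 - k_i) for finitely many neighbourhoods covering K; compact
  -- induction builds it factor by factor.
  have key : ∀ K : Set G, IsCompact K → ∀ a : Acb G, ∃ b : Acb G, (φ b = 0 → φ a = 0) ∧
      ∀ s, s ∈ K ∨ a.symbol s = 0 → b.symbol s = 0 := by
    intro K hK
    refine hK.induction_on (p := fun K => ∀ a : Acb G, ∃ b : Acb G, (φ b = 0 → φ a = 0) ∧
      ∀ s, s ∈ K ∨ a.symbol s = 0 → b.symbol s = 0) ?_ ?_ ?_ ?_
    · exact fun a => ⟨a, id, fun s hs => hs.resolve_left fun h => h⟩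
    · intro s t hst ht a
      obtain ⟨b, hb, hb0⟩ := ht a
      exact ⟨b, hb, fun r hr => hb0 r (hr.imp_left fun h => hst h)⟩
    · intro s t hs ht a
      obtain ⟨b, hb, hb0⟩ := hs a
      obtain ⟨c, hc, hc0⟩ := ht b
      refine ⟨c, hb ∘ hc, fun r hr => hc0 r ?_⟩
      rcases hr with (hr | hr) | hr
      · exact Or.inr (hb0 r (Or.inl hr))
      · exact Or.inl hr
      · exact Or.inr (hb0 r (Or.inr hr))
    · intro x _
      obtain ⟨k, hk1, hkφ⟩ := hk x
      -- The product a(1 - k) is written as a - ak, so that no unit is needed in A_cb(G).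
      refine ⟨_, mem_nhdsWithin_of_mem_nhds hk1, fun a => ⟨a - a * ofFourier k, fun h => ?_, ?_⟩⟩
      · rw [map_sub, map_mul, ← mul_one_sub, mul_eq_zero, sub_eq_zero] at h
        exact h.resolve_right fun h => hkφ h.symm
      · intro s hs
        rw [symbol_sub, symbol_mul, symbol_ofFourier, ← mul_one_sub, mul_eq_zero, sub_eq_zero]
        exact hs.symm.imp_right Eq.symm
  refine φ.2.1 ?_
  refine ContinuousLinearMap.ext fun T => ?_
  refine congrFun (denseRange_ofFourier.equalizer (h := fun _ => (0 : ℂ))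
    (WeakDual.CharacterSpace.toCLM φ).continuous continuous_const ?_) T
  refine Continuous.ext_on dense_compactlySupportedFourier
    ((WeakDual.CharacterSpace.toCLM φ).continuous.comp ofFourier.continuous) continuous_const ?_
  intro u hu
  obtain ⟨b, hb, hb0⟩ := key _ (HasCompactSupport.isCompact hu) (ofFourier u)
  refine hb ?_
  -- On the support of u the factors 1 - k_i kill b, and elsewhere u does.
  have : b = 0 := ext_symbol (funext fun s => by
    rw [hb0 s ?_, ← evalL_apply, map_zero]
    rw [symbol_ofFourier]
    exact (em _).imp_right image_eq_zero_of_notMem_tsupport)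
  rw [this, map_zero]

variable (G) in
/-- The identification of `G` with the character space of `A_cb(G)`. -/
def evalHomeomorph [T2Space G] : G ≃ₜ WeakDual.characterSpace ℂ (Acb G) :=
  (Equiv.ofBijective evalChar
    ⟨isInducing_evalChar.injective, surjective_evalChar⟩).toHomeomorphOfIsInducing
    isInducing_evalChar

theorem isGelfandSemisimple : IsGelfandSemisimple (Acb G) := fun _ _ h =>
  ext_symbol (funext fun s => congrFun h (evalChar s))

theorem isRegularBanachAlgebra [T2Space G] : IsRegularBanachAlgebra (Acb G) := by
  intro F hF φ hφ
  obtain ⟨x, rfl⟩ := surjective_evalChar φ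
  obtain ⟨k, hk, hk0⟩ := exists_toFun_bump
    ((hF.isOpen_compl.preimage continuous_evalChar).mem_nhds hφ)
  refine ⟨ofFourier k, fun ψ hψ => ?_, ?_⟩
  · obtain ⟨y, rfl⟩ := surjective_evalChar ψ
    change (ofFourier k).symbol y = 0
    rw [symbol_ofFourier]
    exact hk0 y fun h => h hψ
  · change (ofFourier k).symbol x = 1
    rw [symbol_ofFourier]
    exact hk.self_of_nhds

/-- The homeomorphism turns compact support on G into compact support of the Gelfand transform, and
compactly supported elements of A(G) have dense image. -/
theorem isTauberian [T2Space G] : IsTauberian (Acb G) := by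
  refine (denseRange_ofFourier.dense_image ofFourier.continuous
    dense_compactlySupportedFourier).mono ?_
  rintro _ ⟨u, hu, rfl⟩
  have h : gelfandFun (ofFourier u) = u.toFun ∘ (evalHomeomorph G).symm := by
    funext ψ
    obtain ⟨y, rfl⟩ := (evalHomeomorph G).surjective ψ
    change (ofFourier u).symbol y = _
    rw [symbol_ofFourier, Function.comp_apply, Homeomorph.symm_apply_apply]
  change HasCompactSupport (gelfandFun (ofFourier u))
  rw [h]
  exact HasCompactSupport.comp_homeomorph hu _

end Acb

end Group

end

theorem mainTheorem10 (G : Type*) [Group G] [TopologicalSpace G] [IsTopologicalGroup G]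
    [LocallyCompactSpace G] [T2Space G] [MeasurableSpace G] [BorelSpace G] :
    -- `A(G)` is contained in `A_cb(G)`
    (∀ v : FourierAlgebra G, ∃ T : Acb G, T.IsSymbol (FourierAlgebra.toFun v)) ∧
    -- `A_cb(G)` is a quantized Banach algebra
    IsQuantizedBanachAlgebra (Acb G) ∧
    -- it is commutative, semisimple, regular and Tauberian
    (∀ S T : Acb G, S * T = T * S) ∧
    IsGelfandSemisimple (Acb G) ∧
    IsRegularBanachAlgebra (Acb G) ∧
    IsTauberian (Acb G) ∧
    -- point evaluation is a homeomorphism of `G` onto the character space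
    ∃ Φ : G ≃ₜ WeakDual.characterSpace ℂ (Acb G),
      ∀ (x : G) (T : Acb G) (f : G → ℂ), T.IsSymbol f → Φ x T = f x := by
  refine ⟨fun v => ?_, Acb.isQuantizedBanachAlgebra, Acb.mul_comm, Acb.isGelfandSemisimple,
    Acb.isRegularBanachAlgebra, Acb.isTauberian, Acb.evalHomeomorph G, fun x T f hf => ?_⟩
  · obtain ⟨T, -, hT⟩ := Acb.exists_isSymbol_toFun v
    exact ⟨T, hT⟩
  · exact congrFun hf.eq x
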